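/- Throughout, graphs are finite and simple, with vertex set $\{0,\dots,n-1\}$. A clique coloring of $G$ with $k$ colors is a map $\phi\colon V(G)\to\{0,\dots,k-1\}$ such that no inclusion-maximal clique of $G$ is monochromatic (a single isolated vertex counts as a maximal clique). A rooted branch decomposition of $G$ is a rooted subcubic tree $T$ (every node has at most two children, the root at most three) whose leaves, i.e. the nodes without children, are in bijection with $V(G)$. For a node $t$ let $V_t$ be the set of vertices at the leaves below $t$; the module-width of $T$ is the maximum, over all nodes $t$, of the number of classes of the relation $u\sim_t v \Leftrightarrow N_G(u)\setminus V_t=N_G(v)\setminus V_t$ on $V_t$. A clique-width $w$-expression builds $G$ from single labelled vertices by disjoint unions, adding all edges between labels $i\ne j$, and relabelling $i\to j$, with $w$ labels; the clique-width of $G$ is the least $w$ for which this is possible. Theorem. (1) There is an algorithm that, given a graph $G$ on $n$ vertices, one of its rooted branch decompositions $T$ and a positive integer $k$, decides whether $G$ has a clique coloring with $k$ colors, and outputs one if it exists, in time $|V(T)|^{O(1)}\cdot n^{2^{2^{O(w)}}}$, where $w$ is the module-width of $T$ (hence in time $n^{2^{2^{O(w)}}}$ whenever $|V(T)|=n^{O(1)}$,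 in particular if every internal node of $T$ has at least two children, since then $|V(T)|\le 2n-1$). (2) There is an algorithm that, given a graph $G$ on $n$ vertices, a clique-width $w$-expression with $m$ operations that builds $G$, and a positive integer $k$, does the same in time $m^{O(1)}\cdot n^{2^{2^{O(w)}}}$. Hence Clique Coloring, with a clique-width expression of the graph given in the input, is in XP parameterized by clique-width (the number of labels of the expression). All constants hidden in $O(\cdot)$ are absolute: precisely, for a constant $c$, the number of steps is at most $c\,|V(T)|^{c}\,n^{2^{2^{cw}}}$, respectively $c\,m^{c}\,n^{2^{2^{cw}}}$. Algorithms are programs of a first-order functional language over binary trees, with unit cost for each elementary operation (building a pair, taking a component, testing for nil, reading a variable, calling a function); graphs are given by adjacency matrices, and vertices, labels and $k$ in unary. -/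

import Mathlib

namespace CliqueCol

/-! ## Clique colorings -/

/-- `φ` is a clique coloring with `k` colors: no inclusion-maximal clique is monochromatic.
Color classes may be empty, and all maximal cliques count, also those on a single vertex. -/
def IsCliqueColoring {V : Type*} (G : SimpleGraph V) {k : ℕ} (φ : V → Fin k) : Prop :=
  ∀ X : Set V, Maximal G.IsClique X → ¬ ∃ i : Fin k, ∀ v ∈ X, φ v = i

/-! ## Rooted branch decompositions and module-width -/

/-- Rooted trees whose leaves (the nodes without children) are labelled by elements of `V`, and in
which every node has at most three children. -/
inductive RTree (V : Type*) where
  | leaf (v : V) : RTree V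
  | node1 (t : RTree V) : RTree V
  | node2 (s t : RTree V) : RTree V
  | node3 (r s t : RTree V) : RTree V

namespace RTree

variable {V : Type*}

/-- The list of labels of the leaves; as a set, this is `V_t` for the root `t` of the tree. -/
def leaves : RTree V → List V
  | leaf v => [v]
  | node1 t => t.leaves
  | node2 s t => s.leaves ++ t.leaves
  | node3 r s t => r.leaves ++ s.leaves ++ t.leaves

/-- The set `V_t` of labels of the leaves below the root `t` of the tree. -/
def leafSet (T : RTree V) : Set V := {v | v ∈ T.leaves}

/-- The number of nodes. -/
def numNodes : RTree V → ℕ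
  | leaf _ => 1
  | node1 t => t.numNodes + 1
  | node2 s t => s.numNodes + t.numNodes + 1
  | node3 r s t => r.numNodes + s.numNodes + t.numNodes + 1

/-- No node has three children. -/
def AtMostBinary : RTree V → Prop
  | leaf _ => True
  | node1 t => t.AtMostBinary
  | node2 s t => s.AtMostBinary ∧ t.AtMostBinary
  | node3 _ _ _ => False

/-- Every node has degree at most three: only the root, which has no parent, may have three
children. -/
def Subcubic : RTree V → Prop
  | leaf _ => True
  | node1 t => t.AtMostBinary
  | node2 s t => s.AtMostBinary ∧ t.AtMostBinary
  | node3 r s t => r.AtMostBinary ∧ s.AtMostBinary ∧ t.AtMostBinary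

end RTree

/-- A rooted branch decomposition of a graph with vertex set `V`: a rooted subcubic tree whose
leaves are in bijection with `V`. -/
structure IsRootedBranchDecomposition {V : Type*} (T : RTree V) : Prop where
  subcubic : T.Subcubic
  nodup : T.leaves.Nodup
  complete : ∀ v : V, v ∈ T.leaves

/-- The equivalence relation on `S`: the same neighbors outside `S`. -/
def outsideSetoid {V : Type*} (G : SimpleGraph V) (S : Set V) : Setoid S where
  r u v := G.neighborSet u ∩ Sᶜ = G.neighborSet v ∩ Sᶜ
  iseqv := ⟨fun _ => rfl, fun h => h.symm, fun h h' => h.trans h'⟩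

/-- The number of classes of vertices of `S` with the same neighbors outside `S`. -/
noncomputable def numClasses {V : Type*} (G : SimpleGraph V) (S : Set V) : ℕ :=
  Nat.card (Quotient (outsideSetoid G S))

/-- The module-width: the maximum of `numClasses G V_t` over all nodes `t` of the tree. -/
noncomputable def moduleWidth {V : Type*} (G : SimpleGraph V) : RTree V → ℕ
  | .leaf v => numClasses G (RTree.leaf v).leafSet
  | .node1 t => max (numClasses G (RTree.node1 t).leafSet) (moduleWidth G t)
  | .node2 s t => max (numClasses G (RTree.node2 s t).leafSet)
      (max (moduleWidth G s) (moduleWidth G t))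
  | .node3 r s t => max (numClasses G (RTree.node3 r s t).leafSet)
      (max (moduleWidth G r) (max (moduleWidth G s) (moduleWidth G t)))

/-! ## Clique-width expressions -/

/-- Clique-width expressions with labels in `Fin w`: create a vertex `v` with label `i`; take a
disjoint union; add all edges between label `i` and label `j ≠ i`; relabel `i` to `j`. -/
inductive CWExpr (V : Type*) (w : ℕ) where
  | single (v : V) (i : Fin w) : CWExpr V w
  | union (a b : CWExpr V w) : CWExpr V w
  | join (i j : Fin w) (h : i ≠ j) (a : CWExpr V w) : CWExpr V w
  | relabel (i j : Fin w) (a : CWExpr V w) : CWExpr V w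

namespace CWExpr

variable {V : Type*} {w : ℕ}

/-- The vertices created by the expression. -/
def verts : CWExpr V w → List V
  | single v _ => [v]
  | union a b => a.verts ++ b.verts
  | join _ _ _ a => a.verts
  | relabel _ _ a => a.verts

/-- `e.HasLabel v l`: in the labelled graph built by `e`, the vertex `v` has label `l`. -/
def HasLabel : CWExpr V w → V → Fin w → Prop
  | single u i, v, l => v = u ∧ l = i
  | union a b, v, l => a.HasLabel v l ∨ b.HasLabel v l
  | join _ _ _ a, v, l => a.HasLabel v l
  | relabel i j a, v, l => (a.HasLabel v i ∧ l = j) ∨ (a.HasLabel v l ∧ l ≠ i)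

/-- Adjacency in the labelled graph built by the expression. -/
def Adj : CWExpr V w → V → V → Prop
  | single _ _, _, _ => False
  | union a b, u, v => a.Adj u v ∨ b.Adj u v
  | join i j _ a, u, v => a.Adj u v ∨ (a.HasLabel u i ∧ a.HasLabel v j) ∨
      (a.HasLabel u j ∧ a.HasLabel v i)
  | relabel _ _ a, u, v => a.Adj u v

/-- The number of operations of the expression. -/
def numNodes : CWExpr V w → ℕ
  | single _ _ => 1
  | union a b => a.numNodes + b.numNodes + 1
  | join _ _ _ a => a.numNodes + 1
  | relabel _ _ a => a.numNodes + 1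

/-- The expression builds `G`: it creates every vertex exactly once (so all unions are disjoint) and
the edges of the resulting graph are those of `G`. -/
structure Builds (e : CWExpr V w) (G : SimpleGraph V) : Prop where
  nodup : e.verts.Nodup
  complete : ∀ v : V, v ∈ e.verts
  adj_iff : ∀ u v : V, G.Adj u v ↔ e.Adj u v

end CWExpr

/-! ## The machine model

A first-order functional language over binary trees (pure LISP with the single atom `nil`), with
mutually recursive functions and unit-cost steps. Every step allocates at most one cell, follows at
most one pointer, tests one pointer for `nil`, or enters a function body, so this is the usual cost of
a pointer machine, and running times agree with those of multitape Turing machines or logarithmic-cost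
RAMs up to a polynomial. -/

/-- Data values: binary trees. -/
inductive Data where
  | nil : Data
  | cons (a b : Data) : Data

namespace Data

/-- The first component, with `hd nil = nil`. -/
def hd : Data → Data
  | nil => nil
  | cons a _ => a

/-- The second component, with `tl nil = nil`. -/
def tl : Data → Data
  | nil => nil
  | cons _ b => b

end Data

/-- Terms of the language. `var i` is the `i`-th entry of the environment; `cond c a b` is `a` if `c`
is not `nil`, and `b` if it is; `bind a b` evaluates `b` with the value of `a` put in front of the
environment; `call f a` applies the `f`-th function to the value of `a`. -/
inductive Term where
  | var (i : ℕ) : Term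
  | nil : Term
  | cons (a b : Term) : Term
  | hd (a : Term) : Term
  | tl (a : Term) : Term
  | cond (c a b : Term) : Term
  | bind (a b : Term) : Term
  | call (f : ℕ) (a : Term) : Term

/-- A program: the bodies of its functions. Each function has one argument, which is the only entry
of the environment of its body. Function `0` is the main one. -/
abbrev Program := List Term

/-- `Eval P ρ a x t`: in the environment `ρ`, the term `a` evaluates to `x` in exactly `t` steps. -/
inductive Eval (P : Program) : List Data → Term → Data → ℕ → Prop where
  | var (ρ : List Data) (i : ℕ) : Eval P ρ (.var i) (ρ.getD i .nil) 1
  | nil (ρ : List Data) : Eval P ρ .nil .nil 1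
  | cons {ρ : List Data} {a b : Term} {x y : Data} {s t : ℕ} :
      Eval P ρ a x s → Eval P ρ b y t → Eval P ρ (.cons a b) (.cons x y) (s + t + 1)
  | hd {ρ : List Data} {a : Term} {x : Data} {s : ℕ} :
      Eval P ρ a x s → Eval P ρ (.hd a) x.hd (s + 1)
  | tl {ρ : List Data} {a : Term} {x : Data} {s : ℕ} :
      Eval P ρ a x s → Eval P ρ (.tl a) x.tl (s + 1)
  | cond_cons {ρ : List Data} {c a b : Term} {x x' y : Data} {s t : ℕ} :
      Eval P ρ c (.cons x x') s → Eval P ρ a y t → Eval P ρ (.cond c a b) y (s + t + 1)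
  | cond_nil {ρ : List Data} {c a b : Term} {y : Data} {s t : ℕ} :
      Eval P ρ c .nil s → Eval P ρ b y t → Eval P ρ (.cond c a b) y (s + t + 1)
  | bind {ρ : List Data} {a b : Term} {x y : Data} {s t : ℕ} :
      Eval P ρ a x s → Eval P (x :: ρ) b y t → Eval P ρ (.bind a b) y (s + t + 1)
  | call {ρ : List Data} {f : ℕ} {a : Term} {x y : Data} {s t : ℕ} :
      Eval P ρ a x s → Eval P [x] (P.getD f .nil) y t → Eval P ρ (.call f a) y (s + t + 1)

/-- Evaluation is deterministic, in its result and in its number of steps. -/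
theorem Eval.unique {P : Program} {ρ : List Data} {a : Term} {x : Data} {s : ℕ}
    (h : Eval P ρ a x s) : ∀ {y : Data} {t : ℕ}, Eval P ρ a y t → x = y ∧ s = t := by
  induction h with
  | var ρ i => intro y t h; cases h; exact ⟨rfl, rfl⟩
  | nil ρ => intro y t h; cases h; exact ⟨rfl, rfl⟩
  | cons _ _ ih1 ih2 =>
    intro y t h
    cases h with
    | cons h1 h2 => obtain ⟨rfl, rfl⟩ := ih1 h1; obtain ⟨rfl, rfl⟩ := ih2 h2; exact ⟨rfl, rfl⟩
  | hd _ ih =>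
    intro y t h
    cases h with
    | hd h1 => obtain ⟨rfl, rfl⟩ := ih h1; exact ⟨rfl, rfl⟩
  | tl _ ih =>
    intro y t h
    cases h with
    | tl h1 => obtain ⟨rfl, rfl⟩ := ih h1; exact ⟨rfl, rfl⟩
  | cond_cons _ _ ih1 ih2 =>
    intro y t h
    cases h with
    | cond_cons h1 h2 =>
      obtain ⟨_, rfl⟩ := ih1 h1; obtain ⟨rfl, rfl⟩ := ih2 h2; exact ⟨rfl, rfl⟩
    | cond_nil h1 h2 => cases (ih1 h1).1
  | cond_nil _ _ ih1 ih2 =>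
    intro y t h
    cases h with
    | cond_cons h1 h2 => cases (ih1 h1).1
    | cond_nil h1 h2 =>
      obtain ⟨_, rfl⟩ := ih1 h1; obtain ⟨rfl, rfl⟩ := ih2 h2; exact ⟨rfl, rfl⟩
  | bind _ _ ih1 ih2 =>
    intro y t h
    cases h with
    | bind h1 h2 => obtain ⟨rfl, rfl⟩ := ih1 h1; obtain ⟨rfl, rfl⟩ := ih2 h2; exact ⟨rfl, rfl⟩
  | call _ _ ih1 ih2 =>
    intro y t h
    cases h with
    | call h1 h2 => obtain ⟨rfl, rfl⟩ := ih1 h1; obtain ⟨rfl, rfl⟩ := ih2 h2; exact ⟨rfl, rfl⟩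

/-- The program `P` halts on `input` with result `output` after exactly `t` steps. -/
def Runs (P : Program) (input output : Data) (t : ℕ) : Prop :=
  Eval P [input] (P.getD 0 .nil) output t

/-! ## Inputs and outputs -/

namespace Data

/-- A natural number, as the list of that many `nil`s. -/
def ofNat : ℕ → Data
  | 0 => nil
  | m + 1 => cons nil (ofNat m)

/-- A list of data. -/
def ofList : List Data → Data
  | [] => nil
  | x :: l => cons x (ofList l)

open Classical in
/-- A graph on `{0, …, n - 1}`, by its adjacency matrix, as a list of rows. -/
noncomputable def ofGraph {n : ℕ} (G : SimpleGraph (Fin n)) : Data :=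
  ofList (List.ofFn fun i : Fin n => ofList (List.ofFn fun j : Fin n =>
    ofNat (if G.Adj i j then 1 else 0)))

/-- A rooted tree: each node is its number of children, followed by its label or its children. -/
def ofTree {n : ℕ} : RTree (Fin n) → Data
  | .leaf v => cons (ofNat 0) (ofNat v)
  | .node1 t => cons (ofNat 1) (ofTree t)
  | .node2 s t => cons (ofNat 2) (cons (ofTree s) (ofTree t))
  | .node3 r s t => cons (ofNat 3) (cons (ofTree r) (cons (ofTree s) (ofTree t)))

/-- A clique-width expression: each operation is its number, followed by its arguments. -/
def ofCWExpr {n w : ℕ} : CWExpr (Fin n) w → Data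
  | .single v i => cons (ofNat 0) (cons (ofNat v) (ofNat i))
  | .union a b => cons (ofNat 1) (cons (ofCWExpr a) (ofCWExpr b))
  | .join i j _ a => cons (ofNat 2) (cons (ofNat i) (cons (ofNat j) (ofCWExpr a)))
  | .relabel i j a => cons (ofNat 3) (cons (ofNat i) (cons (ofNat j) (ofCWExpr a)))

/-- A coloring, as the list of the colors of the vertices `0, …, n - 1`. -/
def ofColoring {n k : ℕ} (φ : Fin n → Fin k) : Data :=
  ofList (List.ofFn fun v : Fin n => ofNat (φ v))

end Data

/-- `output` is a correct answer for `(G, k)`: it is `nil` if `G` has no clique coloring with `k`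
colors, and otherwise it is `cons nil d` where `d` is such a coloring. -/
def IsAnswer {n : ℕ} (G : SimpleGraph (Fin n)) (k : ℕ) (output : Data) : Prop :=
  ((¬ ∃ φ : Fin n → Fin k, IsCliqueColoring G φ) ∧ output = .nil) ∨
  ∃ φ : Fin n → Fin k, IsCliqueColoring G φ ∧ output = .cons .nil (Data.ofColoring φ)

end CliqueCol

-- A coloring is a clique coloring exactly when every clique `X` inside a color class `C`, the empty
-- clique included, has a common neighbor outside `C` (`isCliqueColoring_iff`). So color classes can
-- be judged one at a time.
--
-- Let `L` be the vertex set below a tree node. A vertex outside `L` cannot distinguish two vertices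
-- of `L` with the same neighbors outside `L`. For a clique `X` in `C ⊆ L` it is therefore enough to
-- remember its profile: the neighborhood classes met by `X`, and those containing a vertex of `L \
-- C` adjacent to all of `X`. The type of `C` is the set of profiles of its cliques; with `r`
-- neighborhood classes there are `4 ^ r` pairs of sets of representatives and so at most `2 ^ 4 ^
-- r` types. When disjoint sets `L₁`, `L₂` are united, the type of `C₁ ∪ C₂` is determined by those
-- of `C₁` and `C₂` (`mergeTypes_eq`), and at the root a class is good iff no profile in its type
-- has an empty second component (`typeOf_good_iff`).
--
-- Colors are interchangeable, so a partial coloring matters only through the multiset of types of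
-- its classes. At a node it suffices to try every multiset of pairs of types, saying how classes of
-- the two children are united, and to keep one partial coloring for each. Every table entry is a
-- genuine partial coloring (`isEntry_of_mem_value`), and every coloring has an entry with the same
-- multiset of types (`exists_mem_value`). Since more than `n` colors never help, `k` may be
-- replaced by `min n k`, and the tables have size `n ^ 2 ^ 2 ^ O(w)`.
--
-- Both kinds of input become binary trees of bounded width: a ternary node is split at the cost of
-- a factor two (`RTree.widthLE`), and in a clique-width expression vertices with equal labels have
-- equal outside neighborhoods (`CWExpr.widthLE`).
--
-- For the running time, `Comp` and `Poly` are shown to be closed under the usual constructions on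
-- lists; `PT` does the same relative to a measure that may be exponential in the width, and
-- everything is polynomial in `TreeInstance.bound`.

namespace CliqueCol

/-! ## Linking programs -/

/-- Move all calls to functions with index `f < N` to index `f + k`; calls to undefined functions
are replaced by evaluations of `nil` that take equally long. -/
def Term.reloc (N k : ℕ) : Term → Term
  | .var i => .var i
  | .nil => .nil
  | .cons a b => .cons (a.reloc N k) (b.reloc N k)
  | .hd a => .hd (a.reloc N k)
  | .tl a => .tl (a.reloc N k)
  | .cond c a b => .cond (c.reloc N k) (a.reloc N k) (b.reloc N k)
  | .bind a b => .bind (a.reloc N k) (b.reloc N k)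
  | .call f a => if f < N then .call (f + k) (a.reloc N k) else .bind (a.reloc N k) .nil

/-- The derivation is copied rule by rule, so the exact number of steps survives. The delicate rule
is a call beyond the end of `P`: there the body is the default `nil`, but the shifted index may be
occupied in `Q`, so the call has been replaced by a `bind` into `nil`, which costs the same. -/
theorem Eval.reloc {P Q : Program} {k : ℕ}
    (h : ∀ f < P.length, Q.getD (f + k) .nil = (P.getD f .nil).reloc P.length k)
    {ρ : List Data} {a : Term} {x : Data} {t : ℕ} (e : Eval P ρ a x t) :
    Eval Q ρ (a.reloc P.length k) x t := by
  induction e with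
  | var ρ i => exact .var ρ i
  | nil ρ => exact .nil ρ
  | cons _ _ ih1 ih2 => exact .cons ih1 ih2
  | hd _ ih => exact .hd ih
  | tl _ ih => exact .tl ih
  | cond_cons _ _ ih1 ih2 => exact .cond_cons ih1 ih2
  | cond_nil _ _ ih1 ih2 => exact .cond_nil ih1 ih2
  | bind _ _ ih1 ih2 => exact .bind ih1 ih2
  | @call ρ f a x y s t _ h2 ih1 ih2 =>
    by_cases hf : f < P.length
    · rw [Term.reloc, if_pos hf]
      refine .call ih1 ?_
      rw [h f hf]
      exact ih2
    · rw [Term.reloc, if_neg hf]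
      rw [List.getD_eq_default _ _ (not_lt.mp hf)] at h2
      cases h2
      exact .bind ih1 (.nil _)

/-- Puts three programs under a common main body. That body is a function `b` of the three entry
points because their indices depend on the lengths of the programs; it may also call index `0`,
which gives recursion. -/
theorem exists_link (b : ℕ → ℕ → ℕ → Term) (p q r : Program) :
    ∃ (Q : Program) (i j k : ℕ), Q.getD 0 .nil = b i j k ∧
      (∀ x y t, Runs p x y t → Eval Q [x] (Q.getD i .nil) y t) ∧
      (∀ x y t, Runs q x y t → Eval Q [x] (Q.getD j .nil) y t) ∧
      (∀ x y t, Runs r x y t → Eval Q [x] (Q.getD k .nil) y t) := by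
  -- An empty program has no function `0` to relocate. Appending an explicit `nil` makes the list
  -- nonempty and changes no lookup, since `nil` is the default.
  have pad : ∀ (p : Program) (x y : Data) (t : ℕ), Runs p x y t →
      Runs (p ++ [Term.nil]) x y t := by
    intro p x y t h
    have hget : ∀ f, (p ++ [Term.nil]).getD f Term.nil = p.getD f Term.nil := by
      intro f
      rcases lt_or_ge f p.length with hf | hf
      · rw [List.getD_append _ _ _ _ hf]
      · rw [List.getD_append_right _ _ _ _ hf, List.getD_eq_default _ _ hf]
        cases f - p.length <;> rfl
    unfold Runs at h ⊢
    rw [hget]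
    generalize p.getD 0 Term.nil = a at h
    revert h
    generalize [x] = ρ
    intro e
    induction e with
    | var ρ i => exact .var ρ i
    | nil ρ => exact .nil ρ
    | cons _ _ ih1 ih2 => exact .cons ih1 ih2
    | hd _ ih => exact .hd ih
    | tl _ ih => exact .tl ih
    | cond_cons _ _ ih1 ih2 => exact .cond_cons ih1 ih2
    | cond_nil _ _ ih1 ih2 => exact .cond_nil ih1 ih2
    | bind _ _ ih1 ih2 => exact .bind ih1 ih2
    | call _ _ ih1 ih2 => exact .call ih1 (by rw [hget]; exact ih2)
  obtain ⟨p', hp', hp⟩ : ∃ p' : Program, 0 < p'.length ∧ ∀ x y t, Runs p x y t → Runs p' x y t :=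
    ⟨_, by simp, pad p⟩
  obtain ⟨q', hq', hq⟩ : ∃ p' : Program, 0 < p'.length ∧ ∀ x y t, Runs q x y t → Runs p' x y t :=
    ⟨_, by simp, pad q⟩
  obtain ⟨r', hr', hr⟩ : ∃ p' : Program, 0 < p'.length ∧ ∀ x y t, Runs r x y t → Runs p' x y t :=
    ⟨_, by simp, pad r⟩
  have key : ∀ (p : Program) (A B : Program), 0 < p.length →
      ∀ x y t, Runs p x y t →
        Eval (A ++ p.map (Term.reloc p.length A.length) ++ B) [x]
          ((A ++ p.map (Term.reloc p.length A.length) ++ B).getD A.length .nil) y t := by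
    intro p A B h0 x y t h
    have hh : ∀ f < p.length,
        (A ++ p.map (Term.reloc p.length A.length) ++ B).getD (f + A.length) Term.nil =
          (p.getD f Term.nil).reloc p.length A.length := by
      intro f hf
      rw [List.getD_append _ _ _ _ (by simp; omega), List.getD_append_right _ _ _ _ (by omega)]
      simp [List.getD_eq_getElem?_getD, hf]
    have := Eval.reloc hh h
    rw [← hh 0 h0] at this
    simpa using this
  -- Index `0` holds the new main body; the three relocated blocks follow it.
  let i := 1
  let j := 1 + p'.length
  let k := 1 + p'.length + q'.length
  let P := p'.map (Term.reloc p'.length i)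
  let R := q'.map (Term.reloc q'.length j)
  let S := r'.map (Term.reloc r'.length k)
  refine ⟨[b i j k] ++ P ++ R ++ S, i, j, k, rfl, fun x y t h => ?_, fun x y t h => ?_,
    fun x y t h => ?_⟩
  · have := key p' [b i j k] (R ++ S) hp' x y t (hp x y t h)
    rw [← List.append_assoc] at this
    exact this
  · have := key q' ([b i j k] ++ P) S hq' x y t (hq x y t h)
    simpa [R, P, j, List.append_assoc, Nat.add_comm] using this
  · have := key r' ([b i j k] ++ P ++ R) [] hr' x y t (hr x y t h)
    have e : ([b i j k] ++ P ++ R).length = k := by simp [P, R, k]; omega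
    rw [e] at this
    simpa [S, List.append_assoc] using this

/-! ## Encodings -/

/-- The number of cells of a value, with `nil` counted as `1`. -/
def Data.size : Data → ℕ
  | .nil => 1
  | .cons a b => a.size + b.size + 1

/-- Types whose elements are represented by data. -/
class Enc (α : Type) where
  enc : α → Data

/-- Representations that determine the element. -/
class EncInj (α : Type) [Enc α] : Prop where
  inj : ∀ {a b : α}, Enc.enc a = Enc.enc b → a = b

open Enc (enc)

instance : Enc Data := ⟨id⟩
instance : Enc Bool := ⟨fun b => if b then .cons .nil .nil else .nil⟩
instance : Enc ℕ := ⟨Data.ofNat⟩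
instance {α β : Type} [Enc α] [Enc β] : Enc (α × β) := ⟨fun p => .cons (enc p.1) (enc p.2)⟩
instance {α : Type} [Enc α] : Enc (List α) := ⟨fun l => .ofList (l.map enc)⟩
instance {α : Type} [Enc α] : Enc (Option α) :=
  ⟨fun o => match o with
    | none => .nil
    | some a => .cons .nil (enc a)⟩

section
variable {α β : Type} [Enc α] [Enc β]

@[simp] theorem enc_true : enc true = .cons .nil .nil := rfl
@[simp] theorem enc_false : enc false = .nil := rfl
@[simp] theorem enc_zero : enc (0 : ℕ) = .nil := rfl
@[simp] theorem enc_succ (n : ℕ) : enc (n + 1) = .cons .nil (enc n) := rfl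
@[simp] theorem enc_pair (a : α) (b : β) : enc (a, b) = .cons (enc a) (enc b) := rfl
@[simp] theorem enc_list_nil : enc ([] : List α) = .nil := rfl
@[simp] theorem enc_list_cons (a : α) (l : List α) : enc (a :: l) = .cons (enc a) (enc l) := rfl
@[simp] theorem enc_none : enc (none : Option α) = .nil := rfl
@[simp] theorem enc_some (a : α) : enc (some a) = .cons .nil (enc a) := rfl

instance : EncInj Bool := ⟨fun {a b} h => by cases a <;> cases b <;> simp_all⟩
instance : EncInj ℕ := ⟨fun {a b} h => by
  induction a generalizing b with
  | zero => cases b <;> simp_all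
  | succ a ih =>
    cases b with
    | zero => simp at h
    | succ b => simp at h; rw [ih h]⟩
instance [EncInj α] [EncInj β] : EncInj (α × β) := ⟨fun {a b} h => by
  injection h with h1 h2
  exact Prod.ext (EncInj.inj h1) (EncInj.inj h2)⟩
instance [EncInj α] : EncInj (List α) := ⟨fun {a b} h => by
  induction a generalizing b with
  | nil => cases b <;> simp_all
  | cons x a ih =>
    cases b with
    | nil => simp at h
    | cons y b => simp at h; rw [EncInj.inj h.1, ih h.2]⟩

/-- The size of the representation. -/
def sz (a : α) : ℕ := (enc a).size

@[simp] theorem sz_true : sz true = 3 := rfl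
@[simp] theorem sz_false : sz false = 1 := rfl
theorem sz_bool (b : Bool) : sz b ≤ 3 := by cases b <;> simp
@[simp] theorem sz_pair (a : α) (b : β) : sz (a, b) = sz a + sz b + 1 := rfl
theorem sz_prod (p : α × β) : sz p = sz p.1 + sz p.2 + 1 := rfl
@[simp] theorem sz_nil : sz ([] : List α) = 1 := rfl
@[simp] theorem sz_cons (a : α) (l : List α) : sz (a :: l) = sz a + sz l + 1 := rfl
@[simp] theorem sz_none : sz (none : Option α) = 1 := rfl
@[simp] theorem sz_some (a : α) : sz (some a) = sz a + 2 := by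
  simp [sz, Data.size]; omega
@[simp] theorem sz_nat (n : ℕ) : sz n = 2 * n + 1 := by
  induction n with
  | zero => rfl
  | succ n ih => simp only [sz, enc_succ, Data.size] at ih ⊢; omega

theorem sz_append (l l' : List α) : sz (l ++ l') + 1 = sz l + sz l' := by
  induction l with
  | nil => simp; omega
  | cons a l ih => simp; omega

theorem length_le_sz (l : List α) : l.length ≤ sz l := by
  induction l with
  | nil => simp
  | cons a l ih => simp; omega

theorem sz_le_of_mem {a : α} {l : List α} (h : a ∈ l) : sz a ≤ sz l := by
  induction l with
  | nil => simp at h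
  | cons b l ih =>
    rcases List.mem_cons.mp h with rfl | h
    · simp; omega
    · have := ih h; simp; omega

theorem sz_le_of_sublist {l l' : List α} (h : l.Sublist l') : sz l ≤ sz l' := by
  induction h with
  | slnil => simp
  | cons a h ih => simp; omega
  | cons_cons a h ih => simp; omega

theorem sz_list_le {l : List α} {B : ℕ} (h : ∀ a ∈ l, sz a ≤ B) :
    sz l ≤ l.length * (B + 1) + 1 := by
  induction l with
  | nil => simp
  | cons a l ih =>
    have h1 := h a (by simp)
    have h2 := ih fun b hb => h b (by simp [hb])
    simp only [sz_cons, List.length_cons]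
    nlinarith

end

/-! ## Polynomial bounds -/

/-- `g` is bounded by a polynomial in `m`. -/
def PB {ι : Sort*} (m g : ι → ℕ) : Prop := ∃ c, ∀ i, g i ≤ (m i + c) ^ c

theorem pow_add_mono {m n c d : ℕ} (h : m ≤ n) (h' : c ≤ d) : (m + c) ^ c ≤ (n + d) ^ d := by
  rcases Nat.eq_zero_or_pos d with rfl | hd
  · obtain rfl : c = 0 := by omega
    simp
  · exact (Nat.pow_le_pow_left (by omega) c).trans (Nat.pow_le_pow_right (by omega) h')

namespace PB
variable {ι : Sort*} {m g h : ι → ℕ}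

theorem mono (hg : PB m g) (h' : ∀ i, h i ≤ g i) : PB m h :=
  let ⟨c, hc⟩ := hg; ⟨c, fun i => (h' i).trans (hc i)⟩

theorem self : PB m m := ⟨1, fun i => by simp⟩

theorem const (n : ℕ) : PB m fun _ => n := by
  refine ⟨n + 1, fun i => ?_⟩
  calc n ≤ (m i + (n + 1)) ^ 1 := by rw [pow_one]; omega
    _ ≤ _ := Nat.pow_le_pow_right (by omega) (by omega)

/-- The same constant serves as shift and as exponent, so substitution needs one that absorbs both:
`(m + c) ^ c + d` is at most `(m + (c + d + 1)) ^ (c + d + 1)`, and the outer exponent `d`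
multiplies the inner one. -/
theorem trans (hg : PB m g) (hh : PB g h) : PB m h := by
  obtain ⟨c, hc⟩ := hg
  obtain ⟨d, hd⟩ := hh
  refine ⟨(c + d + 1) * (d + 1), fun i => ?_⟩
  have e : c + d + 1 ≤ (c + d + 1) * (d + 1) := Nat.le_mul_of_pos_right _ (by omega)
  calc h i ≤ (g i + d) ^ d := hd i
    _ ≤ ((m i + (c + d + 1)) ^ (c + d + 1)) ^ d := by
      apply Nat.pow_le_pow_left
      rcases Nat.eq_zero_or_pos c with rfl | hc0
      · have := hc i
        simp only [pow_zero] at this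
        calc g i + d ≤ (m i + (0 + d + 1)) ^ 1 := by rw [pow_one]; omega
          _ ≤ _ := Nat.pow_le_pow_right (by omega) (by omega)
      · calc g i + d ≤ (m i + c) ^ c + d := by have := hc i; omega
          _ ≤ (m i + (c + d + 1)) ^ c + (m i + (c + d + 1)) ^ c * d := by
            refine add_le_add (Nat.pow_le_pow_left (by omega) _) ?_
            exact Nat.le_mul_of_pos_left _ (by positivity)
          _ = (m i + (c + d + 1)) ^ c * (d + 1) := by ring
          _ ≤ (m i + (c + d + 1)) ^ c * (m i + (c + d + 1)) := Nat.mul_le_mul_left _ (by omega)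
          _ = (m i + (c + d + 1)) ^ (c + 1) := by ring
          _ ≤ _ := Nat.pow_le_pow_right (by omega) (by omega)
    _ = (m i + (c + d + 1)) ^ ((c + d + 1) * d) := by rw [← pow_mul]
    _ ≤ (m i + (c + d + 1) * (d + 1)) ^ ((c + d + 1) * d) :=
      Nat.pow_le_pow_left (by omega) _
    _ ≤ _ := Nat.pow_le_pow_right (by omega) (Nat.mul_le_mul_left _ (by omega))

theorem mul (hg : PB m g) (hh : PB m h) : PB m fun i => g i * h i := by
  obtain ⟨c, hc⟩ := hg
  obtain ⟨d, hd⟩ := hh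
  refine ⟨c + d, fun i => ?_⟩
  calc g i * h i ≤ (m i + c) ^ c * (m i + d) ^ d := Nat.mul_le_mul (hc i) (hd i)
    _ ≤ (m i + (c + d)) ^ c * (m i + (c + d)) ^ d :=
      Nat.mul_le_mul (Nat.pow_le_pow_left (by omega) _) (Nat.pow_le_pow_left (by omega) _)
    _ = _ := by rw [pow_add]

theorem add (hg : PB m g) (hh : PB m h) : PB m fun i => g i + h i := by
  have hg' : PB m fun i => (g i + 1) := by
    obtain ⟨c, hc⟩ := hg
    have : PB g fun i => g i + 1 := ⟨1, fun i => by simp⟩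
    exact trans ⟨c, hc⟩ this
  have hh' : PB m fun i => (h i + 1) := trans hh ⟨1, fun i => by simp⟩
  exact (hg'.mul hh').mono fun i => by nlinarith

theorem pow (hg : PB m g) (n : ℕ) : PB m fun i => g i ^ n := by
  induction n with
  | zero => simpa using const 1
  | succ n ih => simpa [pow_succ] using ih.mul hg

theorem comp {κ : Sort*} (hg : PB m g) (f : κ → ι) : PB (fun k => m (f k)) fun k => g (f k) :=
  let ⟨c, hc⟩ := hg; ⟨c, fun k => hc (f k)⟩

theorem le (h' : ∀ i, h i ≤ m i) : PB m h := self.mono h'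

end PB

/-! ## Computable functions -/

section
variable {α β γ δ : Type} [Enc α] [Enc β] [Enc γ] [Enc δ]

/-- Some program computes `f a` in at most `T a` steps. -/
def Comp (f : α → β) (T : α → ℕ) : Prop :=
  ∃ P : Program, ∀ a, ∃ t ≤ T a, Runs P (enc a) (enc (f a)) t

theorem Runs.of_body {P : Program} {b : Term} {x y : Data} {t : ℕ} (hb : P.getD 0 .nil = b)
    (h : Eval P [x] b y t) : Runs P x y t := by
  subst hb; exact h

namespace Comp

theorem mono {f : α → β} {T T' : α → ℕ} (h : Comp f T) (h' : ∀ a, T a ≤ T' a) : Comp f T' :=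
  let ⟨P, hP⟩ := h
  ⟨P, fun a => let ⟨t, ht, hr⟩ := hP a; ⟨t, ht.trans (h' a), hr⟩⟩

theorem of_term {f : α → β} {n : ℕ} (a : Term) (h : ∀ x, Eval [a] [enc x] a (enc (f x)) n) :
    Comp f fun _ => n :=
  ⟨[a], fun x => ⟨n, le_rfl, h x⟩⟩

theorem of_enc {f : α → β} (h : ∀ x, enc (f x) = enc x) : Comp f fun _ => 1 :=
  of_term (.var 0) fun x => by rw [h]; exact .var _ 0

theorem fst : Comp (Prod.fst : α × β → α) fun _ => 2 :=
  of_term (.hd (.var 0)) fun _ => .hd (.var _ 0)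

theorem snd : Comp (Prod.snd : α × β → β) fun _ => 2 :=
  of_term (.tl (.var 0)) fun _ => .tl (.var _ 0)

theorem const_data (d : Data) : ∃ (a : Term) (n : ℕ), ∀ P ρ, Eval P ρ a d n := by
  induction d with
  | nil => exact ⟨.nil, 1, fun _ _ => .nil _⟩
  | cons x y ih1 ih2 =>
    obtain ⟨a, n, ha⟩ := ih1
    obtain ⟨b, m, hb⟩ := ih2
    exact ⟨.cons a b, n + m + 1, fun P ρ => .cons (ha P ρ) (hb P ρ)⟩

theorem const (b : β) : ∃ n, Comp (fun _ : α => b) fun _ => n :=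
  let ⟨a, n, h⟩ := const_data (enc b)
  ⟨n, of_term a fun _ => h _ _⟩

theorem comp {f : α → β} {g : β → γ} {S : α → ℕ} {T : β → ℕ} (hg : Comp g T) (hf : Comp f S) :
    Comp (fun a => g (f a)) fun a => S a + T (f a) + 3 := by
  obtain ⟨p, hp⟩ := hf
  obtain ⟨q, hq⟩ := hg
  obtain ⟨Q, i, j, k, h0, h1, h2, -⟩ :=
    exists_link (fun i j _ => .call j (.call i (.var 0))) p q []
  refine ⟨Q, fun a => ?_⟩
  obtain ⟨s, hs, hs'⟩ := hp a
  obtain ⟨t, ht, ht'⟩ := hq (f a)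
  refine ⟨_, ?_, Runs.of_body h0 (.call (.call (.var _ 0) (h1 _ _ _ hs')) (h2 _ _ _ ht'))⟩
  dsimp only; omega

theorem pair {f : α → β} {g : α → γ} {S T : α → ℕ} (hf : Comp f S) (hg : Comp g T) :
    Comp (fun a => (f a, g a)) fun a => S a + T a + 5 := by
  obtain ⟨p, hp⟩ := hf
  obtain ⟨q, hq⟩ := hg
  obtain ⟨Q, i, j, k, h0, h1, h2, -⟩ :=
    exists_link (fun i j _ => .cons (.call i (.var 0)) (.call j (.var 0))) p q []
  refine ⟨Q, fun a => ?_⟩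
  obtain ⟨s, hs, hs'⟩ := hp a
  obtain ⟨t, ht, ht'⟩ := hq a
  refine ⟨_, ?_, Runs.of_body h0 (.cons (.call (.var _ 0) (h1 _ _ _ hs')) (.call (.var _ 0) (h2 _ _ _ ht')))⟩
  dsimp only; omega

theorem cond {b : α → Bool} {f g : α → β} {R S T : α → ℕ} (hb : Comp b R) (hf : Comp f S)
    (hg : Comp g T) :
    Comp (fun a => bif b a then f a else g a) fun a => R a + (S a + T a) + 5 := by
  obtain ⟨p, hp⟩ := hb
  obtain ⟨q, hq⟩ := hf
  obtain ⟨r, hr⟩ := hg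
  obtain ⟨Q, i, j, k, h0, h1, h2, h3⟩ :=
    exists_link (fun i j k => .cond (.call i (.var 0)) (.call j (.var 0)) (.call k (.var 0))) p q r
  refine ⟨Q, fun a => ?_⟩
  obtain ⟨s, hs, hs'⟩ := hp a
  obtain ⟨t, ht, ht'⟩ := hq a
  obtain ⟨u, hu, hu'⟩ := hr a
  cases hba : b a
  · rw [hba] at hs'
    simp only [hba, cond_false]
    refine ⟨_, ?_, Runs.of_body h0 (.cond_nil (.call (.var _ 0) (h1 _ _ _ hs')) (.call (.var _ 0) (h3 _ _ _ hu')))⟩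
    omega
  · rw [hba] at hs'
    simp only [hba, cond_true]
    refine ⟨_, ?_, Runs.of_body h0 (.cond_cons (.call (.var _ 0) (h1 _ _ _ hs')) (.call (.var _ 0) (h2 _ _ _ ht')))⟩
    omega

theorem list_cases {f : γ → β} {g : γ × α × List α → β} {S : γ → ℕ} {T : γ × α × List α → ℕ}
    (hf : Comp f S) (hg : Comp g T) :
    Comp (fun x : γ × List α => match x.2 with
        | [] => f x.1
        | a :: l => g (x.1, a, l))
      fun x => (match x.2 with
        | [] => S x.1
        | a :: l => T (x.1, a, l)) + 8 := by
  obtain ⟨p, hp⟩ := hf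
  obtain ⟨q, hq⟩ := hg
  obtain ⟨Q, i, j, k, h0, h1, h2, -⟩ :=
    exists_link (fun i j _ => .cond (.tl (.var 0)) (.call j (.var 0)) (.call i (.hd (.var 0)))) p q []
  refine ⟨Q, fun x => ?_⟩
  obtain ⟨c, l⟩ := x
  cases l with
  | nil =>
    obtain ⟨s, hs, hs'⟩ := hp c
    refine ⟨_, ?_, Runs.of_body h0 (.cond_nil (.tl (.var _ 0)) (.call (.hd (.var _ 0)) (h1 _ _ _ hs')))⟩
    dsimp only; omega
  | cons a l =>
    obtain ⟨s, hs, hs'⟩ := hq (c, a, l)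
    refine ⟨_, ?_, Runs.of_body h0 (.cond_cons (.tl (.var _ 0)) (.call (.var _ 0) (h2 _ _ _ hs')))⟩
    dsimp only; omega

theorem option_cases {f : γ → β} {g : γ × α → β} {S : γ → ℕ} {T : γ × α → ℕ}
    (hf : Comp f S) (hg : Comp g T) :
    Comp (fun x : γ × Option α => match x.2 with
        | none => f x.1
        | some a => g (x.1, a))
      fun x => (match x.2 with
        | none => S x.1
        | some a => T (x.1, a)) + 12 := by
  obtain ⟨p, hp⟩ := hf
  obtain ⟨q, hq⟩ := hg
  obtain ⟨Q, i, j, k, h0, h1, h2, -⟩ :=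
    exists_link (fun i j _ => .cond (.tl (.var 0))
      (.call j (.cons (.hd (.var 0)) (.tl (.tl (.var 0))))) (.call i (.hd (.var 0)))) p q []
  refine ⟨Q, fun x => ?_⟩
  obtain ⟨c, o⟩ := x
  cases o with
  | none =>
    obtain ⟨s, hs, hs'⟩ := hp c
    refine ⟨_, ?_, Runs.of_body h0 (.cond_nil (.tl (.var _ 0)) (.call (.hd (.var _ 0)) (h1 _ _ _ hs')))⟩
    dsimp only; omega
  | some a =>
    obtain ⟨s, hs, hs'⟩ := hq (c, a)
    refine ⟨_, ?_, Runs.of_body h0 (.cond_cons (.tl (.var _ 0))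
        (.call (.cons (.hd (.var _ 0)) (.tl (.tl (.var _ 0)))) (h2 _ _ _ hs')))⟩
    dsimp only; omega

/-- The number of steps of a right fold. -/
def foldrTime (step : γ × α × β → β) (T : γ × α × β → ℕ) (c : γ) (z : β) : List α → ℕ
  | [] => 10
  | a :: l => foldrTime step T c z l + T (c, a, l.foldr (fun a b => step (c, a, b)) z) + 40

/-- The linked program calls itself at index `0` on the tail of the list and passes the result to
the step program. -/
theorem foldr {step : γ × α × β → β} {T : γ × α × β → ℕ} (h : Comp step T) :
    Comp (fun x : γ × β × List α => x.2.2.foldr (fun a b => step (x.1, a, b)) x.2.1)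
      fun x => foldrTime step T x.1 x.2.1 x.2.2 := by
  obtain ⟨p, hp⟩ := h
  obtain ⟨Q, i, j, k, h0, h1, -⟩ :=
    exists_link (fun i _ _ => .cond (.tl (.tl (.var 0)))
      (.call i (.cons (.hd (.var 0)) (.cons (.hd (.tl (.tl (.var 0))))
        (.call 0 (.cons (.hd (.var 0)) (.cons (.hd (.tl (.var 0))) (.tl (.tl (.tl (.var 0))))))))))
      (.hd (.tl (.var 0)))) p [] []
  refine ⟨Q, ?_⟩
  rintro ⟨c, z, l⟩
  induction l with
  | nil =>
    refine ⟨_, ?_, Runs.of_body h0 (.cond_nil (.tl (.tl (.var _ 0))) (.hd (.tl (.var _ 0))))⟩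
    simp [foldrTime]
  | cons a l ih =>
    obtain ⟨t, ht, ht'⟩ := ih
    obtain ⟨s, hs, hs'⟩ := hp (c, a, l.foldr (fun a b => step (c, a, b)) z)
    refine ⟨_, ?_, Runs.of_body h0 (.cond_cons (.tl (.tl (.var _ 0))) (.call (.cons (.hd (.var _ 0))
        (.cons (.hd (.tl (.tl (.var _ 0)))) (.call
          (.cons (.hd (.var _ 0)) (.cons (.hd (.tl (.var _ 0))) (.tl (.tl (.tl (.var _ 0))))))
          ht'))) (h1 _ _ _ hs')))⟩
    simp only [foldrTime] at ht ⊢; omega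

omit [Enc α] [Enc β] [Enc γ] in
-- A right fold only ever meets the values of suffixes, so a bound on the step time at those values
-- is enough.
theorem foldrTime_le {step : γ × α × β → β} {T : γ × α × β → ℕ} {c : γ} {z : β} {B : ℕ}
    (l : List α) (h : ∀ a s, a :: s <:+ l →
      T (c, a, s.foldr (fun a b => step (c, a, b)) z) ≤ B) :
    foldrTime step T c z l ≤ (l.length + 1) * (B + 40) := by
  induction l with
  | nil => simp [foldrTime]
  | cons a l ih =>
    have h1 := ih fun b s hs => h b s (hs.trans (List.suffix_cons a l))
    have h2 := h a l (List.suffix_refl _)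
    simp only [foldrTime, List.length_cons]
    nlinarith

end Comp

end

/-! ## Functions computable in polynomial time -/

section
variable {α β γ δ : Type} [Enc α] [Enc β] [Enc γ] [Enc δ]

/-- The function `f` is computable in time polynomial in `m`, with values of size polynomial in
`m`. -/
def PT (m : α → ℕ) (f : α → β) : Prop :=
  PB m (fun a => sz (f a)) ∧ ∃ T, PB m T ∧ Comp f T

/-- The function `f` is computable in polynomial time. -/
def Poly (f : α → β) : Prop := PT sz f

namespace PT

theorem comp {f : α → β} {g : β → γ} {m : α → ℕ} {m' : β → ℕ} (hg : PT m' g) (hf : PT m f)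
    (h : PB m fun a => m' (f a)) : PT m fun a => g (f a) := by
  obtain ⟨hg1, T, hT, hg2⟩ := hg
  obtain ⟨hf1, S, hS, hf2⟩ := hf
  exact ⟨h.trans (hg1.comp f), _, (hS.add (h.trans (hT.comp f))).add (PB.const 3), hg2.comp hf2⟩

theorem pair {f : α → β} {g : α → γ} {m : α → ℕ} (hf : PT m f) (hg : PT m g) :
    PT m fun a => (f a, g a) := by
  obtain ⟨hg1, T, hT, hg2⟩ := hg
  obtain ⟨hf1, S, hS, hf2⟩ := hf
  exact ⟨((hf1.add hg1).add (PB.const 1)).mono fun a => by simp, _,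
    (hS.add hT).add (PB.const 5), hf2.pair hg2⟩

theorem mono {f : α → β} {m m' : α → ℕ} (hf : PT m f) (h : PB m' m) : PT m' f :=
  let ⟨h1, T, hT, h2⟩ := hf
  ⟨h.trans h1, T, h.trans hT, h2⟩

theorem of_poly {f : α → β} (hf : Poly f) {m : α → ℕ} (h : PB m sz) : PT m f :=
  PT.mono hf h

theorem comp_poly {f : α → β} {g : β → γ} {m : α → ℕ} (hg : Poly g) (hf : PT m f) :
    PT m fun a => g (f a) :=
  PT.comp hg hf hf.1

/-- Iterating a polynomial step can produce values of exponential size. Hence the explicit bound `B`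
on all intermediate values; with it, each of the polynomially many steps acts on arguments of
polynomial size. -/
theorem foldr {m : γ → ℕ} {l : γ → List α} {z : γ → β} {step : γ → α → β → β}
    (hm : PB m sz) (hl : PT m l) (hz : PT m z)
    (hs : Poly fun p : γ × α × β => step p.1 p.2.1 p.2.2) {B : γ → ℕ} (hB : PB m B)
    (h : ∀ c s, s <:+ l c → sz (s.foldr (step c) (z c)) ≤ B c) :
    PT m fun c => (l c).foldr (step c) (z c) := by
  obtain ⟨hl1, S, hS, hl2⟩ := hl
  obtain ⟨hz1, U, hU, hz2⟩ := hz
  obtain ⟨-, T, ⟨k, hT⟩, hs⟩ := hs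
  refine ⟨hB.mono fun c => h c _ (List.suffix_refl _), _, ?_,
    (Comp.foldr hs).comp ((Comp.of_enc (f := id) fun _ => rfl).pair (hz2.pair hl2))⟩
  have h0 : PB m fun c => (sz (l c) + 1) * ((sz c + sz (l c) + B c + 2 + k) ^ k + 40) :=
    (hl1.add (.const 1)).mul ((((((hm.add hl1).add hB).add (.const 2)).add (.const k)).pow k).add
      (.const 40))
  refine ((((PB.const 1).add ((hU.add hS).add (.const 5))).add (.const 5)).add h0 |>.add
    (.const 3)).mono fun c => ?_
  have := Comp.foldrTime_le (step := fun p : γ × α × β => step p.1 p.2.1 p.2.2) (T := T) (c := c)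
    (z := z c) (B := (sz c + sz (l c) + B c + 2 + k) ^ k) (l c) (by
      intro a s has
      refine (hT _).trans (Nat.pow_le_pow_left ?_ k)
      have h1 := h c s ((List.suffix_cons a s).trans has)
      have h2 : sz a ≤ sz (l c) := sz_le_of_mem (has.mem (by simp))
      simp only [sz_pair]
      change sz c + (sz a + sz (List.foldr (step c) (z c) s) + 1) + 1 + k ≤ _
      omega)
  have h3 := length_le_sz (l c)
  have h4 := Nat.mul_le_mul_right ((sz c + sz (l c) + B c + 2 + k) ^ k + 40)
    (Nat.add_le_add_right h3 1)
  simp only [id]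
  omega

end PT

namespace Poly

theorem comp {f : α → β} {g : β → γ} (hg : Poly g) (hf : Poly f) : Poly fun a => g (f a) :=
  PT.comp_poly hg hf

theorem congr {f g : α → β} (hf : Poly f) (h : ∀ a, g a = f a) : Poly g :=
  (funext h : g = f) ▸ hf

theorem of_comp {f : α → β} {n : ℕ} (hf : Comp f fun _ => n) (h : PB sz fun a => sz (f a)) :
    Poly f :=
  ⟨h, _, .const n, hf⟩

theorem of_enc {f : α → β} (h : ∀ a, enc (f a) = enc a) : Poly f :=
  of_comp (.of_enc h) (.le fun a => by rw [sz, h]; rfl)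

theorem id : Poly fun a : α => a := of_enc fun _ => rfl

theorem const (b : β) : Poly fun _ : α => b :=
  let ⟨_, h⟩ := Comp.const (α := α) b
  of_comp h (.const _)

theorem fst {f : α → β × γ} (hf : Poly f) : Poly fun a => (f a).1 :=
  comp (g := Prod.fst) (of_comp .fst (.le fun p => by rw [sz_prod]; omega)) hf

theorem snd {f : α → β × γ} (hf : Poly f) : Poly fun a => (f a).2 :=
  comp (g := Prod.snd) (of_comp .snd (.le fun p => by rw [sz_prod]; omega)) hf

theorem pair {f : α → β} {g : α → γ} (hf : Poly f) (hg : Poly g) : Poly fun a => (f a, g a) :=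
  PT.pair hf hg

theorem comp₂ {f : α → β} {g : α → γ} {h : β → γ → δ} (hh : Poly fun p : β × γ => h p.1 p.2)
    (hf : Poly f) (hg : Poly g) : Poly fun a => h (f a) (g a) :=
  hh.comp (hf.pair hg)

theorem cond {b : α → Bool} {f g : α → β} (hb : Poly b) (hf : Poly f) (hg : Poly g) :
    Poly fun a => bif b a then f a else g a := by
  obtain ⟨hb1, R, hR, hb2⟩ := hb
  obtain ⟨hg1, T, hT, hg2⟩ := hg
  obtain ⟨hf1, S, hS, hf2⟩ := hf
  exact ⟨(hf1.add hg1).mono fun a => by dsimp only; cases b a <;> simp,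
    _, (hR.add (hS.add hT)).add (.const 5), hb2.cond hf2 hg2⟩

theorem and {f g : α → Bool} (hf : Poly f) (hg : Poly g) : Poly fun a => f a && g a :=
  (hf.cond hg (const false)).congr fun a => by cases f a <;> rfl

theorem or {f g : α → Bool} (hf : Poly f) (hg : Poly g) : Poly fun a => f a || g a :=
  (hf.cond (const true) hg).congr fun a => by cases f a <;> rfl

theorem not {f : α → Bool} (hf : Poly f) : Poly fun a => !f a := by
  have := hf.cond (const (α := α) false) (const true)
  refine this.congr fun a => ?_
  cases f a <;> rfl

theorem cons {f : α → β} {g : α → List β} (hf : Poly f) (hg : Poly g) :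
    Poly fun a => f a :: g a :=
  comp₂ (h := List.cons) (of_enc fun _ => rfl) hf hg

instance : Enc Unit := ⟨fun _ => .nil⟩

theorem mk_some {f : α → β} (hf : Poly f) : Poly fun a => some (f a) :=
  comp₂ (f := fun _ => ()) (h := fun _ b => some b) (of_enc fun _ => rfl) (const _) hf

theorem succ {f : α → ℕ} (hf : Poly f) : Poly fun a => f a + 1 :=
  comp₂ (f := fun _ => ()) (h := fun _ n => n + 1) (of_enc fun _ => rfl) (const _) hf

theorem option_elim {o : γ → Option α} {z : γ → β} {f : γ → α → β} (ho : Poly o) (hz : Poly z)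
    (hf : Poly fun p : γ × α => f p.1 p.2) : Poly fun c => (o c).elim (z c) (f c) := by
  obtain ⟨hz1, S, hS, hz2⟩ := hz
  obtain ⟨hf1, T, hT, hf2⟩ := hf
  have key : Poly fun x : γ × Option α => x.2.elim (z x.1) (f x.1) := by
    have pb : ∀ {g : γ → ℕ} {h : γ × α → ℕ}, PB sz g → PB sz h →
        PB sz fun x : γ × Option α => (match x.2 with
          | none => g x.1
          | some a => h (x.1, a)) := by
      rintro g h ⟨c, hc⟩ ⟨d, hd⟩
      refine ⟨c + d, ?_⟩
      rintro ⟨x, _ | a⟩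
      · refine (hc x).trans (pow_add_mono (n := sz (x, (none : Option α))) ?_ ?_)
        · simp only [sz_pair]; omega
        · omega
      · refine (hd (x, a)).trans (pow_add_mono (n := sz (x, some a)) ?_ ?_)
        · simp only [sz_pair, sz_some]; omega
        · omega
    refine ⟨(pb hz1 hf1).mono ?_, _, (pb hS hT).add (.const 12), ?_⟩
    · rintro ⟨x, _ | a⟩ <;> exact le_rfl
    · have := Comp.option_cases hz2 hf2
      refine (funext ?_ : (fun x : γ × Option α => x.2.elim (z x.1) (f x.1)) = _) ▸ this
      rintro ⟨x, _ | a⟩ <;> rfl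
  exact key.comp (id.pair ho)

theorem head? {l : γ → List α} (hl : Poly l) : Poly fun c => (l c).head? := by
  have key : Poly fun x : Bool × List α => x.2.head? := by
    have h := Comp.list_cases (f := fun _ : Bool => (none : Option α)) (S := fun _ => 1)
      (g := fun x : Bool × α × List α => some x.2.1)
      (.of_term .nil fun _ => .nil _)
      (.of_term (.cons .nil (.hd (.tl (.var 0)))) fun _ => .cons (.nil _) (.hd (.tl (.var _ 0))))
    refine (of_comp (n := 13) (h.mono ?_) ((PB.self.add (.const 2)).mono ?_)).congr ?_
    · rintro ⟨x, _ | ⟨a, l⟩⟩ <;> simp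
    · rintro ⟨x, _ | ⟨a, l⟩⟩ <;> simp only [sz_none, sz_some, sz_pair, sz_nil, sz_cons] <;> omega
    · rintro ⟨x, _ | ⟨a, l⟩⟩ <;> rfl
  exact key.comp ((const false).pair hl)

theorem tail {l : γ → List α} (hl : Poly l) : Poly fun c => (l c).tail := by
  have key : Poly fun x : List α => x.tail := by
    refine of_comp (n := 2) (.of_term (.tl (.var 0)) fun x => ?_) (.le fun x => ?_)
    · cases x <;> exact .tl (.var _ 0)
    · cases x <;> simp only [List.tail_nil, List.tail_cons, sz_nil, sz_cons] <;> omega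
  exact key.comp hl

theorem isEmpty {l : γ → List α} (hl : Poly l) : Poly fun c => (l c).isEmpty := by
  have := option_elim hl.head? (const (α := γ) true) (f := fun _ _ => false) (const false)
  refine this.congr fun c => ?_
  cases l c <;> rfl

/-- The growth in one step is bounded by a term `G (c, a)` that does not involve the accumulator, so
sizes add up instead of compounding and stay polynomial. -/
theorem foldr {l : γ → List α} {z : γ → β} {step : γ → α → β → β} (hl : Poly l) (hz : Poly z)
    (hs : Poly fun p : γ × α × β => step p.1 p.2.1 p.2.2) {G : γ × α → ℕ} (hG : PB sz G)
    (h : ∀ c a b, sz (step c a b) ≤ sz b + G (c, a)) :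
    Poly fun c => (l c).foldr (step c) (z c) := by
  obtain ⟨k, hk⟩ := hG
  refine PT.foldr .self hl hz hs
    (B := fun c => sz (z c) + sz (l c) * (sz c + sz (l c) + 1 + k) ^ k)
    (hz.1.add (hl.1.mul ((((PB.self.add hl.1).add (.const 1)).add (.const k)).pow k))) ?_
  intro c s hs
  have : sz (s.foldr (step c) (z c)) ≤ sz (z c) + s.length * (sz c + sz (l c) + 1 + k) ^ k := by
    induction s with
    | nil => simp
    | cons a s ih =>
      have h1 := ih ((List.suffix_cons a s).trans hs)
      have h2 := h c a (s.foldr (step c) (z c))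
      have h3 : G (c, a) ≤ (sz c + sz (l c) + 1 + k) ^ k := by
        refine (hk _).trans (Nat.pow_le_pow_left ?_ k)
        have : sz a ≤ sz (l c) := sz_le_of_mem (hs.mem (by simp))
        simp; omega
      simp only [List.foldr_cons, List.length_cons]
      linarith
  refine this.trans (Nat.add_le_add_left (Nat.mul_le_mul_right _ ?_) _)
  exact (hs.length_le).trans (length_le_sz _)

theorem append {l l' : γ → List α} (hl : Poly l) (hl' : Poly l') : Poly fun c => l c ++ l' c := by
  have := foldr hl hl' (step := fun _ a s => a :: s) (cons (fst (snd id)) (snd (snd id)))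
    (G := fun p => sz p.2 + 1) (((snd id).1).add (.const 1)) fun c a b => by simp; omega
  exact this.congr fun c => by simp

theorem map {l : γ → List α} {f : γ → α → β} (hl : Poly l)
    (hf : Poly fun p : γ × α => f p.1 p.2) : Poly fun c => (l c).map fun a => f c a := by
  have := foldr hl (const (α := γ) []) (step := fun c a s => f c a :: s)
    (cons (hf.comp (pair (fst id) (fst (snd id)))) (snd (snd id)))
    (G := fun p => sz (f p.1 p.2) + 1) (hf.1.add (.const 1)) fun c a b => by simp; omega
  exact this.congr fun c => List.map_eq_foldr

theorem flatten {l : γ → List (List α)} (hl : Poly l) : Poly fun c => (l c).flatten := by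
  have := foldr hl (const (α := γ) []) (step := fun c a s => a ++ s)
    (append (fst (snd id)) (snd (snd id)))
    (G := fun p => sz p.2) ((snd id).1) fun c a b => by have := sz_append a b; dsimp only; omega
  refine this.congr fun c => ?_
  induction l c <;> simp_all

theorem flatMap {l : γ → List α} {f : γ → α → List β} (hl : Poly l)
    (hf : Poly fun p : γ × α => f p.1 p.2) : Poly fun c => (l c).flatMap fun a => f c a := by
  simpa only [List.flatMap] using flatten (map hl hf)

theorem filter {l : γ → List α} {f : γ → α → Bool} (hl : Poly l)
    (hf : Poly fun p : γ × α => f p.1 p.2) : Poly fun c => (l c).filter fun a => f c a := by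
  have := flatMap hl (f := fun c a => bif f c a then [a] else [])
    (hf.cond (cons (snd id) (const [])) (const []))
  refine this.congr fun c => ?_
  induction l c with
  | nil => rfl
  | cons a l ih => cases h : f c a <;> simp [h, ih]

theorem any {l : γ → List α} {f : γ → α → Bool} (hl : Poly l)
    (hf : Poly fun p : γ × α => f p.1 p.2) : Poly fun c => (l c).any fun a => f c a := by
  have := foldr hl (const (α := γ) false) (step := fun c a s => f c a || s)
    (or (hf.comp (pair (fst id) (fst (snd id)))) (snd (snd id)))
    (G := fun _ => 3) (.const 3) fun c a b => (sz_bool _).trans (by omega)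
  refine this.congr fun c => ?_
  induction l c <;> simp_all

theorem all {l : γ → List α} {f : γ → α → Bool} (hl : Poly l)
    (hf : Poly fun p : γ × α => f p.1 p.2) : Poly fun c => (l c).all fun a => f c a := by
  have := not (any hl (f := fun c a => !f c a) (not hf))
  refine this.congr fun c => ?_
  simp [List.all_eq_not_any_not]

theorem product {l : γ → List α} {l' : γ → List β} (hl : Poly l) (hl' : Poly l') :
    Poly fun c => (l c).product (l' c) := by
  unfold List.product
  exact flatMap hl (map (hl'.comp (fst id)) (pair (snd (fst id)) (snd id)))

theorem option_getD {o : γ → Option α} {z : γ → α} (ho : Poly o) (hz : Poly z) :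
    Poly fun c => (o c).getD (z c) := by
  have := option_elim ho hz (f := fun _ a => a) (snd id)
  refine this.congr fun c => ?_
  cases o c <;> rfl

theorem isSome {o : γ → Option α} (ho : Poly o) : Poly fun c => (o c).isSome := by
  have := option_elim ho (const (α := γ) false) (f := fun _ a => true) (const true)
  refine this.congr fun c => ?_
  cases o c <;> rfl

theorem toList {o : γ → Option α} (ho : Poly o) : Poly fun c => (o c).toList := by
  have := option_elim ho (const (α := γ) []) (f := fun _ a => [a]) (cons (snd id) (const []))
  refine this.congr fun c => ?_
  cases o c <;> rfl

/-- A unary number and a list of units are the same data, so recursion over numbers comes for free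
from folds over lists. -/
theorem enc_replicate_unit (n : ℕ) : enc (List.replicate n ()) = enc n := by
  induction n with
  | zero => rfl
  | succ n ih => rw [List.replicate_succ, enc_list_cons, enc_succ, ih]; rfl

theorem units {f : γ → ℕ} (hf : Poly f) : Poly fun c => List.replicate (f c) () :=
  comp (g := fun n => List.replicate n ()) (of_enc enc_replicate_unit) hf

theorem replicate {f : γ → ℕ} {g : γ → α} (hf : Poly f) (hg : Poly g) :
    Poly fun c => List.replicate (f c) (g c) := by
  have := map (units hf) (f := fun c _ => g c) (hg.comp (fst id))
  exact this.congr fun c => by simp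

theorem length {l : γ → List α} (hl : Poly l) : Poly fun c => (l c).length := by
  have h : Poly fun u : List Unit => u.length := of_enc fun u => by
    rw [← enc_replicate_unit]
    exact congrArg _ (List.eq_replicate_of_mem fun _ _ => rfl).symm
  have := h.comp (map hl (f := fun _ _ => ()) (const ()))
  exact this.congr fun c => by simp

theorem drop {n : γ → ℕ} {l : γ → List α} (hn : Poly n) (hl : Poly l) :
    Poly fun c => (l c).drop (n c) := by
  have := foldr (units hn) hl (step := fun _ _ s => s.tail) (tail (snd (snd id)))
    (G := fun p => 0) (.const 0) fun c a b => by cases b <;> simp; omega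
  refine this.congr fun c => ?_
  induction n c with
  | zero => rfl
  | succ n ih => simp [← ih, List.replicate_succ]

/-- The element appended in each step is the length of the accumulator, so the additive criterion
does not apply; the intermediate values are known exactly and are bounded directly. -/
theorem range {n : γ → ℕ} (hn : Poly n) : Poly fun c => List.range (n c) := by
  have h : ∀ s : List Unit, s.foldr (fun _ r => r ++ [r.length]) [] = List.range s.length := by
    intro s
    induction s with
    | nil => rfl
    | cons a s ih => simp [ih, List.range_succ]
  have : Poly _ := PT.foldr .self (units hn) (const (α := γ) []) (step := fun _ _ r => r ++ [r.length])
    (append (snd (snd id)) (cons (length (snd (snd id))) (const [])))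
    (B := fun c => sz (n c) * (2 * sz (n c) + 2) + 1)
    (((hn.1.mul (((PB.const 2).mul hn.1).add (.const 2))).add (.const 1))) (by
      intro c s hs
      have h1 : s.length ≤ n c := by simpa using hs.length_le
      rw [h]
      refine (sz_list_le (B := 2 * sz (n c) + 1) ?_).trans ?_
      · intro a ha
        have := List.mem_range.mp ha
        simp; omega
      · simp only [List.length_range, sz_nat]
        have : s.length ≤ 2 * n c + 1 := by omega
        exact Nat.add_le_add_right (Nat.mul_le_mul_right _ this) _)
  exact this.congr fun c => by simp [h]

end Poly
end

/-! ### Equality -/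

/-- Equality of data. -/
def Data.beq : Data → Data → Bool
  | .nil, .nil => true
  | .nil, .cons _ _ => false
  | .cons _ _, .nil => false
  | .cons a b, .cons c d => bif a.beq c then b.beq d else false

theorem Data.beq_iff {x y : Data} : x.beq y = true ↔ x = y := by
  induction x generalizing y with
  | nil => cases y <;> simp [Data.beq]
  | cons a b ih1 ih2 => cases y <;> simp [Data.beq, ih1, ih2]

/-- The body of a program for equality of the components of a pair. -/
def beqBody : Term :=
  .cond (.hd (.var 0))
    (.cond (.tl (.var 0))
      (.cond (.call 0 (.cons (.hd (.hd (.var 0))) (.hd (.tl (.var 0)))))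
        (.call 0 (.cons (.tl (.hd (.var 0))) (.tl (.tl (.var 0))))) .nil) .nil)
    (.cond (.tl (.var 0)) .nil (.cons .nil .nil))

/-- The recursion descends in both trees at once, so the size of the first alone bounds the time. -/
theorem Comp.beq : Comp (fun p : Data × Data => p.1.beq p.2) fun p => 40 * sz p.1 := by
  refine ⟨[beqBody], ?_⟩
  rintro ⟨x, y⟩
  dsimp only
  induction x generalizing y with
  | nil =>
    cases y with
    | nil =>
      exact ⟨_, by simp [sz, enc, Data.size],
        .cond_nil (.hd (.var _ 0)) (.cond_nil (.tl (.var _ 0)) (.cons (.nil _) (.nil _)))⟩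
    | cons c d =>
      exact ⟨_, by simp [sz, enc, Data.size],
        .cond_nil (.hd (.var _ 0)) (.cond_cons (.tl (.var _ 0)) (.nil _))⟩
  | cons a b ih1 ih2 =>
    cases y with
    | nil =>
      exact ⟨_, by simp [sz, enc, Data.size]; omega,
        .cond_cons (.hd (.var _ 0)) (.cond_nil (.tl (.var _ 0)) (.nil _))⟩
    | cons c d =>
      obtain ⟨s, hs, hs'⟩ := ih1 c
      obtain ⟨t, ht, ht'⟩ := ih2 d
      simp only [sz, enc, id, Data.size] at hs ht ⊢
      cases hac : a.beq c
      · rw [hac] at hs'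
        simp only [Data.beq, hac, cond_false]
        exact ⟨_, by omega, .cond_cons (.hd (.var _ 0)) (.cond_cons (.tl (.var _ 0))
          (.cond_nil (.call (.cons (.hd (.hd (.var _ 0))) (.hd (.tl (.var _ 0)))) hs')
            (.nil _)))⟩
      · rw [hac] at hs'
        simp only [Data.beq, hac, cond_true]
        exact ⟨_, by omega, .cond_cons (.hd (.var _ 0)) (.cond_cons (.tl (.var _ 0))
          (.cond_cons (.call (.cons (.hd (.hd (.var _ 0))) (.hd (.tl (.var _ 0)))) hs')
            (.call (.cons (.tl (.hd (.var _ 0))) (.tl (.tl (.var _ 0)))) ht')))⟩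

namespace Poly
variable {α γ : Type} [Enc α] [Enc γ]

/-- An injective encoding turns equality of elements into equality of data. -/
theorem beq [EncInj α] [BEq α] [LawfulBEq α] {f g : γ → α} (hf : Poly f) (hg : Poly g) :
    Poly fun c => f c == g c := by
  have h : Poly fun p : Data × Data => p.1.beq p.2 :=
    ⟨(PB.const 3).mono fun _ => sz_bool _, _,
      (PB.const 40).mul (PB.le fun p => by rw [sz_prod]; omega), Comp.beq⟩
  have e : Poly fun a : α => enc a := of_enc fun _ => rfl
  have := h.comp ((e.comp hf).pair (e.comp hg))
  refine this.congr fun c => ?_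
  rw [Bool.eq_iff_iff, Data.beq_iff, beq_iff_eq]
  exact ⟨fun h => by rw [h], fun h => EncInj.inj h⟩

theorem contains [EncInj α] [BEq α] [LawfulBEq α] {l : γ → List α} {f : γ → α} (hl : Poly l)
    (hf : Poly f) : Poly fun c => (l c).contains (f c) := by
  have := any hl (f := fun c a => f c == a) (beq (hf.comp (fst id)) (snd id))
  exact this.congr fun c => List.contains_eq_any_beq

end Poly

/-! ## The dynamic program -/

/-- Two sets of representatives: those met by a clique inside a color class, and those of the
vertices outside of the color class that are adjacent to all vertices of the clique. -/
abbrev Profile := List ℕ × List ℕ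

/-- The profiles of all cliques of a color class. -/
abbrev ClassType := List Profile

/-- A partial coloring, as the list of its color classes with their types. -/
abbrev Entry := List (ClassType × List ℕ)

/-- The first element with property `p`, if there is one, and the list of the other elements. -/
def extract {α : Type} (p : α → Bool) (l : List α) : Option α × List α :=
  l.foldr (fun x s => bif p x && !s.1.isSome then (some x, s.2) else (s.1, x :: s.2)) (none, [])

/-- All multisets of elements of `A` with multiplicities at most `k`. -/
def msets {α : Type} (k : ℕ) (A : List α) : List (List α) :=
  A.foldr (fun a acc => (List.range (k + 1)).flatMap fun j => acc.map fun l =>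
    List.replicate j a ++ l) [[]]

/-- All pairs of subsets. -/
def profiles (R : List ℕ) : List Profile := R.sublists'.product R.sublists'

/-- All sets of profiles. -/
def classTypes (R : List ℕ) : List ClassType := (profiles R).sublists'

section
variable (adj : ℕ → ℕ → Bool) (n : ℕ)

/-- The vertices `u` and `v` have the same neighbors outside `L`. -/
def sameOutside (L : List ℕ) (u v : ℕ) : Bool :=
  (List.range n).all fun x => L.contains x || (adj u x == adj v x)

/-- The representative of the class of `v`. -/
def rep (L : List ℕ) (v : ℕ) : ℕ := (L.filter fun u => sameOutside adj n L u v).head?.getD v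

/-- The representatives of all classes of vertices of `L`. -/
def reps (L : List ℕ) : List ℕ := L.filter fun v => rep adj n L v == v

/-- The profile of the union of two cliques, from their profiles. -/
def mergeProfile (L : List ℕ) (p q : Profile) : Profile :=
  ((reps adj n L).filter fun r =>
      (p.1.any fun x => rep adj n L x == r) || (q.1.any fun x => rep adj n L x == r),
    (reps adj n L).filter fun r =>
      (p.2.any fun v => (rep adj n L v == r) && q.1.all fun x => adj v x) ||
      (q.2.any fun v => (rep adj n L v == r) && p.1.all fun x => adj v x))

/-- The type of the union of two color classes, from their types; `P` is the list of all profiles. -/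
def mergeTypes (L : List ℕ) (P : List Profile) (σ τ : ClassType) : ClassType :=
  P.filter fun p => σ.any fun s => τ.any fun t =>
    (s.1.all fun x => t.1.all fun y => adj x y) && (p == mergeProfile adj n L s t)

/-- Unite a class of type `w.1` and a class of type `w.2`. -/
def joinStep (L : List ℕ) (P : List Profile) (w : ClassType × ClassType)
    (s : Option (Entry × Entry × Entry)) : Option (Entry × Entry × Entry) :=
  s.elim none fun s =>
    (extract (fun x => x.1 == w.1) s.1).1.elim none fun x =>
      (extract (fun x => x.1 == w.2) s.2.1).1.elim none fun y =>
        some ((extract (fun x => x.1 == w.1) s.1).2, (extract (fun x => x.1 == w.2) s.2.1).2,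
          (mergeTypes adj n L P w.1 w.2, x.2 ++ y.2) :: s.2.2)

/-- Unite the color classes of two partial colorings, in pairs of the types in `W`. -/
def joinEntries (L : List ℕ) (P : List Profile) (W : List (ClassType × ClassType))
    (e f : Entry) : Option Entry :=
  (W.foldr (joinStep adj n L P) (some (e, f, []))).elim none fun s =>
    bif s.1.isEmpty && s.2.1.isEmpty then some s.2.2 else none

/-- The vertices below a leaf, and its table of partial colorings with `k` colors. -/
def leafValue (k : ℕ) (v : ℕ) : List ℕ × List Entry :=
  ([v], [([([], []), ([v], [])], [v]) :: (List.replicate k ([([], [v])], [])).tail])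

/-- All lists of pairs of types of color classes, up to the order. -/
def pairings (k : ℕ) (A B : List ℕ) : List (List (ClassType × ClassType)) :=
  msets k ((classTypes (reps adj n A)).product (classTypes (reps adj n B)))

/-- The table of a node from the tables of its children: for every multiset of pairs of types, at
most one partial coloring. -/
def joinTables (U : List (List (ClassType × ClassType))) (L : List ℕ) (P : List Profile)
    (a b : List Entry) : List Entry :=
  U.flatMap fun W =>
    (a.flatMap fun e => b.flatMap fun f => (joinEntries adj n L P W e f).toList).head?.toList

/-- The value of a node, from the values of its children. -/
def nodeValue (k : ℕ) (a b : List ℕ × List Entry) : List ℕ × List Entry :=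
  (a.1 ++ b.1, joinTables adj n (pairings adj n k a.1 b.1) (a.1 ++ b.1)
    (profiles (reps adj n (a.1 ++ b.1))) a.2 b.2)

/-- Binary trees with labelled leaves. -/
inductive BinTree where
  | leaf (v : ℕ) : BinTree
  | node (s t : BinTree) : BinTree

namespace BinTree

/-- The labels of the leaves. -/
def leaves : BinTree → List ℕ
  | leaf v => [v]
  | node s t => s.leaves ++ t.leaves

/-- The value at the root. -/
def value (k : ℕ) : BinTree → List ℕ × List Entry
  | leaf v => leafValue k v
  | node s t => nodeValue adj n k (s.value k) (t.value k)

theorem value_fst (k : ℕ) (T : BinTree) : (T.value adj n k).1 = T.leaves := by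
  induction T with
  | leaf v => rfl
  | node s t ih1 ih2 => simp [value, nodeValue, leaves, ih1, ih2]

end BinTree

/-- Every clique in every class has a common neighbor outside of the class. -/
def goodEntry (e : Entry) : Bool := e.all fun x => x.1.all fun p => !p.2.isEmpty

/-- The coloring of the vertices `0, …, n - 1` by the positions of their classes. -/
def colorList (e : Entry) : List ℕ :=
  (List.range n).map fun v => e.foldr (fun x c => bif x.2.contains v then 0 else c + 1) 0

/-- A coloring from the table at the root. -/
def answer (tab : List Entry) : Option (List ℕ) :=
  (tab.filter goodEntry).head?.elim none fun e => some (colorList n e)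

end

/-! ## Correctness -/

section

/-- The fold runs from the right, so with several matches it is the rightmost that is taken. Only
the multiset of remaining elements matters. -/
theorem extract_some {α : Type} {p : α → Bool} {l : List α} {x : α}
    (h : (extract p l).1 = some x) : p x = true ∧ l.Perm (x :: (extract p l).2) := by
  induction l with
  | nil => simp [extract] at h
  | cons a l ih =>
    have e : extract p (a :: l) = bif p a && !(extract p l).1.isSome then
      (some a, (extract p l).2) else ((extract p l).1, a :: (extract p l).2) := rfl
    rw [e] at h ⊢
    cases hl : (extract p l).1 with
    | none =>
      cases ha : p a with
      | false => simp [hl, ha] at h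
      | true =>
        simp only [hl, ha, Option.isSome_none, Bool.not_false, Bool.and_self, cond_true,
          Option.some.injEq] at h ⊢
        subst h
        refine ⟨ha, .cons _ ?_⟩
        -- There was no match in `l`, so the second component is still `l`; this is a separate
        -- induction.
        clear ih e
        induction l with
        | nil => exact .refl _
        | cons b l ih =>
          have e : extract p (b :: l) = bif p b && !(extract p l).1.isSome then
            (some b, (extract p l).2) else ((extract p l).1, b :: (extract p l).2) := rfl
          rw [e] at hl ⊢
          cases hb : p b <;> cases hl' : (extract p l).1 <;> simp_all
    | some y =>
      simp only [hl, Option.isSome_some, Bool.not_true, Bool.and_false, cond_false,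
        Option.some.injEq] at h ⊢
      subst h
      exact ⟨(ih hl).1, ((ih hl).2.cons a).trans (.swap _ _ _)⟩

theorem extract_none {α : Type} {p : α → Bool} {l : List α}
    (h : (extract p l).1 = none) : ∀ x ∈ l, p x = false := by
  induction l with
  | nil => simp
  | cons a l ih =>
    have e : extract p (a :: l) = bif p a && !(extract p l).1.isSome then
      (some a, (extract p l).2) else ((extract p l).1, a :: (extract p l).2) := rfl
    rw [e] at h
    cases hl : (extract p l).1 <;> cases ha : p a <;> simp_all

/-- Sort `W` by the elements of `A`: split off all copies of the head, at most `W.length ≤ k` of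
them, and recurse on the rest. -/
theorem exists_perm_mem_msets {α : Type} [DecidableEq α] {k : ℕ} {A W : List α}
    (hW : W.length ≤ k) (h : ∀ w ∈ W, w ∈ A) : ∃ W' ∈ msets k A, W.Perm W' := by
  induction A generalizing W with
  | nil =>
    obtain rfl : W = [] := List.eq_nil_iff_forall_not_mem.mpr fun w hw => by simpa using h w hw
    exact ⟨[], by simp [msets], .refl _⟩
  | cons a A ih =>
    obtain ⟨W', hW', hp⟩ := ih (W := W.filter fun w => !(w == a))
      ((List.length_filter_le _ _).trans hW) fun w hw => by
        simp only [List.mem_filter, Bool.not_eq_true', beq_eq_false_iff_ne] at hw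
        simpa [hw.2] using h w hw.1
    refine ⟨List.replicate (W.count a) a ++ W', ?_, ?_⟩
    · simp only [msets, List.foldr_cons, List.mem_flatMap, List.mem_map, List.mem_range]
      exact ⟨W.count a, by have := List.count_le_length (a := a) (l := W); omega, W', hW', rfl⟩
    · refine (List.filter_append_perm (fun w => w == a) W).symm.trans (.append ?_ hp)
      rw [List.filter_beq]

theorem length_msets {α : Type} (k : ℕ) (A : List α) :
    (msets k A).length = (k + 1) ^ A.length := by
  induction A with
  | nil => rfl
  | cons a A ih =>
    have e : msets k (a :: A) = (List.range (k + 1)).flatMap fun j => (msets k A).map fun l =>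
      List.replicate j a ++ l := rfl
    rw [e, List.length_flatMap]
    simp [ih, pow_succ, mul_comm]

theorem mem_of_mem_msets {α : Type} {k : ℕ} {A W : List α} (h : W ∈ msets k A) :
    W.length ≤ k * A.length ∧ ∀ w ∈ W, w ∈ A := by
  induction A generalizing W with
  | nil => simp [msets] at h; simp [h]
  | cons a A ih =>
    have e : msets k (a :: A) = (List.range (k + 1)).flatMap fun j => (msets k A).map fun l =>
      List.replicate j a ++ l := rfl
    rw [e] at h
    simp only [List.mem_flatMap, List.mem_range, List.mem_map] at h
    obtain ⟨j, hj, W', hW', rfl⟩ := h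
    obtain ⟨h1, h2⟩ := ih hW'
    constructor
    · simp only [List.length_append, List.length_replicate, List.length_cons]
      rw [Nat.mul_succ]
      omega
    · intro w hw
      rcases List.mem_append.mp hw with hw | hw
      · simp [List.eq_of_mem_replicate hw]
      · exact List.mem_cons_of_mem _ (h2 w hw)

end

-- Neighborhood classes, and how profiles and types merge.

section
variable {adj : ℕ → ℕ → Bool} {n : ℕ} {L L₁ L₂ : List ℕ}

theorem sameOutside_iff {u v : ℕ} :
    sameOutside adj n L u v = true ↔ ∀ x < n, x ∉ L → adj u x = adj v x := by
  simp [sameOutside, or_iff_not_imp_left]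

/-- Both sides are the head of the same filtered list. Membership of `u` makes that list nonempty,
so the defaults `u` and `v`, which may differ, are not used. -/
theorem rep_congr {u v : ℕ} (h : sameOutside adj n L u v = true) (hu : u ∈ L) :
    rep adj n L u = rep adj n L v := by
  have e : (fun w => sameOutside adj n L w u) = fun w => sameOutside adj n L w v := by
    funext w
    rw [Bool.eq_iff_iff, sameOutside_iff, sameOutside_iff]
    rw [sameOutside_iff] at h
    exact ⟨fun h' x hx hL => (h' x hx hL).trans (h x hx hL),
      fun h' x hx hL => (h' x hx hL).trans (h x hx hL).symm⟩
  have hne : (L.filter fun w => sameOutside adj n L w u) ≠ [] := by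
    refine List.ne_nil_of_mem (a := u) (List.mem_filter.mpr ⟨hu, ?_⟩)
    simp [sameOutside_iff]
  unfold rep
  rw [e] at hne ⊢
  cases h' : L.filter fun w => sameOutside adj n L w v with
  | nil => exact absurd h' hne
  | cons a l => rfl

theorem rep_spec {v : ℕ} (hv : v ∈ L) :
    rep adj n L v ∈ L ∧ sameOutside adj n L (rep adj n L v) v = true := by
  have hne : v ∈ L.filter fun w => sameOutside adj n L w v :=
    List.mem_filter.mpr ⟨hv, by simp [sameOutside_iff]⟩
  have : rep adj n L v ∈ L.filter fun w => sameOutside adj n L w v := by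
    unfold rep
    cases h : L.filter fun w => sameOutside adj n L w v with
    | nil => simp [h] at hne
    | cons a l => simp
  exact List.mem_filter.mp this

theorem rep_mem_reps {v : ℕ} (hv : v ∈ L) : rep adj n L v ∈ reps adj n L := by
  obtain ⟨h1, h2⟩ := rep_spec (adj := adj) (n := n) hv
  exact List.mem_filter.mpr ⟨h1, by simpa using rep_congr h2 h1⟩

/-- Enlarging the set leaves fewer outside vertices to tell its elements apart, so classes only get
coarser. -/
theorem rep_rep (h : L₁ ⊆ L) {v : ℕ} (hv : v ∈ L₁) :
    rep adj n L (rep adj n L₁ v) = rep adj n L v := by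
  obtain ⟨h1, h2⟩ := rep_spec (adj := adj) (n := n) hv
  refine rep_congr ?_ (h h1)
  rw [sameOutside_iff] at h2 ⊢
  exact fun x hx hL => h2 x hx fun h' => hL (h h')

theorem adj_rep {v x : ℕ} (hv : v ∈ L) (hx : x < n) (hL : x ∉ L) :
    adj (rep adj n L v) x = adj v x :=
  sameOutside_iff.mp (rep_spec hv).2 x hx hL

open Classical in
/-- The representatives met by `X`. -/
noncomputable def trace (adj : ℕ → ℕ → Bool) (n : ℕ) (L : List ℕ) (X : Set ℕ) : List ℕ :=
  (reps adj n L).filter fun r => decide (∃ x ∈ X, rep adj n L x = r)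

open Classical in
/-- The representatives of vertices outside `C` that are adjacent to all of `X`. -/
noncomputable def dominators (adj : ℕ → ℕ → Bool) (n : ℕ) (L C : List ℕ) (X : Set ℕ) : List ℕ :=
  (reps adj n L).filter fun r =>
    decide (∃ v ∈ L, v ∉ C ∧ (∀ x ∈ X, adj v x = true) ∧ rep adj n L v = r)

open Classical in
/-- The type of a color class. -/
noncomputable def typeOf (adj : ℕ → ℕ → Bool) (n : ℕ) (L C : List ℕ) : ClassType :=
  (profiles (reps adj n L)).filter fun p => decide (∃ X : Set ℕ, (∀ x ∈ X, x ∈ C) ∧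
    X.Pairwise (fun x y => adj x y = true) ∧ p = (trace adj n L X, dominators adj n L C X))

theorem typeOf_mem_classTypes (C : List ℕ) : typeOf adj n L C ∈ classTypes (reps adj n L) := by
  rw [classTypes, List.mem_sublists']
  exact List.filter_sublist

theorem mem_profiles (p : Profile) (R : List ℕ) :
    p ∈ profiles R ↔ p.1.Sublist R ∧ p.2.Sublist R := by
  rw [← List.mem_sublists', ← List.mem_sublists']
  exact List.mem_product

theorem mem_typeOf {C : List ℕ} {p : Profile} : p ∈ typeOf adj n L C ↔
    ∃ X : Set ℕ, (∀ x ∈ X, x ∈ C) ∧ X.Pairwise (fun x y => adj x y = true) ∧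
      p = (trace adj n L X, dominators adj n L C X) := by
  simp only [typeOf, List.mem_filter, decide_eq_true_eq]
  refine ⟨fun h => h.2, fun h => ⟨?_, h⟩⟩
  obtain ⟨X, -, -, rfl⟩ := h
  rw [mem_profiles]
  exact ⟨List.filter_sublist, List.filter_sublist⟩

theorem mem_trace {X : Set ℕ} (hX : ∀ x ∈ X, x ∈ L) {r : ℕ} :
    r ∈ trace adj n L X ↔ ∃ x ∈ X, rep adj n L x = r := by
  simp only [trace, List.mem_filter, decide_eq_true_eq]
  refine ⟨fun h => h.2, fun h => ⟨?_, h⟩⟩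
  obtain ⟨x, hx, rfl⟩ := h
  exact rep_mem_reps (hX x hx)

theorem mem_dominators {C : List ℕ} {X : Set ℕ} {r : ℕ} : r ∈ dominators adj n L C X ↔
    ∃ v ∈ L, v ∉ C ∧ (∀ x ∈ X, adj v x = true) ∧ rep adj n L v = r := by
  simp only [dominators, List.mem_filter, decide_eq_true_eq]
  refine ⟨fun h => h.2, fun h => ⟨?_, h⟩⟩
  obtain ⟨x, hx, -, -, rfl⟩ := h
  exact rep_mem_reps hx

/-- A vertex outside `L` is adjacent to `x` iff it is adjacent to the representative of `x`, so the
trace of `X` decides whether it is adjacent to all of `X`. -/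
theorem adj_trace_iff (hsymm : ∀ x y, adj x y = adj y x) {X : Set ℕ} (hX : ∀ x ∈ X, x ∈ L)
    {v : ℕ} (hv : v < n) (hvL : v ∉ L) :
    (∀ x ∈ trace adj n L X, adj v x = true) ↔ ∀ x ∈ X, adj v x = true := by
  have key : ∀ x ∈ X, adj v (rep adj n L x) = adj v x := fun x hx => by
    rw [hsymm, adj_rep (adj := adj) (hX x hx) hv hvL, hsymm]
  constructor
  · intro h x hx
    rw [← key x hx]
    exact h _ ((mem_trace hX).mpr ⟨x, hx, rfl⟩)
  · intro h y hy
    obtain ⟨x, hx, rfl⟩ := (mem_trace hX).mp hy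
    rw [key x hx]
    exact h x hx

variable (hsymm : ∀ x y, adj x y = adj y x) (h₁ : ∀ x ∈ L₁, x < n) (h₂ : ∀ x ∈ L₂, x < n)
  (hd : ∀ x ∈ L₁, x ∉ L₂)
include hsymm h₁ h₂ hd

/-- Each side lies outside the other, so vertices can be exchanged for representatives on one side
and then on the other. -/
theorem complete_iff {X₁ X₂ : Set ℕ} (hX₁ : ∀ x ∈ X₁, x ∈ L₁) (hX₂ : ∀ x ∈ X₂, x ∈ L₂) :
    (∀ x ∈ trace adj n L₁ X₁, ∀ y ∈ trace adj n L₂ X₂, adj x y = true) ↔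
      ∀ x ∈ X₁, ∀ y ∈ X₂, adj x y = true := by
  have h : ∀ x ∈ trace adj n L₁ X₁, x ∈ L₁ := fun x hx => by
    obtain ⟨y, hy, rfl⟩ := (mem_trace hX₁).mp hx
    exact (rep_spec (hX₁ y hy)).1
  constructor
  · intro h' x hx
    rw [← adj_trace_iff hsymm hX₂ (h₁ x (hX₁ x hx)) (hd x (hX₁ x hx))]
    intro y hy
    have h2 := h' _ ((mem_trace hX₁).mpr ⟨x, hx, rfl⟩) y hy
    obtain ⟨z, hz, rfl⟩ := (mem_trace hX₂).mp hy
    have hz2 := (rep_spec (adj := adj) (n := n) (hX₂ z hz)).1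
    rwa [adj_rep (adj := adj) (hX₁ x hx) (h₂ _ hz2) fun hz1 => hd _ hz1 hz2] at h2
  · intro h' x hx
    rw [adj_trace_iff hsymm hX₂ (h₁ x (h x hx)) (hd x (h x hx))]
    obtain ⟨z, hz, rfl⟩ := (mem_trace hX₁).mp hx
    intro y hy
    rw [adj_rep (adj := adj) (hX₁ z hz) (h₂ y (hX₂ y hy)) fun hz1 => hd _ hz1 (hX₂ y hy)]
    exact h' z hz y hy

/-- For a vertex of `L₁`, adjacency to `X₁` is already recorded in the profile of `X₁`. Adjacency to
`X₂` is a question about outside neighbors, so it can be tested between its representative and the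
trace of `X₂`. -/
theorem dominators_step (hL : L₁ ⊆ L) {C₁ : List ℕ} {X₁ X₂ : Set ℕ} (hX₂ : ∀ x ∈ X₂, x ∈ L₂)
    {r : ℕ} :
    (∃ v ∈ dominators adj n L₁ C₁ X₁, rep adj n L v = r ∧
        ∀ x ∈ trace adj n L₂ X₂, adj v x = true) ↔
      ∃ v ∈ L₁, v ∉ C₁ ∧ (∀ x ∈ X₁, adj v x = true) ∧ (∀ x ∈ X₂, adj v x = true) ∧
        rep adj n L v = r := by
  have key : ∀ v ∈ L₁, (∀ x ∈ trace adj n L₂ X₂, adj (rep adj n L₁ v) x = true) ↔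
      ∀ x ∈ X₂, adj v x = true := by
    intro v hv
    have hv' := (rep_spec (adj := adj) (n := n) hv).1
    rw [adj_trace_iff hsymm hX₂ (h₁ _ hv') (hd _ hv')]
    refine forall₂_congr fun x hx => ?_
    rw [adj_rep (adj := adj) hv (h₂ x (hX₂ x hx)) fun hx1 => hd x hx1 (hX₂ x hx)]
  constructor
  · rintro ⟨v, hv, rfl, h⟩
    obtain ⟨u, hu, huC, huX, rfl⟩ := mem_dominators.mp hv
    exact ⟨u, hu, huC, huX, (key u hu).mp h, (rep_rep hL hu).symm⟩
  · rintro ⟨v, hv, hvC, hvX₁, hvX₂, rfl⟩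
    exact ⟨_, mem_dominators.mpr ⟨v, hv, hvC, hvX₁, rfl⟩, rep_rep hL hv, (key v hv).mpr hvX₂⟩

/-- A common neighbor of `X₁ ∪ X₂` lies in `L₁` or in `L₂`, which gives the two alternatives in the
second component. By disjointness, avoiding `C₁ ++ C₂` means avoiding the part of the class on its
own side. -/
theorem mergeProfile_eq {C₁ C₂ : List ℕ} (hC₁ : C₁ ⊆ L₁) (hC₂ : C₂ ⊆ L₂) {X₁ X₂ : Set ℕ}
    (hX₁ : ∀ x ∈ X₁, x ∈ C₁) (hX₂ : ∀ x ∈ X₂, x ∈ C₂) :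
    mergeProfile adj n (L₁ ++ L₂) (trace adj n L₁ X₁, dominators adj n L₁ C₁ X₁)
        (trace adj n L₂ X₂, dominators adj n L₂ C₂ X₂) =
      (trace adj n (L₁ ++ L₂) (X₁ ∪ X₂), dominators adj n (L₁ ++ L₂) (C₁ ++ C₂) (X₁ ∪ X₂)) := by
  have hX₁' : ∀ x ∈ X₁, x ∈ L₁ := fun x hx => hC₁ (hX₁ x hx)
  have hX₂' : ∀ x ∈ X₂, x ∈ L₂ := fun x hx => hC₂ (hX₂ x hx)
  have hL₁ : L₁ ⊆ L₁ ++ L₂ := List.subset_append_left _ _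
  have hL₂ : L₂ ⊆ L₁ ++ L₂ := List.subset_append_right _ _
  refine Prod.ext (List.filter_congr fun r _ => ?_) (List.filter_congr fun r _ => ?_)
  · rw [Bool.eq_iff_iff]
    simp only [Bool.or_eq_true, List.any_eq_true, beq_iff_eq,
      decide_eq_true_eq]
    constructor
    · rintro (⟨y, hy, rfl⟩ | ⟨y, hy, rfl⟩)
      · obtain ⟨x, hx, rfl⟩ := (mem_trace hX₁').mp hy
        exact ⟨x, .inl hx, (rep_rep hL₁ (hX₁' x hx)).symm⟩
      · obtain ⟨x, hx, rfl⟩ := (mem_trace hX₂').mp hy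
        exact ⟨x, .inr hx, (rep_rep hL₂ (hX₂' x hx)).symm⟩
    · rintro ⟨x, hx | hx, rfl⟩
      · exact .inl ⟨_, (mem_trace hX₁').mpr ⟨x, hx, rfl⟩, rep_rep hL₁ (hX₁' x hx)⟩
      · exact .inr ⟨_, (mem_trace hX₂').mpr ⟨x, hx, rfl⟩, rep_rep hL₂ (hX₂' x hx)⟩
  · rw [Bool.eq_iff_iff]
    simp only [Bool.or_eq_true, List.any_eq_true, beq_iff_eq,
      decide_eq_true_eq, Bool.and_eq_true, List.all_eq_true]
    rw [dominators_step hsymm h₁ h₂ hd hL₁ hX₂',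
      dominators_step hsymm h₂ h₁ (fun x hx hx' => hd x hx' hx) hL₂ hX₁']
    constructor
    · rintro (⟨v, hv, hvC, hv1, hv2, hr⟩ | ⟨v, hv, hvC, hv1, hv2, hr⟩)
      · refine ⟨v, hL₁ hv, ?_, ?_, hr⟩
        · rw [List.mem_append]
          exact fun h => h.elim hvC fun h => hd v hv (hC₂ h)
        · exact fun x hx => hx.elim (hv1 x) (hv2 x)
      · refine ⟨v, hL₂ hv, ?_, ?_, hr⟩
        · rw [List.mem_append]
          exact fun h => h.elim (fun h => hd v (hC₁ h) hv) hvC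
        · exact fun x hx => hx.elim (hv2 x) (hv1 x)
    · rintro ⟨v, hv, hvC, hvX, hr⟩
      rw [List.mem_append, not_or] at hvC
      rcases List.mem_append.mp hv with hv | hv
      · exact .inl ⟨v, hv, hvC.1, fun x hx => hvX x (.inl hx), fun x hx => hvX x (.inr hx), hr⟩
      · exact .inr ⟨v, hv, hvC.2, fun x hx => hvX x (.inr hx), fun x hx => hvX x (.inl hx), hr⟩

/-- The cliques in the union are exactly the unions of a clique in `C₁` and a clique in `C₂` with
all edges between them. Whether these edges are present is decided by the traces, and the profile of
the union by the two profiles. This is what makes types sufficient for the dynamic program. -/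
theorem mergeTypes_eq {C₁ C₂ : List ℕ} (hC₁ : C₁ ⊆ L₁) (hC₂ : C₂ ⊆ L₂) :
    mergeTypes adj n (L₁ ++ L₂) (profiles (reps adj n (L₁ ++ L₂))) (typeOf adj n L₁ C₁)
        (typeOf adj n L₂ C₂) =
      typeOf adj n (L₁ ++ L₂) (C₁ ++ C₂) := by
  refine List.filter_congr fun p _ => ?_
  rw [Bool.eq_iff_iff]
  simp only [List.any_eq_true, beq_iff_eq, decide_eq_true_eq, Bool.and_eq_true,
    List.all_eq_true]
  constructor
  · rintro ⟨p₁, hp₁, p₂, hp₂, hc, rfl⟩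
    obtain ⟨X₁, hX₁, hq₁, rfl⟩ := mem_typeOf.mp hp₁
    obtain ⟨X₂, hX₂, hq₂, rfl⟩ := mem_typeOf.mp hp₂
    have hc' := (complete_iff hsymm h₁ h₂ hd (fun x hx => hC₁ (hX₁ x hx))
      (fun x hx => hC₂ (hX₂ x hx))).mp hc
    refine ⟨X₁ ∪ X₂, fun x hx => ?_, ?_, mergeProfile_eq hsymm h₁ h₂ hd hC₁ hC₂ hX₁ hX₂⟩
    · exact List.mem_append.mpr (hx.imp (hX₁ x) (hX₂ x))
    · rintro x (hx | hx) y (hy | hy) hxy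
      · exact hq₁ hx hy hxy
      · exact hc' x hx y hy
      · rw [hsymm]; exact hc' y hy x hx
      · exact hq₂ hx hy hxy
  · rintro ⟨X, hX, hq, rfl⟩
    have hX₁ : ∀ x ∈ X ∩ {x | x ∈ C₁}, x ∈ C₁ := fun x hx => hx.2
    have hX₂ : ∀ x ∈ X ∩ {x | x ∈ C₂}, x ∈ C₂ := fun x hx => hx.2
    refine ⟨_, mem_typeOf.mpr ⟨X ∩ {x | x ∈ C₁}, hX₁, hq.mono Set.inter_subset_left, rfl⟩,
      _, mem_typeOf.mpr ⟨X ∩ {x | x ∈ C₂}, hX₂, hq.mono Set.inter_subset_left, rfl⟩, ?_, ?_⟩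
    · refine (complete_iff hsymm h₁ h₂ hd (fun x hx => hC₁ (hX₁ x hx))
        (fun x hx => hC₂ (hX₂ x hx))).mpr fun x hx y hy => hq hx.1 hy.1 ?_
      rintro rfl
      exact hd x (hC₁ hx.2) (hC₂ hy.2)
    · rw [mergeProfile_eq hsymm h₁ h₂ hd hC₁ hC₂ hX₁ hX₂, ← Set.inter_union_distrib_left]
      have : X ∩ ({x | x ∈ C₁} ∪ {x | x ∈ C₂}) = X :=
        Set.inter_eq_left.mpr fun x hx => List.mem_append.mp (hX x hx)
      rw [this]

end

-- Joining partial colorings.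

section
variable {adj : ℕ → ℕ → Bool} {n k : ℕ} {L L₁ L₂ : List ℕ} {P : List Profile}

/-- `U` is the record of the pairs of classes that were united, and `r₁`, `r₂` are the classes not
yet used. -/
theorem foldr_joinStep_some {W : List (ClassType × ClassType)} {e f r₁ r₂ g : Entry}
    (h : W.foldr (joinStep adj n L P) (some (e, f, [])) = some (r₁, r₂, g)) :
    ∃ U : List ((ClassType × List ℕ) × (ClassType × List ℕ)),
      e.Perm (U.map Prod.fst ++ r₁) ∧ f.Perm (U.map Prod.snd ++ r₂) ∧
      g = U.map (fun u => (mergeTypes adj n L P u.1.1 u.2.1, u.1.2 ++ u.2.2)) ∧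
      U.map (fun u => (u.1.1, u.2.1)) = W := by
  induction W generalizing r₁ r₂ g with
  | nil =>
    simp only [List.foldr_nil, Option.some.injEq, Prod.mk.injEq] at h
    obtain ⟨rfl, rfl, rfl⟩ := h
    exact ⟨[], by simp⟩
  | cons w W ih =>
    rw [List.foldr_cons] at h
    cases hs : W.foldr (joinStep adj n L P) (some (e, f, [])) with
    | none => simp [hs, joinStep] at h
    | some s =>
      obtain ⟨s₁, s₂, s₃⟩ := s
      obtain ⟨U, hU1, hU2, hU3, hU4⟩ := ih hs
      rw [hs] at h
      simp only [joinStep, Option.elim_some] at h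
      cases hx : (extract (fun x => x.1 == w.1) s₁).1 with
      | none => simp [hx] at h
      | some x =>
        cases hy : (extract (fun x => x.1 == w.2) s₂).1 with
        | none => simp [hx, hy] at h
        | some y =>
          obtain ⟨hx1, hx2⟩ := extract_some hx
          obtain ⟨hy1, hy2⟩ := extract_some hy
          rw [beq_iff_eq] at hx1 hy1
          simp only [hx, hy, Option.elim_some, Option.some.injEq, Prod.mk.injEq] at h
          obtain ⟨rfl, rfl, rfl⟩ := h
          refine ⟨(x, y) :: U, ?_, ?_, ?_, ?_⟩
          · exact hU1.trans ((hx2.append_left _).trans List.perm_middle)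
          · exact hU2.trans ((hy2.append_left _).trans List.perm_middle)
          · simp [hx1, hy1, hU3]
          · simp [hx1, hy1, hU4]

/-- Whether the classes can be united along `W` depends only on the multisets of types of `e` and
`f`. The leftover types `S`, `T` are needed for the induction: the fold treats the tail of `W`
first, and the types in `w` must still be available afterwards. -/
theorem exists_foldr_joinStep {W : List (ClassType × ClassType)} {e f : Entry}
    {S T : List ClassType} (he : (e.map Prod.fst).Perm (W.map Prod.fst ++ S))
    (hf : (f.map Prod.fst).Perm (W.map Prod.snd ++ T)) :
    ∃ r₁ r₂ g, W.foldr (joinStep adj n L P) (some (e, f, [])) = some (r₁, r₂, g) ∧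
      (r₁.map Prod.fst).Perm S ∧ (r₂.map Prod.fst).Perm T := by
  induction W generalizing S T with
  | nil => exact ⟨e, f, [], rfl, by simpa using he, by simpa using hf⟩
  | cons w W ih =>
    obtain ⟨s₁, s₂, g, hs, h1, h2⟩ := ih (S := w.1 :: S) (T := w.2 :: T)
      (he.trans List.perm_middle.symm) (hf.trans List.perm_middle.symm)
    rw [List.foldr_cons, hs]
    simp only [joinStep, Option.elim_some]
    have key : ∀ {s : Entry} {τ : ClassType} {S : List ClassType},
        (s.map Prod.fst).Perm (τ :: S) → ∃ x, (extract (fun x => x.1 == τ) s).1 = some x ∧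
          ((extract (fun x => x.1 == τ) s).2.map Prod.fst).Perm S := by
      intro s τ S h
      cases hx : (extract (fun x => x.1 == τ) s).1 with
      | none =>
        have := extract_none hx
        obtain ⟨x, hx, hx'⟩ := List.mem_map.mp (h.mem_iff.mpr (List.mem_cons_self ..))
        simpa [hx'] using this x hx
      | some x =>
        obtain ⟨hx1, hx2⟩ := extract_some hx
        rw [beq_iff_eq] at hx1
        refine ⟨x, rfl, List.Perm.cons_inv (a := τ) ?_⟩
        have := (hx2.map Prod.fst).symm.trans h
        rwa [List.map_cons, hx1] at this
    obtain ⟨x, hx, hx'⟩ := key h1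
    obtain ⟨y, hy, hy'⟩ := key h2
    rw [hx, hy]
    exact ⟨_, _, _, rfl, hx', hy'⟩

theorem joinEntries_some {W : List (ClassType × ClassType)} {e f g : Entry}
    (h : joinEntries adj n L P W e f = some g) :
    ∃ U : List ((ClassType × List ℕ) × (ClassType × List ℕ)),
      e.Perm (U.map Prod.fst) ∧ f.Perm (U.map Prod.snd) ∧
      g = U.map (fun u => (mergeTypes adj n L P u.1.1 u.2.1, u.1.2 ++ u.2.2)) ∧
      U.map (fun u => (u.1.1, u.2.1)) = W := by
  unfold joinEntries at h
  cases hs : W.foldr (joinStep adj n L P) (some (e, f, [])) with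
  | none => simp [hs] at h
  | some s =>
    obtain ⟨r₁, r₂, g'⟩ := s
    cases r₁ with
    | cons => simp [hs] at h
    | nil =>
      cases r₂ with
      | cons => simp [hs] at h
      | nil =>
        simp only [hs, Option.elim_some, List.isEmpty_nil, Bool.and_self, cond_true,
          Option.some.injEq] at h
        subst h
        simpa using foldr_joinStep_some hs

theorem exists_joinEntries {W : List (ClassType × ClassType)} {e f : Entry}
    (he : (e.map Prod.fst).Perm (W.map Prod.fst)) (hf : (f.map Prod.fst).Perm (W.map Prod.snd)) :
    ∃ g, joinEntries adj n L P W e f = some g := by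
  obtain ⟨r₁, r₂, g, h, h1, h2⟩ := exists_foldr_joinStep (adj := adj) (n := n) (L := L) (P := P) (W := W)
    (e := e) (f := f) (S := []) (T := []) (by simpa using he) (by simpa using hf)
  obtain rfl : r₁ = [] := by simpa using h1
  obtain rfl : r₂ = [] := by simpa using h2
  exact ⟨g, by simp [joinEntries, h]⟩

/-- `e` consists of the classes of a coloring of `L` with `k` colors, with their types. -/
structure IsEntry (adj : ℕ → ℕ → Bool) (n k : ℕ) (L : List ℕ) (e : Entry) : Prop where
  length_eq : e.length = k
  type_eq : ∀ x ∈ e, x.1 = typeOf adj n L x.2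
  perm : (e.map Prod.snd).flatten.Perm L

theorem IsEntry.subset {e : Entry} (he : IsEntry adj n k L e) {x : ClassType × List ℕ}
    (hx : x ∈ e) : x.2 ⊆ L := fun _ hv =>
  he.perm.mem_iff.mp (List.mem_flatten.mpr ⟨_, List.mem_map_of_mem hx, hv⟩)

theorem perm_flatten_append {α β : Type} (U : List β) (f g : β → List α) :
    (U.map fun u => f u ++ g u).flatten.Perm ((U.map f).flatten ++ (U.map g).flatten) := by
  induction U with
  | nil => simp
  | cons u U ih =>
    simp only [List.map_cons, List.flatten_cons, List.append_assoc]
    refine .append_left _ ((ih.append_left _).trans ?_)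
    rw [← List.append_assoc, ← List.append_assoc]
    exact List.perm_append_comm.append_right _

theorem IsEntry.join (hsymm : ∀ x y, adj x y = adj y x) (h₁ : ∀ x ∈ L₁, x < n)
    (h₂ : ∀ x ∈ L₂, x < n) (hd : ∀ x ∈ L₁, x ∉ L₂) {W : List (ClassType × ClassType)}
    {e f g : Entry} (he : IsEntry adj n k L₁ e) (hf : IsEntry adj n k L₂ f)
    (h : joinEntries adj n (L₁ ++ L₂) (profiles (reps adj n (L₁ ++ L₂))) W e f = some g) :
    IsEntry adj n k (L₁ ++ L₂) g := by
  obtain ⟨U, h1, h2, rfl, -⟩ := joinEntries_some h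
  refine ⟨?_, ?_, ?_⟩
  · rw [List.length_map, ← he.length_eq, h1.length_eq, List.length_map]
  · intro x hx
    obtain ⟨u, hu, rfl⟩ := List.mem_map.mp hx
    have e1 := h1.mem_iff.mpr (List.mem_map_of_mem hu)
    have e2 := h2.mem_iff.mpr (List.mem_map_of_mem hu)
    dsimp only
    rw [he.type_eq _ e1, hf.type_eq _ e2]
    exact mergeTypes_eq hsymm h₁ h₂ hd (he.subset e1) (hf.subset e2)
  · rw [List.map_map]
    refine (perm_flatten_append U (fun u => u.1.2) (fun u => u.2.2)).trans (.append ?_ ?_)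
    · refine .trans (List.Perm.flatten ?_) he.perm
      have := (h1.map Prod.snd).symm
      rwa [List.map_map] at this
    · refine .trans (List.Perm.flatten ?_) hf.perm
      have := (h2.map Prod.snd).symm
      rwa [List.map_map] at this

theorem mem_joinTables {U : List (List (ClassType × ClassType))} {a b : List Entry} {g : Entry}
    (h : g ∈ joinTables adj n U L P a b) :
    ∃ W ∈ U, ∃ e ∈ a, ∃ f ∈ b, joinEntries adj n L P W e f = some g := by
  simp only [joinTables, List.mem_flatMap, Option.mem_toList] at h
  obtain ⟨W, hW, h⟩ := h
  have := List.mem_of_head? h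
  simp only [List.mem_flatMap, Option.mem_toList] at this
  obtain ⟨e, he, f, hf, h⟩ := this
  exact ⟨W, hW, e, he, f, hf, h⟩

/-- The table keeps only the first success for `W`, which may come from other entries `e'`, `f'`.
This is harmless, because the types of its classes are determined by `W` alone. -/
theorem exists_mem_joinTables {U : List (List (ClassType × ClassType))} {a b : List Entry}
    {W : List (ClassType × ClassType)} {e f g : Entry} (hW : W ∈ U) (he : e ∈ a) (hf : f ∈ b)
    (h : joinEntries adj n L P W e f = some g) :
    ∃ e' ∈ a, ∃ f' ∈ b, ∃ g' ∈ joinTables adj n U L P a b,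
      joinEntries adj n L P W e' f' = some g' := by
  have hne : g ∈ a.flatMap fun e => b.flatMap fun f => (joinEntries adj n L P W e f).toList := by
    simp only [List.mem_flatMap, Option.mem_toList]
    exact ⟨e, he, f, hf, h⟩
  cases hl : a.flatMap fun e => b.flatMap fun f => (joinEntries adj n L P W e f).toList with
  | nil => simp [hl] at hne
  | cons g' l =>
    have hg : g' ∈ a.flatMap fun e => b.flatMap fun f => (joinEntries adj n L P W e f).toList := by
      simp [hl]
    simp only [List.mem_flatMap, Option.mem_toList] at hg
    obtain ⟨e', he', f', hf', h'⟩ := hg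
    refine ⟨e', he', f', hf', g', ?_, h'⟩
    simp only [joinTables, List.mem_flatMap]
    exact ⟨W, hW, by simp [hl]⟩

theorem length_joinTables_le (U : List (List (ClassType × ClassType))) (P : List Profile)
    (a b : List Entry) :
    (joinTables adj n U L P a b).length ≤ U.length := by
  rw [joinTables, List.length_flatMap]
  refine (List.sum_le_card_nsmul _ 1 ?_).trans (by simp)
  intro x hx
  obtain ⟨W, -, rfl⟩ := List.mem_map.mp hx
  cases (a.flatMap fun e => b.flatMap fun f => (joinEntries adj n L P W e f).toList).head? <;> simp

theorem reps_singleton (v : ℕ) : reps adj n [v] = [v] := by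
  have := (rep_spec (adj := adj) (n := n) (L := [v]) (v := v) (by simp)).1
  simp only [List.mem_singleton] at this
  simp [reps, this]

theorem rep_singleton (v : ℕ) : rep adj n [v] v = v := by
  have := (rep_spec (adj := adj) (n := n) (L := [v]) (v := v) (by simp)).1
  simpa only [List.mem_singleton] using this

theorem profiles_singleton (v : ℕ) :
    profiles [v] = [([], []), ([], [v]), ([v], []), ([v], [v])] := rfl

/-- The cliques are `∅` and `{v}`, and no vertex below the leaf remains outside the class. -/
theorem typeOf_singleton_self (v : ℕ) : typeOf adj n [v] [v] = [([], []), ([v], [])] := by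
  have key : ∀ p ∈ profiles (reps adj n [v]), p ∈ typeOf adj n [v] [v] ↔
      p = ([], []) ∨ p = ([v], []) := by
    intro p _
    have hdom : ∀ X, dominators adj n [v] [v] X = [] := fun X => by
      refine List.eq_nil_iff_forall_not_mem.mpr fun r hr => ?_
      obtain ⟨u, hu, hu', -⟩ := mem_dominators.mp hr
      exact hu' hu
    rw [mem_typeOf]
    simp only [hdom]
    constructor
    · rintro ⟨X, hX, -, rfl⟩
      simp only [trace, reps_singleton]
      by_cases h : ∃ x ∈ X, rep adj n [v] x = v <;> simp [h]
    · rintro (rfl | rfl)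
      · exact ⟨∅, by simp, by simp, by simp [trace]⟩
      · exact ⟨{v}, by simp, by simp, by simp [trace, reps_singleton, rep_singleton]⟩
  have : typeOf adj n [v] [v] = (profiles (reps adj n [v])).filter fun p =>
      decide (p = ([], []) ∨ p = ([v], [])) := by
    refine List.filter_congr fun p hp => ?_
    have := key p hp
    rw [typeOf, List.mem_filter] at this
    rw [Bool.eq_iff_iff, decide_eq_true_iff (p := p = ([], []) ∨ p = ([v], [])), ← this]
    exact ⟨fun h => ⟨hp, h⟩, fun h => h.2⟩
  rw [this, reps_singleton, profiles_singleton]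
  simp

/-- The only clique is empty, and `v`, being outside the class, is vacuously adjacent to all of it.
-/
theorem typeOf_singleton_nil (v : ℕ) : typeOf adj n [v] [] = [([], [v])] := by
  have key : ∀ p ∈ profiles (reps adj n [v]), p ∈ typeOf adj n [v] [] ↔ p = ([], [v]) := by
    intro p _
    rw [mem_typeOf]
    have h0 : (trace adj n [v] ∅, dominators adj n [v] [] ∅) = ([], [v]) := by
      simp [trace, dominators, reps_singleton, rep_singleton]
    constructor
    · rintro ⟨X, hX, -, rfl⟩
      obtain rfl : X = ∅ := Set.eq_empty_iff_forall_notMem.mpr fun x hx => by simpa using hX x hx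
      exact h0
    · rintro rfl
      exact ⟨∅, by simp, by simp, h0.symm⟩
  have : typeOf adj n [v] [] = (profiles (reps adj n [v])).filter fun p =>
      decide (p = ([], [v])) := by
    refine List.filter_congr fun p hp => ?_
    have := key p hp
    rw [typeOf, List.mem_filter] at this
    rw [Bool.eq_iff_iff, decide_eq_true_iff (p := p = ([], [v])), ← this]
    exact ⟨fun h => ⟨hp, h⟩, fun h => h.2⟩
  rw [this, reps_singleton, profiles_singleton]
  simp

-- Soundness and completeness of the tables.

variable (hsymm : ∀ x y, adj x y = adj y x) (hk : 0 < k)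
include hsymm hk

theorem isEntry_of_mem_value {T : BinTree} (hT : T.leaves.Nodup) (hn : ∀ v ∈ T.leaves, v < n)
    {e : Entry} (he : e ∈ (T.value adj n k).2) : IsEntry adj n k T.leaves e := by
  induction T generalizing e with
  | leaf v =>
    simp only [BinTree.value, leafValue, List.mem_singleton] at he
    subst he
    refine ⟨?_, ?_, ?_⟩
    · simp; omega
    · intro x hx
      rcases List.mem_cons.mp hx with rfl | hx
      · exact (typeOf_singleton_self v).symm
      · rw [List.tail_replicate] at hx
        rw [List.eq_of_mem_replicate hx]
        exact (typeOf_singleton_nil v).symm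
    · simp [BinTree.leaves]
  | node s t ih1 ih2 =>
    simp only [BinTree.leaves, List.nodup_append, List.mem_append] at hT hn ⊢
    simp only [BinTree.value, nodeValue, BinTree.value_fst] at he
    obtain ⟨W, hW, e₁, he₁, e₂, he₂, h⟩ := mem_joinTables he
    exact (ih1 hT.1 (fun v hv => hn v (.inl hv)) he₁).join hsymm (fun v hv => hn v (.inl hv))
      (fun v hv => hn v (.inr hv)) (fun v hv hv' => hT.2.2 v hv v hv' rfl)
      (ih2 hT.2.1 (fun v hv => hn v (.inr hv)) he₂) h

omit hk in
-- Completeness is an exchange argument: the entry found need not be the restriction of `φ`, but it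
-- has the same multiset of types. That is preserved at a node, since joinability and the resulting
-- types depend only on the types of the children's classes.
theorem exists_mem_value {T : BinTree} (hT : T.leaves.Nodup) (hn : ∀ v ∈ T.leaves, v < n)
    {φ : ℕ → ℕ} (hφ : ∀ v ∈ T.leaves, φ v < k) : ∃ e ∈ (T.value adj n k).2,
      (e.map Prod.fst).Perm ((List.range k).map fun i =>
        typeOf adj n T.leaves (T.leaves.filter fun v => φ v == i)) := by
  induction T with
  | leaf v =>
    have hv : φ v < k := hφ v (by simp [BinTree.leaves])
    refine ⟨_, List.mem_singleton.mpr rfl, ?_⟩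
    -- Bring the color of `v` to the front; each of the other `k - 1` classes is empty.
    have h := (List.perm_cons_erase (List.mem_range.mpr hv)).map fun i =>
        typeOf adj n [v] ([v].filter fun v => φ v == i)
    refine .trans ?_ h.symm
    have h2 : ((List.range k).erase (φ v)).map (fun i =>
        typeOf adj n [v] ([v].filter fun v => φ v == i)) =
          List.replicate (k - 1) [([], [v])] := by
      rw [List.eq_replicate_iff]
      refine ⟨by simp [List.length_erase_of_mem (List.mem_range.mpr hv)], fun τ hτ => ?_⟩
      obtain ⟨i, hi, rfl⟩ := List.mem_map.mp hτ
      have hne : φ v ≠ i := fun h' => by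
        have := (List.nodup_range.mem_erase_iff).mp hi
        exact this.1 h'.symm
      have : ([v].filter fun v => φ v == i) = [] := by simp [hne]
      rw [this, typeOf_singleton_nil]
    rw [List.map_cons, List.map_cons, h2]
    have : ([v].filter fun w => φ w == φ v) = [v] := by simp
    rw [this, typeOf_singleton_self]
    simp
  | node s t ih1 ih2 =>
    simp only [BinTree.leaves, List.nodup_append, List.mem_append] at hT hn hφ ⊢
    obtain ⟨e, he, he'⟩ := ih1 hT.1 (fun v hv => hn v (.inl hv)) fun v hv => hφ v (.inl hv)
    obtain ⟨f, hf, hf'⟩ := ih2 hT.2.1 (fun v hv => hn v (.inr hv)) fun v hv => hφ v (.inr hv)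
    set σ := fun i => typeOf adj n s.leaves (s.leaves.filter fun v => φ v == i)
    set τ := fun i => typeOf adj n t.leaves (t.leaves.filter fun v => φ v == i)
    -- `W` describes how `φ` itself unites classes: color `i` contributes the pair `(σ i, τ i)`.
    obtain ⟨W, hW, hp⟩ := exists_perm_mem_msets (k := k)
      (A := (classTypes (reps adj n s.leaves)).product (classTypes (reps adj n t.leaves)))
      (W := (List.range k).map fun i => (σ i, τ i)) (by simp) (by
        intro w hw
        obtain ⟨i, -, rfl⟩ := List.mem_map.mp hw
        exact List.mem_product.mpr ⟨typeOf_mem_classTypes _, typeOf_mem_classTypes _⟩)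
    have he2 : (e.map Prod.fst).Perm (W.map Prod.fst) :=
      he'.trans (by have := hp.map Prod.fst; rwa [List.map_map] at this)
    have hf2 : (f.map Prod.fst).Perm (W.map Prod.snd) :=
      hf'.trans (by have := hp.map Prod.snd; rwa [List.map_map] at this)
    obtain ⟨g, hg⟩ := exists_joinEntries (adj := adj) (n := n) (L := s.leaves ++ t.leaves)
      (P := profiles (reps adj n (s.leaves ++ t.leaves))) he2 hf2
    -- The stored `g'` may differ from `g`, but it was joined along the same `W`, which fixes its
    -- multiset of types.
    obtain ⟨e', -, f', -, g', hg', h⟩ := exists_mem_joinTables hW he hf hg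
    refine ⟨g', ?_, ?_⟩
    · simp only [BinTree.value, nodeValue, BinTree.value_fst]
      exact hg'
    · obtain ⟨U, -, -, rfl, rfl⟩ := joinEntries_some h
      have := (hp.map fun w => mergeTypes adj n (s.leaves ++ t.leaves)
        (profiles (reps adj n (s.leaves ++ t.leaves))) w.1 w.2).symm
      rw [List.map_map, List.map_map] at this
      rw [List.map_map]
      refine this.trans (.of_eq (List.map_congr_left fun i _ => ?_))
      rw [List.filter_append]
      exact mergeTypes_eq hsymm (fun v hv => hn v (.inl hv)) (fun v hv => hn v (.inr hv))
        (fun v hv hv' => hT.2.2 v hv v hv' rfl) List.filter_sublist.subset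
        List.filter_sublist.subset

omit hsymm hk in
/-- Every clique in `C` has a common neighbor outside `C`. -/
theorem typeOf_good_iff {C : List ℕ} :
    ((typeOf adj n L C).all fun p => !p.2.isEmpty) = true ↔
      ∀ X : Set ℕ, (∀ x ∈ X, x ∈ C) → X.Pairwise (fun x y => adj x y = true) →
        ∃ v ∈ L, v ∉ C ∧ ∀ x ∈ X, adj v x = true := by
  rw [List.all_eq_true]
  constructor
  · intro h X hX hq
    have := h _ (mem_typeOf.mpr ⟨X, hX, hq, rfl⟩)
    simp only [Bool.not_eq_true', List.isEmpty_eq_false_iff_exists_mem] at this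
    obtain ⟨r, hr⟩ := this
    obtain ⟨v, hv, hvC, hvX, -⟩ := mem_dominators.mp hr
    exact ⟨v, hv, hvC, hvX⟩
  · intro h p hp
    obtain ⟨X, hX, hq, rfl⟩ := mem_typeOf.mp hp
    obtain ⟨v, hv, hvC, hvX⟩ := h X hX hq
    simp only [Bool.not_eq_true', List.isEmpty_eq_false_iff_exists_mem]
    exact ⟨_, mem_dominators.mpr ⟨v, hv, hvC, hvX, rfl⟩⟩

/-- `φ` is a clique coloring of the graph with the vertices in `L`. -/
def GoodColoring (adj : ℕ → ℕ → Bool) (k : ℕ) (L : List ℕ) (φ : ℕ → ℕ) : Prop :=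
  ∀ i < k, ∀ X : Set ℕ, (∀ x ∈ X, x ∈ L ∧ φ x = i) → X.Pairwise (fun x y => adj x y = true) →
    ∃ v ∈ L, φ v ≠ i ∧ ∀ x ∈ X, adj v x = true

omit hk in
-- Goodness of an entry is a property of its types, so the entry that `exists_mem_value` provides
-- for a good coloring would itself be good.
theorem answer_eq_none {T : BinTree} (hT : T.leaves.Nodup) (hn : ∀ v ∈ T.leaves, v < n)
    (h : answer n (T.value adj n k).2 = none) {φ : ℕ → ℕ} (hφ : ∀ v ∈ T.leaves, φ v < k) :
    ¬ GoodColoring adj k T.leaves φ := by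
  intro hgood
  obtain ⟨e, he, hp⟩ := exists_mem_value hsymm hT hn hφ
  have hge : goodEntry e = true := by
    rw [goodEntry, List.all_eq_true]
    intro x hx
    obtain ⟨i, hi, hi'⟩ := List.mem_map.mp (hp.mem_iff.mp (List.mem_map_of_mem hx))
    rw [← hi', typeOf_good_iff]
    intro X hX hq
    obtain ⟨v, hv, hvi, hvX⟩ := hgood i (List.mem_range.mp hi) X
      (fun x hx => by simpa using hX x hx) hq
    exact ⟨v, hv, by simp [hvi], hvX⟩
  have hne : e ∈ ((T.value adj n k).2.filter goodEntry) := List.mem_filter.mpr ⟨he, hge⟩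
  unfold answer at h
  cases hl : (T.value adj n k).2.filter goodEntry with
  | nil => simp [hl] at hne
  | cons a l => simp [hl] at h

/-- The classes of a stored entry partition the vertices, so the position of the class containing a
vertex is a coloring whose classes are those of the entry. -/
theorem answer_eq_some {T : BinTree} (hT : T.leaves.Nodup) (hn : ∀ v ∈ T.leaves, v < n)
    {l : List ℕ} (h : answer n (T.value adj n k).2 = some l) :
    ∃ φ : ℕ → ℕ, l = (List.range n).map φ ∧ (∀ v ∈ T.leaves, φ v < k) ∧
      GoodColoring adj k T.leaves φ := by
  unfold answer at h
  cases hl : ((T.value adj n k).2.filter goodEntry).head? with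
  | none => simp [hl] at h
  | some e =>
    simp only [hl, Option.elim_some, Option.some.injEq] at h
    obtain ⟨he, hge⟩ := List.mem_filter.mp (List.mem_of_head? hl)
    have hE := isEntry_of_mem_value hsymm hk hT hn he
    -- The fold computes the index of the first class containing `v`; for a vertex in no class it
    -- would return `e.length`.
    have hfold : ∀ v, e.foldr (fun x c => bif x.2.contains v then 0 else c + 1) 0 =
        e.findIdx fun x => x.2.contains v := by
      intro v
      clear hl he hge hE h
      induction e with
      | nil => rfl
      | cons x e ih => rw [List.foldr_cons, ih, List.findIdx_cons]
    have hnd : (e.map Prod.snd).flatten.Nodup := hE.perm.nodup_iff.mpr hT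
    have hpw := (List.nodup_flatten.mp hnd).2
    rw [List.pairwise_map] at hpw
    have hex : ∀ v ∈ T.leaves, ∃ x ∈ e, x.2.contains v = true := by
      intro v hv
      obtain ⟨C, hC, hvC⟩ := List.mem_flatten.mp (hE.perm.mem_iff.mpr hv)
      obtain ⟨x, hx, rfl⟩ := List.mem_map.mp hC
      exact ⟨x, hx, by simpa using hvC⟩
    have hidx : ∀ v, ∀ i, (hi : i < e.length) → v ∈ e[i].2 →
        (e.findIdx fun x => x.2.contains v) = i := by
      intro v i hi hv
      rw [List.findIdx_eq hi]
      refine ⟨by simpa using hv, fun j hj => ?_⟩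
      have := List.pairwise_iff_getElem.mp hpw j i (by omega) hi hj
      simpa using fun hv' => this hv' hv
    refine ⟨fun v => e.findIdx fun x => x.2.contains v, ?_, ?_, ?_⟩
    · rw [← h, colorList]
      exact List.map_congr_left fun v _ => hfold v
    · intro v hv
      rw [← hE.length_eq]
      exact List.findIdx_lt_length_of_exists (hex v hv)
    · intro i hi X hX hq
      have hi' : i < e.length := hE.length_eq ▸ hi
      have hxi : e[i] ∈ e := List.getElem_mem hi'
      have hg := List.all_eq_true.mp hge _ hxi
      rw [hE.type_eq _ hxi, typeOf_good_iff] at hg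
      obtain ⟨v, hv, hvC, hvX⟩ := hg X (fun x hx => by
        obtain ⟨hxL, rfl⟩ := hX x hx
        simpa using List.findIdx_getElem (w := hi')) hq
      refine ⟨v, hv, fun h' => hvC ?_, hvX⟩
      subst h'
      simpa using List.findIdx_getElem (w := hi')

end

/-! ## Running times -/

theorem sz_perm {α : Type} [Enc α] {l l' : List α} (h : l.Perm l') : sz l = sz l' := by
  induction h with
  | nil => rfl
  | cons a _ ih => simp [ih]
  | swap a b l => simp; omega
  | trans _ _ ih1 ih2 => exact ih1.trans ih2

/-- The entry of an adjacency matrix, and `false` outside of the matrix. -/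
def entryOf (M : List (List Bool)) (u v : ℕ) : Bool :=
  (((M.drop u).head?.getD []).drop v).head?.getD false

namespace Poly
variable {α β γ : Type} [Enc α] [Enc β] [Enc γ]

/-- Weakening: under a binder the context becomes a pair of the old context and the bound element.
Thus `last` and iterated `wk` play the role of de Bruijn variables below. -/
theorem wk {f : γ → β} (hf : Poly f) : Poly fun p : γ × α => f p.1 := hf.comp (fst id)

theorem last : Poly fun p : γ × α => p.2 := snd id

theorem extract {p : γ → α → Bool} {l : γ → List α} (hp : Poly fun x : γ × α => p x.1 x.2)
    (hl : Poly l) : Poly fun c => extract (p c) (l c) := by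
  refine foldr hl (const _)
    (step := fun c x s => bif p c x && !s.1.isSome then (some x, s.2) else (s.1, x :: s.2))
    ?_ (G := fun x => sz x.2 + 3) ((last.1).add (.const 3)) ?_
  · exact cond (and (hp.comp (pair (fst id) (fst last))) (not (isSome (fst (snd last)))))
      (pair (mk_some (fst last)) (snd (snd last)))
      (pair (fst (snd last)) (cons (fst last) (snd (snd last))))
  · rintro c a ⟨o, l⟩
    cases o <;> cases p c a <;> simp <;> omega

variable {M : γ → List (List Bool)} {n k u v : γ → ℕ} {L R A B : γ → List ℕ}

theorem entryOf (hM : Poly M) (hu : Poly u) (hv : Poly v) :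
    Poly fun c => entryOf (M c) (u c) (v c) :=
  option_getD (head? (drop hv (option_getD (head? (drop hu hM)) (const [])))) (const false)

theorem sameOutside (hM : Poly M) (hn : Poly n) (hL : Poly L) (hu : Poly u) (hv : Poly v) :
    Poly fun c => sameOutside (CliqueCol.entryOf (M c)) (n c) (L c) (u c) (v c) :=
  all (range hn) (or (contains hL.wk last)
    (beq (entryOf hM.wk hu.wk last) (entryOf hM.wk hv.wk last)))

theorem rep (hM : Poly M) (hn : Poly n) (hL : Poly L) (hv : Poly v) :
    Poly fun c => rep (CliqueCol.entryOf (M c)) (n c) (L c) (v c) :=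
  option_getD (head? (filter hL (sameOutside hM.wk hn.wk hL.wk last hv.wk))) hv

theorem reps (hM : Poly M) (hn : Poly n) (hL : Poly L) :
    Poly fun c => reps (CliqueCol.entryOf (M c)) (n c) (L c) :=
  filter hL (beq (rep hM.wk hn.wk hL.wk last) last)

theorem mergeProfile {p q : γ → Profile} (hM : Poly M) (hn : Poly n) (hL : Poly L) (hp : Poly p)
    (hq : Poly q) :
    Poly fun c => mergeProfile (CliqueCol.entryOf (M c)) (n c) (L c) (p c) (q c) := by
  have key : ∀ {p q : γ → Profile}, Poly p → Poly q → Poly fun x : γ × ℕ =>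
      (p x.1).2.any fun v => (CliqueCol.rep (CliqueCol.entryOf (M x.1)) (n x.1) (L x.1) v == x.2) &&
        (q x.1).1.all fun y => CliqueCol.entryOf (M x.1) v y := fun hp hq =>
    any (snd hp).wk (and (beq (rep hM.wk.wk hn.wk.wk hL.wk.wk last) last.wk)
      (all (fst hq).wk.wk (entryOf hM.wk.wk.wk last.wk last)))
  have key' : ∀ {p : γ → Profile}, Poly p → Poly fun x : γ × ℕ =>
      (p x.1).1.any fun v =>
        CliqueCol.rep (CliqueCol.entryOf (M x.1)) (n x.1) (L x.1) v == x.2 := fun hp =>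
    any (fst hp).wk (beq (rep hM.wk.wk hn.wk.wk hL.wk.wk last) last.wk)
  exact pair (filter (reps hM hn hL) (or (key' hp) (key' hq)))
    (filter (reps hM hn hL) (or (key hp hq) (key hq hp)))

end Poly

-- Enumerations of exponential length.

namespace PT
variable {α γ : Type} [Enc α] [Enc γ] {m : γ → ℕ}

/-- The output is exponential, so the measure is required to dominate `2 ^ length`; then the list of
sublists of any suffix fits into the bound, each sublist being no larger than `R c`. -/
theorem sublists' {R : γ → List α} (hm : PB m sz) (hR : PT m R)
    (h : PB m fun c => 2 ^ (R c).length) : PT m fun c => (R c).sublists' := by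
  have e : ∀ l : List α, l.foldr (fun a s => s ++ s.map (a :: ·)) [[]] = l.sublists' := by
    intro l
    induction l with
    | nil => rfl
    | cons a l ih => rw [List.foldr_cons, ih, List.sublists'_cons]
  have := PT.foldr hm hR (of_poly (Poly.const [[]]) hm)
    (step := fun _ a s => s ++ s.map (a :: ·))
    (Poly.append (.snd .last) (Poly.map (.snd .last) (Poly.cons (Poly.wk (.fst .last)) .last)))
    (B := fun c => 2 ^ (R c).length * (sz (R c) + 1) + 1)
    ((h.mul (hR.1.add (.const 1))).add (.const 1)) fun c s hs => by
      rw [e]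
      refine (sz_list_le (B := sz (R c)) fun x hx => ?_).trans ?_
      · exact sz_le_of_sublist ((List.mem_sublists'.mp hx).trans hs.sublist)
      · rw [List.length_sublists']
        exact Nat.add_le_add_right (Nat.mul_le_mul_right _
          (Nat.pow_le_pow_right (by omega) hs.length_le)) _
  exact (funext fun c => (e _).symm : (fun c => (R c).sublists') = _) ▸ this

theorem msets {k : γ → ℕ} {A : γ → List α} (hm : PB m sz) (hk : Poly k) (hA : PT m A)
    (h : PB m fun c => (k c + 1) ^ (A c).length) : PT m fun c => msets (k c) (A c) := by
  refine PT.foldr hm hA (of_poly (Poly.const [[]]) hm)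
    (step := fun c a acc => (List.range (k c + 1)).flatMap fun j => acc.map fun l =>
      List.replicate j a ++ l)
    (Poly.flatMap (.range (.succ hk.wk)) (Poly.map (Poly.wk (.snd .last))
      (.append (.replicate (Poly.wk .last) (Poly.wk (Poly.wk (.fst .last)))) .last)))
    (B := fun c => (k c + 1) ^ (A c).length * ((k c * sz (A c) * (sz (A c) + 1) + 1) + 1) + 1)
    ?_ fun c s hs => ?_
  · have hk' : PB m k := (hm.trans hk.1).mono fun c => by rw [sz_nat]; omega
    exact (h.mul ((((hk'.mul hA.1).mul (hA.1.add (.const 1))).add (.const 1)).add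
      (.const 1))).add (.const 1)
  · change sz (CliqueCol.msets (k c) s) ≤ _
    refine (sz_list_le (B := k c * sz (A c) * (sz (A c) + 1) + 1) fun W hW => ?_).trans ?_
    · obtain ⟨h1, h2⟩ := mem_of_mem_msets hW
      refine (sz_list_le (B := sz (A c)) fun w hw => sz_le_of_mem (hs.mem (h2 w hw))).trans ?_
      refine Nat.add_le_add_right (Nat.mul_le_mul_right _ (h1.trans (Nat.mul_le_mul_left _ ?_))) _
      exact hs.length_le.trans (length_le_sz _)
    · rw [length_msets]
      exact Nat.add_le_add_right (Nat.mul_le_mul_right _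
        (Nat.pow_le_pow_right (by omega) hs.length_le)) _

end PT

theorem length_profiles (R : List ℕ) : (profiles R).length = 4 ^ R.length := by
  unfold profiles
  refine (List.length_product _ _).trans ?_
  rw [List.length_sublists', ← mul_pow]; rfl

theorem length_classTypes (R : List ℕ) : (classTypes R).length = 2 ^ 4 ^ R.length := by
  rw [classTypes, List.length_sublists', length_profiles]

section
variable {γ : Type} [Enc γ] {m : γ → ℕ}

theorem PT.profiles {R : γ → List ℕ} (hm : PB m sz) (hR : PT m R)
    (h : PB m fun c => 2 ^ (R c).length) : PT m fun c => profiles (R c) :=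
  PT.comp_poly (g := fun p : List (List ℕ) × List (List ℕ) => p.1.product p.2)
    (Poly.product (Poly.fst .id) (Poly.snd .id)) ((PT.sublists' hm hR h).pair (PT.sublists' hm hR h))

theorem PT.classTypes {R : γ → List ℕ} (hm : PB m sz) (hR : PT m R)
    (h : PB m fun c => 2 ^ 4 ^ (R c).length) : PT m fun c => classTypes (R c) := by
  refine PT.sublists' hm (PT.profiles hm hR (h.mono fun c => ?_)) (h.mono fun c => ?_)
  · exact Nat.pow_le_pow_right (by omega) (Nat.lt_pow_self (by omega)).le
  · rw [length_profiles]

/-- A bound for the number of multisets of pairs of types. -/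
def pairingBound (k a b : ℕ) : ℕ := (k + 2) ^ (2 ^ 4 ^ a * 2 ^ 4 ^ b)

theorem PT.pairings {M : γ → List (List Bool)} {n k : γ → ℕ} {A B : γ → List ℕ} (hm : PB m sz)
    (hM : Poly M) (hn : Poly n) (hk : Poly k) (hA : Poly A) (hB : Poly B)
    (h : PB m fun c => pairingBound (k c) (reps (entryOf (M c)) (n c) (A c)).length
      (reps (entryOf (M c)) (n c) (B c)).length) :
    PT m fun c => pairings (entryOf (M c)) (n c) (k c) (A c) (B c) := by
  -- The base `k + 2` is at least `2` for every `k`, so the power exceeds its exponent; one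
  -- hypothesis thus also covers the numbers of types.
  have hle : ∀ k a b : ℕ, 2 ^ 4 ^ a * 2 ^ 4 ^ b ≤ pairingBound k a b := fun k a b =>
    (Nat.lt_pow_self (by omega)).le
  have h1 := h.mono (h := fun c => 2 ^ 4 ^ (reps (entryOf (M c)) (n c) (A c)).length) fun c =>
    (Nat.le_mul_of_pos_right _ (Nat.pow_pos (by omega))).trans (hle _ _ _)
  have h2 := h.mono (h := fun c => 2 ^ 4 ^ (reps (entryOf (M c)) (n c) (B c)).length) fun c =>
    (Nat.le_mul_of_pos_left _ (Nat.pow_pos (by omega))).trans (hle _ _ _)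
  refine PT.msets hm hk
    (PT.comp_poly (g := fun p : List ClassType × List ClassType => p.1.product p.2)
      (Poly.product (Poly.fst .id) (Poly.snd .id))
      ((PT.classTypes hm (PT.of_poly (.reps hM hn hA) hm) h1).pair
        (PT.classTypes hm (PT.of_poly (.reps hM hn hB) hm) h2))) (h.mono fun c => ?_)
  have e : ((CliqueCol.classTypes (reps (entryOf (M c)) (n c) (A c))).product
      (CliqueCol.classTypes (reps (entryOf (M c)) (n c) (B c)))).length = _ :=
    List.length_product _ _
  rw [e, length_classTypes, length_classTypes]
  exact Nat.pow_le_pow_left (by omega) _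

end

theorem sz_extract {α : Type} [Enc α] {p : α → Bool} {l : List α} {x : α}
    (h : (extract p l).1 = some x) : sz x + sz (extract p l).2 + 1 = sz l := by
  rw [sz_perm (extract_some h).2, sz_cons]

/-- The lists of vertices are only moved and concatenated, so the one new piece of data is the
merged type. This is the additive growth that `Poly.foldr` asks for. -/
theorem sz_joinStep_le (adj : ℕ → ℕ → Bool) (n : ℕ) (L : List ℕ) (P : List Profile)
    (w : ClassType × ClassType) (s : Option (Entry × Entry × Entry)) :
    sz (joinStep adj n L P w s) ≤ sz s + (sz (mergeTypes adj n L P w.1 w.2) + 5) := by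
  cases s with
  | none => simp [joinStep]
  | some s =>
    obtain ⟨s₁, s₂, s₃⟩ := s
    simp only [joinStep, Option.elim_some]
    cases hx : (extract (fun x => x.1 == w.1) s₁).1 with
    | none => simp; omega
    | some x =>
      cases hy : (extract (fun x => x.1 == w.2) s₂).1 with
      | none => simp; omega
      | some y =>
        have h1 := sz_extract hx
        have h2 := sz_extract hy
        have h3 := sz_append x.2 y.2
        rw [sz_prod] at h1 h2
        simp only [Option.elim_some, sz_some, sz_pair, sz_cons]
        omega

namespace Poly
variable {γ : Type} [Enc γ] {M : γ → List (List Bool)} {n k u v : γ → ℕ} {L R A B : γ → List ℕ}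

variable {P : γ → List Profile}

theorem mergeTypes {σ τ : γ → ClassType} (hM : Poly M) (hn : Poly n)
    (hL : Poly L) (hP : Poly P) (hσ : Poly σ) (hτ : Poly τ) :
    Poly fun c => mergeTypes (CliqueCol.entryOf (M c)) (n c) (L c) (P c) (σ c) (τ c) :=
  filter hP (any hσ.wk (any hτ.wk.wk (and
    (all (fst last.wk) (all (fst last.wk) (entryOf hM.wk.wk.wk.wk.wk last.wk last)))
    (beq last.wk.wk (mergeProfile hM.wk.wk.wk hn.wk.wk.wk hL.wk.wk.wk last.wk last)))))

theorem joinStep {w : γ → ClassType × ClassType} {s : γ → Option (Entry × Entry × Entry)}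
    (hM : Poly M) (hn : Poly n) (hL : Poly L) (hP : Poly P) (hw : Poly w) (hs : Poly s) :
    Poly fun c => joinStep (CliqueCol.entryOf (M c)) (n c) (L c) (P c) (w c) (s c) := by
  refine option_elim hs (const none) ?_
  refine option_elim (fst (extract (beq (fst last) (fst hw.wk.wk)) (fst last))) (const none) ?_
  refine option_elim (fst (extract (beq (fst last) (snd hw.wk.wk.wk)) (fst (snd last.wk))))
    (const none) ?_
  exact mk_some (pair (snd (extract (beq (fst last) (fst hw.wk.wk.wk.wk)) (fst last.wk.wk)))
    (pair (snd (extract (beq (fst last) (snd hw.wk.wk.wk.wk)) (fst (snd last.wk.wk))))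
      (cons (pair (mergeTypes hM.wk.wk.wk hn.wk.wk.wk hL.wk.wk.wk hP.wk.wk.wk (fst hw.wk.wk.wk)
        (snd hw.wk.wk.wk)) (append (snd last.wk) (snd last))) (snd (snd last.wk.wk)))))

theorem joinEntries {W : γ → List (ClassType × ClassType)} {e f : γ → Entry}
    (hM : Poly M) (hn : Poly n) (hL : Poly L) (hP : Poly P) (hW : Poly W) (he : Poly e)
    (hf : Poly f) :
    Poly fun c => joinEntries (CliqueCol.entryOf (M c)) (n c) (L c) (P c) (W c) (e c) (f c) := by
  refine option_elim (foldr hW (mk_some (pair he (pair hf (const []))))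
    (step := fun c => CliqueCol.joinStep (CliqueCol.entryOf (M c)) (n c) (L c) (P c))
    (joinStep hM.wk hn.wk hL.wk hP.wk (fst last) (snd last))
    (G := fun p => sz (CliqueCol.mergeTypes (CliqueCol.entryOf (M p.1)) (n p.1) (L p.1) (P p.1)
      p.2.1 p.2.2) + 5)
    ((mergeTypes hM.wk hn.wk hL.wk hP.wk (fst last) (snd last)).1.add (.const 5))
    fun c a b => sz_joinStep_le _ _ _ _ _ _) (const none) ?_
  exact cond (and (isEmpty (fst last)) (isEmpty (fst (snd last)))) (mk_some (snd (snd last)))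
    (const none)

theorem joinTables {U : γ → List (List (ClassType × ClassType))} {a b : γ → List Entry}
    (hM : Poly M) (hn : Poly n) (hU : Poly U) (hL : Poly L) (hP : Poly P) (ha : Poly a)
    (hb : Poly b) :
    Poly fun c => joinTables (CliqueCol.entryOf (M c)) (n c) (U c) (L c) (P c) (a c) (b c) :=
  flatMap hU (toList (head? (flatMap ha.wk (flatMap hb.wk.wk (toList
    (joinEntries hM.wk.wk.wk hn.wk.wk.wk hL.wk.wk.wk hP.wk.wk.wk last.wk.wk last.wk last))))))

theorem leafValue (hk : Poly k) (hv : Poly v) : Poly fun c => leafValue (k c) (v c) := by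
  have hv' := cons hv (const [])
  exact pair hv' (cons (cons (pair (cons (const ([], [])) (cons (pair hv' (const [])) (const [])))
    hv') (tail (replicate hk (pair (cons (pair (const []) hv') (const [])) (const [])))))
    (const []))

theorem answer {tab : γ → List Entry} (hn : Poly n) (ht : Poly tab) :
    Poly fun c => answer (n c) (tab c) := by
  refine option_elim (head? (filter ht (all last (all (fst last) (not (isEmpty (snd last)))))))
    (const none) (mk_some (map (range hn.wk) (foldr last.wk (const 0)
      (step := fun (p : (γ × Entry) × ℕ) (x : ClassType × List ℕ) c => bif x.2.contains p.2 then 0 else c + 1)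
      (cond (contains (snd (fst last)) last.wk) (const 0) (succ (snd last)))
      (G := fun _ => 2) (.const 2) fun c a b => ?_)))
  cases a.2.contains c.2 <;> simp only [cond_true, cond_false, sz_nat] <;> omega

end Poly

/-- The exponential lists, pairings and profiles, are computed first and added to the context; the
remaining work is polynomial in the size of that extended context. -/
theorem PT.nodeValue {γ : Type} [Enc γ] {m : γ → ℕ} {M : γ → List (List Bool)} {n k : γ → ℕ}
    {a b : γ → List ℕ × List Entry} (hm : PB m sz)
    (hM : Poly M) (hn : Poly n) (hk : Poly k) (ha : Poly a) (hb : Poly b)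
    (h : PB m fun c => pairingBound (k c) (reps (entryOf (M c)) (n c) (a c).1).length
      (reps (entryOf (M c)) (n c) (b c).1).length)
    (h' : PB m fun c => 2 ^ (reps (entryOf (M c)) (n c) ((a c).1 ++ (b c).1)).length) :
    PT m fun c => nodeValue (entryOf (M c)) (n c) (k c) (a c) (b c) := by
  have hL : Poly fun c => (a c).1 ++ (b c).1 := .append (.fst ha) (.fst hb)
  have h1 : PT m fun c => ((c, CliqueCol.pairings (entryOf (M c)) (n c) (k c) (a c).1 (b c).1),
      CliqueCol.profiles (reps (entryOf (M c)) (n c) ((a c).1 ++ (b c).1))) :=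
    ((PT.of_poly Poly.id hm).pair (PT.pairings hm hM hn hk (.fst ha) (.fst hb) h)).pair
      (PT.profiles hm (PT.of_poly (.reps hM hn hL) hm) h')
  have h2 : Poly fun p : (γ × List (List (ClassType × ClassType))) × List Profile =>
      joinTables (entryOf (M p.1.1)) (n p.1.1) p.1.2 ((a p.1.1).1 ++ (b p.1.1).1) p.2 (a p.1.1).2
        (b p.1.1).2 :=
    .joinTables hM.wk.wk hn.wk.wk (.snd (.fst .id)) hL.wk.wk .last (.snd ha.wk.wk) (.snd hb.wk.wk)
  have h3 := PT.comp_poly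
    (g := fun p : (γ × List (List (ClassType × ClassType))) × List Profile =>
      joinTables (entryOf (M p.1.1)) (n p.1.1) p.1.2 ((a p.1.1).1 ++ (b p.1.1).1) p.2 (a p.1.1).2
        (b p.1.1).2) h2 h1
  exact (PT.of_poly hL hm).pair h3

-- Recursion over binary trees and its cost.

namespace BinTree

/-- Trees are represented by pairs: a leaf is `nil` and its label, a node is its two children. -/
def toData : BinTree → Data
  | leaf v => .cons .nil (enc v)
  | node s t => .cons s.toData t.toData

instance : Enc BinTree := ⟨toData⟩

theorem exists_enc (T : BinTree) : ∃ x y, enc T = .cons x y := by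
  cases T <;> exact ⟨_, _, rfl⟩

/-- Structural recursion. -/
def fold {β : Type} (l : ℕ → β) (f : β → β → β) : BinTree → β
  | leaf v => l v
  | node s t => f (s.fold l f) (t.fold l f)

/-- The number of steps of a structural recursion. -/
def foldTime {β γ : Type} (l : γ × ℕ → β) (f : γ × β × β → β) (S : γ × ℕ → ℕ)
    (U : γ × β × β → ℕ) (c : γ) : BinTree → ℕ
  | leaf v => S (c, v) + 40
  | node s t => s.foldTime l f S U c + t.foldTime l f S U c +
      U (c, s.fold (fun v => l (c, v)) (fun a b => f (c, a, b)),
        t.fold (fun v => l (c, v)) (fun a b => f (c, a, b))) + 40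

/-- Every set of leaves below a node has at most `W` classes. -/
def WidthLE (adj : ℕ → ℕ → Bool) (n W : ℕ) : BinTree → Prop
  | leaf v => (reps adj n [v]).length ≤ W
  | node s t => (reps adj n (s.leaves ++ t.leaves)).length ≤ W ∧ s.WidthLE adj n W ∧
      t.WidthLE adj n W

theorem WidthLE.length_reps_le {adj : ℕ → ℕ → Bool} {n W : ℕ} {T : BinTree}
    (h : T.WidthLE adj n W) : (reps adj n T.leaves).length ≤ W := by
  cases T with
  | leaf v => exact h
  | node s t => exact h.1

theorem value_eq_fold (adj : ℕ → ℕ → Bool) (n k : ℕ) (T : BinTree) :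
    T.value adj n k = T.fold (leafValue k) (nodeValue adj n k) := by
  induction T with
  | leaf v => rfl
  | node s t ih1 ih2 => simp only [value, fold, ih1, ih2]

theorem length_leaves_pos (T : BinTree) : 0 < T.leaves.length := by
  induction T with
  | leaf v => simp [leaves]
  | node s t ih1 ih2 => simp [leaves]; omega

end BinTree

theorem Comp.fold {β γ : Type} [Enc β] [Enc γ] {l : γ × ℕ → β} {f : γ × β × β → β}
    {S : γ × ℕ → ℕ} {U : γ × β × β → ℕ} (hl : Comp l S) (hf : Comp f U) :
    Comp (fun x : γ × BinTree => x.2.fold (fun v => l (x.1, v)) fun a b => f (x.1, a, b))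
      fun x => x.2.foldTime l f S U x.1 := by
  obtain ⟨p, hp⟩ := hl
  obtain ⟨q, hq⟩ := hf
  obtain ⟨Q, i, j, k, h0, h1, h2, -⟩ :=
    exists_link (fun i j _ => .cond (.hd (.tl (.var 0)))
      (.call j (.cons (.hd (.var 0))
        (.cons (.call 0 (.cons (.hd (.var 0)) (.hd (.tl (.var 0)))))
          (.call 0 (.cons (.hd (.var 0)) (.tl (.tl (.var 0))))))))
      (.call i (.cons (.hd (.var 0)) (.tl (.tl (.var 0)))))) p q []
  refine ⟨Q, ?_⟩
  rintro ⟨c, T⟩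
  dsimp only
  induction T with
  | leaf v =>
    obtain ⟨s, hs, hs'⟩ := hp (c, v)
    refine ⟨_, ?_, Runs.of_body h0 (.cond_nil (.hd (.tl (.var _ 0)))
      (.call (.cons (.hd (.var _ 0)) (.tl (.tl (.var _ 0)))) (h1 _ _ _ hs')))⟩
    simp only [BinTree.foldTime]; omega
  | node s t ih1 ih2 =>
    obtain ⟨t₁, ht₁, ht₁'⟩ := ih1
    obtain ⟨t₂, ht₂, ht₂'⟩ := ih2
    obtain ⟨t₃, ht₃, ht₃'⟩ := hq (c, s.fold (fun v => l (c, v)) (fun a b => f (c, a, b)),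
        t.fold (fun v => l (c, v)) (fun a b => f (c, a, b)))
    -- The program recognizes a leaf by a `nil` head; at an inner node the head encodes a tree and
    -- so is never `nil`.
    obtain ⟨x, y, hxy⟩ := s.exists_enc
    have hhd : Eval Q [enc (c, BinTree.node s t)] (.hd (.tl (.var 0))) (.cons x y) 3 :=
      hxy ▸ .hd (.tl (.var _ 0))
    refine ⟨_, ?_, Runs.of_body h0 (.cond_cons hhd
      (.call (.cons (.hd (.var _ 0)) (.cons
        (.call (.cons (.hd (.var _ 0)) (.hd (.tl (.var _ 0)))) ht₁')
        (.call (.cons (.hd (.var _ 0)) (.tl (.tl (.var _ 0)))) ht₂'))) (h2 _ _ _ ht₃')))⟩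
    simp only [BinTree.foldTime]; omega

/-- The data of the dynamic program: an adjacency matrix of a graph on `n` vertices, a number of
colors, and a binary tree. -/
structure TreeInstance where
  M : List (List Bool)
  k : ℕ
  T : BinTree
  W : ℕ
  rows : ∀ r ∈ M, r.length ≤ M.length
  symm : ∀ u v, entryOf M u v = entryOf M v u
  k_pos : 0 < k
  k_le : k ≤ M.length
  nodup : T.leaves.Nodup
  lt : ∀ v ∈ T.leaves, v < M.length
  width : T.WidthLE (entryOf M) M.length W

namespace TreeInstance

/-- The measure for running times. -/
def bound (I : TreeInstance) : ℕ := pairingBound I.M.length I.W I.W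

theorem le_pairingBound (k W : ℕ) : 4 ^ W ≤ pairingBound k W W :=
  calc 4 ^ W ≤ 2 ^ 4 ^ W := (Nat.lt_pow_self (by omega)).le
    _ ≤ 2 ^ 4 ^ W * 2 ^ 4 ^ W := Nat.le_mul_of_pos_right _ (Nat.pow_pos (by omega))
    _ ≤ _ := (Nat.lt_pow_self (by omega)).le

theorem length_le_bound (I : TreeInstance) : I.M.length ≤ I.bound :=
  calc I.M.length ≤ (I.M.length + 2) ^ 1 := by rw [pow_one]; omega
    _ ≤ _ := Nat.pow_le_pow_right (by omega) (Nat.mul_pos (Nat.pow_pos (by omega))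
      (Nat.pow_pos (by omega)))

theorem pairingBound_mono {k k' a a' b b' : ℕ} (hk : k ≤ k') (ha : a ≤ a') (hb : b ≤ b') :
    pairingBound k a b ≤ pairingBound k' a' b' := by
  unfold pairingBound
  refine (Nat.pow_le_pow_left (by omega) _).trans (Nat.pow_le_pow_right (by omega) ?_)
  exact Nat.mul_le_mul
    (Nat.pow_le_pow_right (by omega) (Nat.pow_le_pow_right (by omega) ha))
    (Nat.pow_le_pow_right (by omega) (Nat.pow_le_pow_right (by omega) hb))

/-- The instance for a subtree. -/
def withTree (I : TreeInstance) (S : BinTree) (h1 : S.leaves.Sublist I.T.leaves)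
    (h2 : S.WidthLE (entryOf I.M) I.M.length I.W) : TreeInstance :=
  { I with
    T := S
    nodup := I.nodup.sublist h1
    lt := fun v hv => I.lt v (h1.subset hv)
    width := h2 }

/-- The value at the root of the tree. -/
def value (I : TreeInstance) : List ℕ × List Entry := I.T.value (entryOf I.M) I.M.length I.k

theorem length_leaves_le (I : TreeInstance) : I.T.leaves.length ≤ I.M.length := by
  have := (I.nodup.subperm (l₂ := List.range I.M.length) fun v hv =>
    List.mem_range.mpr (I.lt v hv)).length_le
  simpa using this

theorem pb_sz_leaves : PB bound fun I => sz I.T.leaves := by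
  have h : PB bound fun I => I.M.length := .le length_le_bound
  refine ((h.mul ((PB.const 2).mul h |>.add (.const 2))).add (.const 1)).mono fun I => ?_
  refine (sz_list_le (B := 2 * I.M.length + 1) fun v hv => ?_).trans ?_
  · have := I.lt v hv
    simp; omega
  · exact Nat.add_le_add_right (Nat.mul_le_mul_right _ I.length_leaves_le) _

theorem sz_classType_le {L : List ℕ} {R : List ℕ} (hR : R.Sublist L) {τ : ClassType}
    (hτ : τ ∈ classTypes R) : sz τ ≤ 4 ^ R.length * (2 * sz L + 2) + 1 := by
  have hτ := List.mem_sublists'.mp hτ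
  refine (sz_list_le (B := 2 * sz L + 1) fun p hp => ?_).trans ?_
  · obtain ⟨h1, h2⟩ := (mem_profiles p R).mp (hτ.subset hp)
    have h1 := sz_le_of_sublist (h1.trans hR)
    have h2 := sz_le_of_sublist (h2.trans hR)
    rw [sz_prod]; omega
  · rw [← length_profiles]
    exact Nat.add_le_add_right (Nat.mul_le_mul_right _ hτ.length_le) _

/-- An inner node stores at most one entry for each multiset of pairs of types, and a leaf stores
one. -/
theorem length_table_le (I : TreeInstance) : I.value.2.length ≤ I.bound := by
  obtain ⟨M, k, T, W, _, _, _, hk, _, _, hw⟩ := I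
  cases T with
  | leaf v =>
    exact Nat.one_le_pow _ _ (by omega)
  | node s t =>
    refine (length_joinTables_le _ _ _ _).trans ?_
    rw [BinTree.value_fst, BinTree.value_fst, pairings, length_msets]
    have e : ((classTypes (reps (entryOf M) M.length s.leaves)).product
      (classTypes (reps (entryOf M) M.length t.leaves))).length = _ := List.length_product _ _
    rw [e, length_classTypes, length_classTypes]
    exact (Nat.pow_le_pow_left (show k + 1 ≤ M.length + 2 by omega) _).trans
      (pairingBound_mono le_rfl hw.2.1.length_reps_le hw.2.2.length_reps_le)

/-- Size is controlled through soundness: an entry has `k ≤ n` classes, each with a true type, and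
its vertex lists together are a permutation of the leaves. -/
theorem pb_sz_value : PB bound fun I => sz I.value := by
  have h4 : PB bound fun I => 4 ^ I.W := .le fun I => le_pairingBound _ _
  have hL := pb_sz_leaves
  have hτ := ((h4.mul (((PB.const 2).mul hL).add (.const 2))).add (.const 1))
  have hE := (((PB.le length_le_bound).mul ((hτ.add hL).add (.const 2))).add (.const 1))
  refine ((hL.add ((PB.self.mul (hE.add (.const 1))).add (.const 1))).add (.const 1)).mono
    fun I => ?_
  have hfst : I.value.1 = I.T.leaves := BinTree.value_fst _ _ _ _
  rw [sz_prod, hfst]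
  refine Nat.add_le_add_right (Nat.add_le_add_left ((sz_list_le fun e he => ?_).trans
    (Nat.add_le_add_right (Nat.mul_le_mul_right _ I.length_table_le) _)) _) _
  have hE := isEntry_of_mem_value I.symm I.k_pos I.nodup I.lt he
  refine (sz_list_le (B := 4 ^ I.W * (2 * sz I.T.leaves + 2) + 1 + sz I.T.leaves + 1)
    fun x hx => ?_).trans (Nat.add_le_add_right
    (Nat.mul_le_mul_right _ (hE.length_eq.le.trans I.k_le)) _)
  have h1 : sz x.1 ≤ 4 ^ I.W * (2 * sz I.T.leaves + 2) + 1 := by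
    rw [hE.type_eq x hx]
    refine (sz_classType_le (List.filter_sublist (l := I.T.leaves))
      (typeOf_mem_classTypes _)).trans ?_
    exact Nat.add_le_add_right (Nat.mul_le_mul_right _
      (Nat.pow_le_pow_right (by omega) I.width.length_reps_le)) _
  have h2 : sz x.2 ≤ sz I.T.leaves := by
    rw [← sz_perm hE.perm]
    exact sz_le_of_sublist (List.sublist_flatten_of_mem (List.mem_map_of_mem hx))
  rw [sz_prod]; omega

theorem pb_sz_context : PB bound fun I => sz (I.M, I.k) := by
  have h : PB bound fun I => I.M.length := .le length_le_bound
  refine (((h.mul ((h.mul (.const 4)).add (.const 2))).add (.const 1)).add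
    (((PB.const 2).mul h).add (.const 2))).mono fun I => ?_
  have : sz I.M ≤ I.M.length * (I.M.length * 4 + 2) + 1 :=
    (sz_list_le fun r hr => (sz_list_le fun b _ => sz_bool b).trans
      (Nat.add_le_add_right (Nat.mul_le_mul_right _ (I.rows r hr)) _))
  have := I.k_le
  simp only [sz_pair, sz_nat]
  omega

end TreeInstance

/-- The number of nodes. -/
def BinTree.numNodes : BinTree → ℕ
  | leaf _ => 1
  | node s t => s.numNodes + t.numNodes + 1

theorem BinTree.numNodes_lt (T : BinTree) : T.numNodes < 2 * T.leaves.length := by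
  induction T with
  | leaf v => simp [numNodes, leaves]
  | node s t ih1 ih2 => simp [numNodes, leaves]; omega

/-- Every subtree gives an instance with the same bound, so each of the fewer than `2 * n` nodes
costs at most one common polynomial in the bound at the root. -/
theorem comp_value : ∃ V, Comp (fun x : (List (List Bool) × ℕ) × BinTree =>
      x.2.value (entryOf x.1.1) x.1.1.length x.1.2) V ∧
    PB TreeInstance.bound fun I => V ((I.M, I.k), I.T) := by
  obtain ⟨-, S, hS, hl⟩ : Poly fun x : (List (List Bool) × ℕ) × ℕ => leafValue x.1.2 x.2 :=
    .leafValue (.snd (.fst .id)) .last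
  obtain ⟨-, U, hU, hf⟩ := PT.nodeValue
    (γ := (List (List Bool) × ℕ) × (List ℕ × List Entry) × (List ℕ × List Entry))
    (m := fun c => sz c + (pairingBound c.1.2
      (reps (entryOf c.1.1) c.1.1.length c.2.1.1).length
      (reps (entryOf c.1.1) c.1.1.length c.2.2.1).length +
        2 ^ (reps (entryOf c.1.1) c.1.1.length (c.2.1.1 ++ c.2.2.1)).length))
    (M := fun c => c.1.1) (n := fun c => c.1.1.length) (k := fun c => c.1.2)
    (a := fun c => c.2.1) (b := fun c => c.2.2) (.le fun c => Nat.le_add_right _ _)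
    (.fst (.fst .id)) (.length (.fst (.fst .id))) (.snd (.fst .id)) (.fst (.snd .id))
    (.snd (.snd .id))
    (.le fun c => (Nat.le_add_right _ _).trans (Nat.le_add_left _ _))
    (.le fun c => (Nat.le_add_left _ _).trans (Nat.le_add_left _ _))
  have hV := Comp.fold hl hf
  simp only [BinTree.value_eq_fold]
  refine ⟨_, hV, ?_⟩
  obtain ⟨s, hS⟩ := hS
  obtain ⟨u, hU⟩ := hU
  obtain ⟨d, hd⟩ := TreeInstance.pb_sz_value
  have hctx := TreeInstance.pb_sz_context
  -- The cost of a single node: the term for a leaf, the term for an inner node, and the overhead of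
  -- the recursion.
  let A : TreeInstance → ℕ := fun I =>
    (sz (I.M, I.k) + (2 * I.M.length + 1) + 1 + s) ^ s +
      (sz (I.M, I.k) + ((I.bound + d) ^ d + (I.bound + d) ^ d + 1) + 1 +
        (I.bound + I.bound) + u) ^ u + 40
  have hn : PB TreeInstance.bound fun I => I.M.length := .le TreeInstance.length_le_bound
  have hA : PB TreeInstance.bound A := by
    have hv : PB TreeInstance.bound fun I => (I.bound + d) ^ d := (PB.self.add (.const d)).pow d
    exact ((((hctx.add (((PB.const 2).mul hn).add (.const 1))).add (.const 1)).add
      (.const s)).pow s).add (((((hctx.add ((hv.add hv).add (.const 1))).add (.const 1)).add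
        (PB.self.add .self)).add (.const u)).pow u) |>.add (.const 40)
  refine (((PB.const 2).mul hn).mul hA).mono fun I => ?_
  have key : ∀ R : BinTree, R.leaves.Sublist I.T.leaves →
      R.WidthLE (entryOf I.M) I.M.length I.W →
      R.foldTime (fun x : (List (List Bool) × ℕ) × ℕ => leafValue x.1.2 x.2)
        (fun c => nodeValue (entryOf c.1.1) c.1.1.length c.1.2 c.2.1 c.2.2) S U (I.M, I.k) ≤
          R.numNodes * A I := by
    intro R h1 h2
    induction R with
    | leaf v =>
      have hv : v < I.M.length := I.lt v (h1.subset (by simp [BinTree.leaves]))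
      have := (hS ((I.M, I.k), v)).trans (Nat.pow_le_pow_left (m := sz (I.M, I.k) +
        (2 * I.M.length + 1) + 1 + s) (by simp only [sz_pair, sz_nat]; omega) s)
      simp only [BinTree.foldTime, BinTree.numNodes, one_mul, A]
      omega
    | node a b ih1 ih2 =>
      have ha : a.leaves.Sublist I.T.leaves := (List.sublist_append_left _ _).trans h1
      have hb : b.leaves.Sublist I.T.leaves := (List.sublist_append_right _ _).trans h1
      have ih1 := ih1 ha h2.2.1
      have ih2 := ih2 hb h2.2.2
      have va : sz (a.value (entryOf I.M) I.M.length I.k) ≤ (I.bound + d) ^ d :=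
        hd (I.withTree a ha h2.2.1)
      have vb : sz (b.value (entryOf I.M) I.M.length I.k) ≤ (I.bound + d) ^ d :=
        hd (I.withTree b hb h2.2.2)
      have hw := h2.1
      have hp : 2 ^ I.W ≤ I.bound :=
        (Nat.pow_le_pow_left (by omega) _).trans (TreeInstance.le_pairingBound I.M.length I.W)
      have hp' : 2 ^ (reps (entryOf I.M) I.M.length (a.leaves ++ b.leaves)).length ≤ I.bound :=
        (Nat.pow_le_pow_right (by omega) hw).trans hp
      have hpb : pairingBound I.k (reps (entryOf I.M) I.M.length a.leaves).length
          (reps (entryOf I.M) I.M.length b.leaves).length ≤ I.bound :=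
        TreeInstance.pairingBound_mono I.k_le h2.2.1.length_reps_le h2.2.2.length_reps_le
      have hu := hU ((I.M, I.k), a.value (entryOf I.M) I.M.length I.k,
        b.value (entryOf I.M) I.M.length I.k)
      simp only [BinTree.value_fst] at hu
      have := hu.trans (Nat.pow_le_pow_left (m := sz (I.M, I.k) +
        ((I.bound + d) ^ d + (I.bound + d) ^ d + 1) + 1 + (I.bound + I.bound) + u)
        (by
          rw [sz_pair (I.M, I.k), sz_pair (a.value _ _ _)]; omega) u)
      rw [BinTree.value_eq_fold, BinTree.value_eq_fold] at this
      have e : (BinTree.node a b).numNodes * A I =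
          a.numNodes * A I + b.numNodes * A I + A I := by
        rw [BinTree.numNodes]; ring
      rw [e]
      simp only [BinTree.foldTime]
      have hA' : U ((I.M, I.k),
          a.fold (leafValue I.k) (nodeValue (entryOf I.M) I.M.length I.k),
          b.fold (leafValue I.k) (nodeValue (entryOf I.M) I.M.length I.k)) + 40 ≤ A I := by
        simp only [A]; omega
      exact (le_of_eq (Nat.add_assoc _ _ _)).trans
        (Nat.add_le_add (Nat.add_le_add ih1 ih2) hA')
  refine (key I.T (List.Sublist.refl _) I.width).trans (Nat.mul_le_mul_right _ ?_)
  have := I.T.numNodes_lt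
  have := I.length_leaves_le
  omega

theorem exists_program_answer : ∃ (P : Program) (c : ℕ), ∀ I : TreeInstance,
    ∃ t ≤ (I.bound + c) ^ c,
      Runs P (enc ((I.M, I.k), I.T)) (enc (answer I.M.length I.value.2)) t := by
  obtain ⟨V, hV, hV'⟩ := comp_value
  obtain ⟨-, S, hS, hs⟩ : Poly fun x : ℕ × List Entry => answer x.1 x.2 :=
    .answer (.fst .id) (.snd .id)
  obtain ⟨-, Q, hQ, hq⟩ : Poly fun x : (List (List Bool) × ℕ) × BinTree => x.1.1.length :=
    .length (.fst (.fst .id))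
  obtain ⟨P, hP⟩ := hs.comp (hq.pair (Comp.comp (Comp.snd (α := List ℕ) (β := List Entry)) hV))
  have hT : PB TreeInstance.bound fun I => sz I.T := by
    have h : PB TreeInstance.bound fun I => I.M.length := .le TreeInstance.length_le_bound
    refine (((PB.const 2).mul h).mul (((PB.const 2).mul h).add (.const 3))).mono fun I => ?_
    have key : ∀ R : BinTree, (∀ v ∈ R.leaves, v < I.M.length) →
        sz R ≤ R.numNodes * (2 * I.M.length + 3) := by
      intro R hR
      induction R with
      | leaf v =>
        have hv := hR v (by simp [BinTree.leaves])
        have : sz (BinTree.leaf v) = 1 + sz v + 1 := rfl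
        rw [this, sz_nat, BinTree.numNodes]; omega
      | node a b ih1 ih2 =>
        have h1 := ih1 fun v hv => hR v (by simp [BinTree.leaves, hv])
        have h2 := ih2 fun v hv => hR v (by simp [BinTree.leaves, hv])
        have : sz (BinTree.node a b) = sz a + sz b + 1 := rfl
        rw [this, BinTree.numNodes, add_mul, add_mul]; omega
    refine (key I.T I.lt).trans (Nat.mul_le_mul_right _ ?_)
    have := I.T.numNodes_lt
    have := I.length_leaves_le
    omega
  have hsz : PB TreeInstance.bound fun I => sz ((I.M, I.k), I.T) :=
    ((TreeInstance.pb_sz_context.add hT).add (.const 1)).mono fun I => by rw [sz_pair (I.M, I.k)]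
  have hvl : PB TreeInstance.bound fun I => sz (I.M.length, I.value.2) := by
    refine ((((PB.const 2).mul (.le TreeInstance.length_le_bound)).add (.const 1)).add
      TreeInstance.pb_sz_value |>.add (.const 1)).mono fun I => ?_
    rw [sz_pair, sz_nat, sz_prod I.value]; omega
  have hB : PB TreeInstance.bound fun I => Q ((I.M, I.k), I.T) + (V ((I.M, I.k), I.T) + 2 + 3) +
      5 + S (I.M.length, I.value.2) + 3 :=
    ((((hsz.trans (hQ.comp _)).add ((hV'.add (.const 2)).add (.const 3))).add (.const 5)).add
      (hvl.trans (hS.comp _))).add (.const 3)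
  obtain ⟨c, hc⟩ := hB
  refine ⟨P, c, fun I => ?_⟩
  obtain ⟨t, ht, ht'⟩ := hP ((I.M, I.k), I.T)
  exact ⟨t, ht.trans (hc I), ht'⟩

/-! ## Clique colorings and good colorings -/

open Classical in
/-- The adjacency matrix. -/
noncomputable def matrix {n : ℕ} (G : SimpleGraph (Fin n)) : List (List Bool) :=
  List.ofFn fun i => List.ofFn fun j => decide (G.Adj i j)

section
variable {n : ℕ} (G : SimpleGraph (Fin n))

theorem enc_matrix : enc (matrix G) = Data.ofGraph G := by
  simp only [enc, matrix, Data.ofGraph, List.map_ofFn]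
  congr 2
  funext i
  simp only [Function.comp, List.map_ofFn]
  congr 2
  funext j
  by_cases h : G.Adj i j <;> simp [h, Data.ofNat]

theorem length_matrix : (matrix G).length = n := by simp [matrix]

variable {G}

theorem entryOf_matrix {u v : ℕ} :
    entryOf (matrix G) u v = true ↔ ∃ (hu : u < n) (hv : v < n), G.Adj ⟨u, hu⟩ ⟨v, hv⟩ := by
  simp only [entryOf, List.head?_drop, matrix]
  by_cases hu : u < n
  · rw [List.getElem?_ofFn, dif_pos hu, Option.getD_some]
    by_cases hv : v < n
    · rw [List.getElem?_ofFn, dif_pos hv]; simp [hu, hv]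
    · rw [List.getElem?_ofFn, dif_neg hv]; simp [hv]
  · rw [List.getElem?_ofFn, dif_neg hu]; simp [hu]

theorem entryOf_matrix_fin {u v : Fin n} : entryOf (matrix G) u v = true ↔ G.Adj u v := by
  rw [entryOf_matrix]; simp

theorem entryOf_matrix_symm (u v : ℕ) : entryOf (matrix G) u v = entryOf (matrix G) v u := by
  rw [Bool.eq_iff_iff, entryOf_matrix, entryOf_matrix]
  exact ⟨fun ⟨a, b, h⟩ => ⟨b, a, h.symm⟩, fun ⟨a, b, h⟩ => ⟨b, a, h.symm⟩⟩

/-- A set that is monochromatic for `ψ` is monochromatic for `φ`. Positivity of `k` supplies a color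
for the empty set. -/
theorem IsCliqueColoring.refine {V : Type*} {G : SimpleGraph V} {k l : ℕ} {φ : V → Fin k}
    {ψ : V → Fin l} (hφ : IsCliqueColoring G φ) (hk : 0 < k)
    (h : ∀ u v, ψ u = ψ v → φ u = φ v) : IsCliqueColoring G ψ := by
  rintro X hX ⟨i, hi⟩
  refine hφ X hX ?_
  rcases X.eq_empty_or_nonempty with rfl | ⟨u, hu⟩
  · exact ⟨⟨0, hk⟩, by simp⟩
  · exact ⟨φ u, fun v hv => h _ _ ((hi v hv).trans (hi u hu).symm)⟩

theorem isCliqueColoring_iff {k : ℕ} {φ : Fin n → Fin k} :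
    IsCliqueColoring G φ ↔ ∀ i, ∀ X : Set (Fin n), (∀ x ∈ X, φ x = i) → G.IsClique X →
      ∃ v, φ v ≠ i ∧ ∀ x ∈ X, G.Adj v x := by
  constructor
  · intro h i X hX hq
    -- Enlarge `X` to a maximal clique `Y` inside the class. It is not maximal in `G`, so some
    -- vertex `z` extends it; by the choice of `Y`, that vertex has another color.
    obtain ⟨Y, hXY, hY⟩ := Finite.exists_le_maximal
      (p := fun Y : Set (Fin n) => G.IsClique Y ∧ ∀ x ∈ Y, φ x = i) ⟨hq, hX⟩
    have hmax : ¬ Maximal G.IsClique Y := fun h' => h Y h' ⟨i, hY.prop.2⟩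
    simp only [Maximal, not_and, not_forall] at hmax
    obtain ⟨Z, hZ, hYZ, hZY⟩ := hmax hY.prop.1
    obtain ⟨z, hz, hzY⟩ := Set.not_subset.mp hZY
    have hadj : ∀ x ∈ Y, G.Adj z x := fun x hx => hZ hz (hYZ hx) (by rintro rfl; exact hzY hx)
    refine ⟨z, fun hzi => hzY ?_, fun x hx => hadj x (hXY hx)⟩
    refine hY.le_of_ge (y := insert z Y) ⟨?_, ?_⟩ (Set.subset_insert _ _) (Set.mem_insert _ _)
    · exact hY.prop.1.insert fun x hx _ => hadj x hx
    · rintro x (rfl | hx)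
      · exact hzi
      · exact hY.prop.2 x hx
  · rintro h X hX ⟨i, hi⟩
    obtain ⟨v, hv, hvX⟩ := h i X hi hX.prop
    refine hv (hi v ?_)
    exact hX.le_of_ge (hX.prop.insert fun x hx _ => hvX x hx) (Set.subset_insert _ _)
      (Set.mem_insert _ _)

theorem goodColoring_iff {k : ℕ} {φ : Fin n → Fin k} {ψ : ℕ → ℕ} {L : List ℕ}
    (h : ∀ v : Fin n, ψ v = φ v) (hL : ∀ v, v ∈ L ↔ v < n) :
    GoodColoring (entryOf (matrix G)) k L ψ ↔ IsCliqueColoring G φ := by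
  rw [isCliqueColoring_iff]
  constructor
  · intro hg i X hX hq
    obtain ⟨v, hv, hvi, hvX⟩ := hg i i.2 (Fin.val '' X) (by
      rintro _ ⟨x, hx, rfl⟩
      exact ⟨(hL _).mpr x.2, by rw [h, hX x hx]⟩) (by
      rintro _ ⟨x, hx, rfl⟩ _ ⟨y, hy, rfl⟩ hxy
      exact entryOf_matrix_fin.mpr (hq hx hy fun e => hxy (by rw [e])))
    refine ⟨⟨v, (hL v).mp hv⟩, fun e => hvi ?_, fun x hx => ?_⟩
    · rw [← e]; exact h ⟨v, (hL v).mp hv⟩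
    · exact entryOf_matrix_fin.mp (hvX x ⟨x, hx, rfl⟩)
  · intro hg i hi X hX hq
    obtain ⟨v, hvi, hvX⟩ := hg ⟨i, hi⟩ (Fin.val ⁻¹' X) (fun x hx => by
      ext; rw [← h]; exact (hX _ hx).2) (fun x hx y hy hxy =>
        entryOf_matrix_fin.mp (hq hx hy fun e => hxy (Fin.ext e)))
    refine ⟨v, (hL _).mpr v.2, fun e => hvi (Fin.ext ((h v).symm.trans e)), fun x hx => ?_⟩
    have hxn := (hL x).mp (hX x hx).1
    exact (entryOf_matrix_fin (u := v) (v := ⟨x, hxn⟩)).mpr (hvX ⟨x, hxn⟩ hx)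

/-! ## The numbers of classes -/

/-- Distinct representatives have distinct outside neighborhoods, so any `f` that determines the
outside neighborhood is injective on them. -/
theorem length_reps_le {l : List (Fin n)} (hl : l.Nodup) {α : Type*} [Finite α]
    (f : {v // v ∈ l} → α)
    (hf : ∀ u v, f u = f v → ∀ x, x ∉ l → (G.Adj u.1 x ↔ G.Adj v.1 x)) :
    (reps (entryOf (matrix G)) n (l.map Fin.val)).length ≤ Nat.card α := by
  have hmem : ∀ v ∈ reps (entryOf (matrix G)) n (l.map Fin.val), ∃ u : {v // v ∈ l}, u.1.1 = v := by
    intro v hv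
    obtain ⟨u, hu, rfl⟩ := List.mem_map.mp (List.mem_of_mem_filter hv)
    exact ⟨⟨u, hu⟩, rfl⟩
  have hnd : (reps (entryOf (matrix G)) n (l.map Fin.val)).Nodup :=
    (hl.map Fin.val_injective).filter _
  choose g hg using hmem
  rw [← List.toFinset_card_of_nodup hnd, ← Fintype.card_coe, ← Nat.card_eq_fintype_card]
  refine Nat.card_le_card_of_injective
    (fun v : {v // v ∈ (reps (entryOf (matrix G)) n (l.map Fin.val)).toFinset} =>
      f (g v.1 (List.mem_toFinset.mp v.2))) ?_
  rintro ⟨u, hu⟩ ⟨v, hv⟩ huv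
  rw [List.mem_toFinset] at hu hv
  have hs : sameOutside (entryOf (matrix G)) n (l.map Fin.val) u v = true := by
    rw [sameOutside_iff]
    intro x hx hxl
    have := hf _ _ huv ⟨x, hx⟩ fun h => hxl (List.mem_map.mpr ⟨_, h, rfl⟩)
    rw [← entryOf_matrix_fin, ← entryOf_matrix_fin, hg u hu, hg v hv] at this
    rw [Bool.eq_iff_iff]
    exact this
  have hu' := List.mem_filter.mp hu
  have hv' := List.mem_filter.mp hv
  have := rep_congr hs hu'.1
  rw [beq_iff_eq.mp hu'.2, beq_iff_eq.mp hv'.2] at this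
  exact Subtype.ext this

end

/-- Replace every node by nodes with two children. -/
def RTree.toBin {n : ℕ} : RTree (Fin n) → BinTree
  | .leaf v => .leaf v
  | .node1 t => t.toBin
  | .node2 s t => .node s.toBin t.toBin
  | .node3 r s t => .node (.node r.toBin s.toBin) t.toBin

/-- The tree of the disjoint unions. -/
def CWExpr.toBin {n w : ℕ} : CWExpr (Fin n) w → BinTree
  | .single v _ => .leaf v
  | .union a b => .node a.toBin b.toBin
  | .join _ _ _ a => a.toBin
  | .relabel _ _ a => a.toBin

theorem RTree.leaves_toBin {n : ℕ} (T : RTree (Fin n)) : T.toBin.leaves = T.leaves.map Fin.val := by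
  induction T <;> simp_all [RTree.toBin, BinTree.leaves, RTree.leaves]

theorem CWExpr.leaves_toBin {n w : ℕ} (e : CWExpr (Fin n) w) :
    e.toBin.leaves = e.verts.map Fin.val := by
  induction e <;> simp_all [CWExpr.toBin, BinTree.leaves, CWExpr.verts]

theorem RTree.length_leaves_le {V : Type*} (T : RTree V) : T.leaves.length ≤ T.numNodes := by
  induction T <;> simp [RTree.leaves, RTree.numNodes] <;> omega

theorem CWExpr.length_verts_le {V : Type*} {w : ℕ} (e : CWExpr V w) :
    e.verts.length ≤ e.numNodes := by
  induction e <;> simp [CWExpr.verts, CWExpr.numNodes] <;> omega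

section
variable {n : ℕ} {G : SimpleGraph (Fin n)}

theorem adj_iff_of_outsideSetoid {S : Set (Fin n)} {u v : S}
    (h : (Quotient.mk (outsideSetoid G S) u) = Quotient.mk (outsideSetoid G S) v) (x : Fin n)
    (hx : x ∉ S) : G.Adj u.1 x ↔ G.Adj v.1 x := by
  have h : G.neighborSet u.1 ∩ Sᶜ = G.neighborSet v.1 ∩ Sᶜ := Quotient.exact h
  have := Set.ext_iff.mp h x
  simpa [hx] using this

theorem length_reps_le_numClasses {l : List (Fin n)} (hl : l.Nodup) :
    (reps (entryOf (matrix G)) n (l.map Fin.val)).length ≤ numClasses G {v | v ∈ l} :=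
  length_reps_le hl (fun v => Quotient.mk (outsideSetoid G {v | v ∈ l}) ⟨v.1, v.2⟩)
    fun _ _ h x hx => adj_iff_of_outsideSetoid h x hx

open Classical in
-- Needed for the auxiliary node created when a ternary node is split: its vertex set need not be
-- the leaf set of any node of the given tree.
theorem length_reps_append_le {l l' : List (Fin n)} (hl : (l ++ l').Nodup) :
    (reps (entryOf (matrix G)) n ((l ++ l').map Fin.val)).length ≤
      numClasses G {v | v ∈ l} + numClasses G {v | v ∈ l'} := by
  rw [numClasses, numClasses, ← Nat.card_sum]
  refine length_reps_le hl (fun v => if h : v.1 ∈ l then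
    .inl (Quotient.mk (outsideSetoid G {v | v ∈ l}) ⟨v.1, h⟩) else
    .inr (Quotient.mk (outsideSetoid G {v | v ∈ l'}) ⟨v.1, by
      have := v.2
      rw [List.mem_append] at this
      exact this.resolve_left h⟩)) ?_
  intro u v h x hx
  rw [List.mem_append, not_or] at hx
  by_cases hu : u.1 ∈ l <;> by_cases hv : v.1 ∈ l <;> simp only [hu, hv, dite_true, dite_false,
    reduceCtorEq, Sum.inl.injEq, Sum.inr.injEq] at h
  · exact adj_iff_of_outsideSetoid h x hx.1
  · exact adj_iff_of_outsideSetoid h x hx.2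

theorem numClasses_le_moduleWidth (T : RTree (Fin n)) :
    numClasses G {v | v ∈ T.leaves} ≤ moduleWidth G T := by
  cases T <;> simp only [moduleWidth, RTree.leafSet] <;> first | exact le_rfl | exact le_max_left _ _

/-- Every node of the binary tree that comes from the given tree has at most `W` classes; the factor
`2` pays for the auxiliary nodes. -/
theorem RTree.widthLE {T : RTree (Fin n)} (hT : T.leaves.Nodup) {W : ℕ}
    (hW : moduleWidth G T ≤ W) : T.toBin.WidthLE (entryOf (matrix G)) n (2 * W) := by
  have hself := ((length_reps_le_numClasses hT).trans (numClasses_le_moduleWidth T)).trans hW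
  have hself2 : (reps (entryOf (matrix G)) n (T.leaves.map Fin.val)).length ≤ 2 * W := by omega
  induction T with
  | leaf v => exact hself2
  | node1 t ih =>
    simp only [moduleWidth, max_le_iff] at hW
    exact ih hT hW.2 (hself) hself2
  | node2 s t ih1 ih2 =>
    simp only [moduleWidth, max_le_iff] at hW
    simp only [RTree.leaves, List.nodup_append] at hT
    have h1 := ((length_reps_le_numClasses hT.1).trans (numClasses_le_moduleWidth s)).trans hW.2.1
    have h2 := ((length_reps_le_numClasses hT.2.1).trans (numClasses_le_moduleWidth t)).trans
      hW.2.2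
    refine ⟨?_, ih1 hT.1 hW.2.1 h1 (by omega), ih2 hT.2.1 hW.2.2 h2 (by omega)⟩
    rw [RTree.leaves_toBin, RTree.leaves_toBin, ← List.map_append]
    exact hself2
  | node3 r s t ih1 ih2 ih3 =>
    simp only [moduleWidth, max_le_iff] at hW
    simp only [RTree.leaves] at hT
    have hrs := (List.nodup_append.mp hT).1
    have hr := (List.nodup_append.mp hrs).1
    have hs := (List.nodup_append.mp hrs).2.1
    have ht := (List.nodup_append.mp hT).2.1
    have h1 := ((length_reps_le_numClasses hr).trans (numClasses_le_moduleWidth r)).trans hW.2.1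
    have h2 := ((length_reps_le_numClasses hs).trans (numClasses_le_moduleWidth s)).trans hW.2.2.1
    have h3 := ((length_reps_le_numClasses ht).trans (numClasses_le_moduleWidth t)).trans hW.2.2.2
    refine ⟨?_, ⟨?_, ih1 hr hW.2.1 h1 (by omega), ih2 hs hW.2.2.1 h2 (by omega)⟩,
      ih3 ht hW.2.2.2 h3 (by omega)⟩
    · simp only [BinTree.leaves, RTree.leaves_toBin, ← List.map_append]
      exact hself2
    · simp only [RTree.leaves_toBin, ← List.map_append]
      refine (length_reps_append_le hrs).trans ?_
      have := numClasses_le_moduleWidth (G := G) r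
      have := numClasses_le_moduleWidth (G := G) s
      omega

end

/-! ### Labels -/

namespace CWExpr
variable {V : Type*} {w : ℕ}

theorem HasLabel.mem {e : CWExpr V w} {v : V} {l : Fin w} (h : e.HasLabel v l) : v ∈ e.verts := by
  induction e generalizing l with
  | single u i => simp [h.1, verts]
  | union a b ih1 ih2 => exact List.mem_append.mpr (h.imp ih1 ih2)
  | join i j _ a ih => exact ih h
  | relabel i j a ih => exact h.elim (fun h => ih h.1) fun h => ih h.1

theorem exists_hasLabel {e : CWExpr V w} {v : V} (h : v ∈ e.verts) : ∃ l, e.HasLabel v l := by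
  induction e with
  | single u i => exact ⟨i, by simpa [verts] using h, rfl⟩
  | union a b ih1 ih2 =>
    rcases List.mem_append.mp h with h | h
    · exact (ih1 h).imp fun _ => .inl
    · exact (ih2 h).imp fun _ => .inr
  | join i j _ a ih => exact ih h
  | relabel i j a ih =>
    obtain ⟨l, hl⟩ := ih h
    by_cases hi : l = i
    · exact ⟨j, .inl ⟨hi ▸ hl, rfl⟩⟩
    · exact ⟨l, .inr ⟨hl, hi⟩⟩

theorem HasLabel.unique {e : CWExpr V w} (he : e.verts.Nodup) {v : V} {l l' : Fin w}
    (h : e.HasLabel v l) (h' : e.HasLabel v l') : l = l' := by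
  induction e generalizing l l' with
  | single u i => exact h.2.trans h'.2.symm
  | union a b ih1 ih2 =>
    have he := List.nodup_append.mp he
    rcases h with h | h <;> rcases h' with h' | h'
    · exact ih1 he.1 h h'
    · exact absurd rfl (he.2.2 v h.mem v h'.mem)
    · exact absurd rfl (he.2.2 v h'.mem v h.mem)
    · exact ih2 he.2.1 h h'
  | join i j _ a ih => exact ih he h h'
  | relabel i j a ih =>
    rcases h with h | h <;> rcases h' with h' | h'
    · exact h.2.trans h'.2.symm
    · exact absurd (ih he h'.1 h.1) h'.2
    · exact absurd (ih he h.1 h'.1) h.2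
    · exact ih he h.1 h'.1

theorem Adj.mem {e : CWExpr V w} {u v : V} (h : e.Adj u v) : u ∈ e.verts ∧ v ∈ e.verts := by
  induction e with
  | single u i => exact h.elim
  | union a b ih1 ih2 =>
    simp only [verts, List.mem_append]
    exact h.elim (fun h => ⟨.inl (ih1 h).1, .inl (ih1 h).2⟩)
      fun h => ⟨.inr (ih2 h).1, .inr (ih2 h).2⟩
  | join i j _ a ih =>
    exact h.elim ih fun h => h.elim (fun h => ⟨h.1.mem, h.2.mem⟩) fun h => ⟨h.1.mem, h.2.mem⟩
  | relabel i j a ih => exact ih h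

/-- The vertices `u` and `v` have the same labels. -/
def SameLabel (e : CWExpr V w) (u v : V) : Prop := ∀ l, e.HasLabel u l ↔ e.HasLabel v l

/-- The edges of `G` that `e` does not build depend only on the labels. -/
structure Respects (e : CWExpr V w) (G : SimpleGraph V) : Prop where
  outside : ∀ u ∈ e.verts, ∀ v ∈ e.verts, e.SameLabel u v → ∀ x ∉ e.verts, (G.Adj u x ↔ G.Adj v x)
  inside : ∀ u ∈ e.verts, ∀ v ∈ e.verts, e.SameLabel u v → ∀ x ∈ e.verts,
    (e.Adj u x ↔ e.Adj v x) → (G.Adj u x ↔ G.Adj v x)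

theorem Builds.respects {e : CWExpr V w} {G : SimpleGraph V} (h : e.Builds G) : e.Respects G where
  outside _ _ _ _ _ x hx := absurd (h.complete x) hx
  inside u _ v _ _ x _ hadj := by rw [h.adj_iff, h.adj_iff, hadj]

end CWExpr

theorem CWExpr.length_reps_verts_le {n w : ℕ} {G : SimpleGraph (Fin n)} {e : CWExpr (Fin n) w}
    (he : e.verts.Nodup) (h : e.Respects G) :
    (reps (entryOf (matrix G)) n (e.verts.map Fin.val)).length ≤ w := by
  choose f hf using fun v : {v // v ∈ e.verts} => exists_hasLabel v.2
  have := length_reps_le (G := G) he f fun u v huv x hx => h.outside u u.2 v v.2 (fun l => by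
    constructor
    · intro hl
      rw [← HasLabel.unique he (hf u) hl, huv]
      exact hf v
    · intro hl
      rw [← HasLabel.unique he (hf v) hl, ← huv]
      exact hf u) x hx
  simpa using this

/-- `Respects` is inherited by every subexpression, and there it bounds the number of classes by the
number of labels: later operations treat vertices with equal labels alike. -/
theorem CWExpr.widthLE {n w : ℕ} {G : SimpleGraph (Fin n)} {e : CWExpr (Fin n) w}
    (he : e.verts.Nodup) (h : e.Respects G) : e.toBin.WidthLE (entryOf (matrix G)) n w := by
  have hself := length_reps_verts_le he h
  induction e with
  | single v i => exact hself
  | union a b ih1 ih2 =>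
    have hd := List.nodup_append.mp he
    -- `c` is either operand of the union and `d` is the other one.
    have key : ∀ {c d : CWExpr (Fin n) w}, (∀ u v, (CWExpr.union a b).Adj u v ↔
        c.Adj u v ∨ d.Adj u v) → (∀ u l, (CWExpr.union a b).HasLabel u l ↔
        c.HasLabel u l ∨ d.HasLabel u l) → (∀ v, v ∈ (CWExpr.union a b).verts ↔
          v ∈ c.verts ∨ v ∈ d.verts) → (∀ v ∈ c.verts, v ∉ d.verts) → c.Respects G := by
      intro c d hadj hlab hmem hdis
      have hlab' : ∀ {u v}, u ∈ c.verts → v ∈ c.verts → c.SameLabel u v →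
          (CWExpr.union a b).SameLabel u v := by
        intro u v hu hv huv l
        rw [hlab, hlab, huv l]
        exact or_congr_right ⟨fun h' => absurd h'.mem (hdis u hu),
          fun h' => absurd h'.mem (hdis v hv)⟩
      have hd' : ∀ {u x}, u ∈ c.verts → ¬ d.Adj u x := fun hu h' => hdis _ hu h'.mem.1
      refine ⟨fun u hu v hv huv x hx => ?_, fun u hu v hv huv x hx hux => ?_⟩
      · by_cases hx' : x ∈ (CWExpr.union a b).verts
        · refine h.inside u ((hmem u).mpr (.inl hu)) v ((hmem v).mpr (.inl hv)) (hlab' hu hv huv)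
            x hx' ?_
          rw [hadj, hadj]
          exact ⟨fun h' => absurd (h'.resolve_right (hd' hu)).mem.2 hx,
            fun h' => absurd (h'.resolve_right (hd' hv)).mem.2 hx⟩
        · exact h.outside u ((hmem u).mpr (.inl hu)) v ((hmem v).mpr (.inl hv)) (hlab' hu hv huv)
            x hx'
      · refine h.inside u ((hmem u).mpr (.inl hu)) v ((hmem v).mpr (.inl hv)) (hlab' hu hv huv)
            x ((hmem x).mpr (.inl hx)) ?_
        rw [hadj, hadj, hux]
        exact or_congr_right ⟨fun h' => absurd h' (hd' hu), fun h' => absurd h' (hd' hv)⟩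
    have ha : a.Respects G := key (d := b) (fun _ _ => Iff.rfl) (fun _ _ => Iff.rfl)
      (fun _ => List.mem_append) fun v hv hv' => hd.2.2 v hv v hv' rfl
    have hb : b.Respects G := key (d := a) (fun _ _ => or_comm) (fun _ _ => or_comm)
      (fun _ => List.mem_append.trans or_comm) fun v hv hv' => hd.2.2 v hv' v hv rfl
    refine ⟨?_, ih1 hd.1 ha (length_reps_verts_le hd.1 ha),
      ih2 hd.2.1 hb (length_reps_verts_le hd.2.1 hb)⟩
    rw [leaves_toBin, leaves_toBin, ← List.map_append]
    exact hself
  | join i j hij a ih =>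
    refine ih he ⟨h.outside, fun u hu v hv huv x hx hux => h.inside u hu v hv huv x hx ?_⟩ hself
    simp only [CWExpr.Adj]
    rw [hux, huv i, huv j]
  | relabel i j a ih =>
    have hlab : ∀ {u v}, a.SameLabel u v → (CWExpr.relabel i j a).SameLabel u v := by
      intro u v huv l
      simp only [CWExpr.HasLabel]
      rw [huv i, huv l]
    exact ih he ⟨fun u hu v hv huv => h.outside u hu v hv (hlab huv),
      fun u hu v hv huv => h.inside u hu v hv (hlab huv)⟩ hself

namespace BinTree
variable {adj : ℕ → ℕ → Bool} {n W : ℕ}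

/-- Capping the width by `n` matters for `n = 1`, where the factor `n ^ 2 ^ 2 ^ (c * W)` is `1` and
cannot absorb a running time that grows with `W`. -/
theorem WidthLE.min {T : BinTree} (h : T.WidthLE adj n W) (hT : T.leaves.length ≤ n) :
    T.WidthLE adj n (min W n) := by
  have hreps : ∀ {L : List ℕ}, L.length ≤ n → (reps adj n L).length ≤ n :=
    fun hL => (List.length_filter_le _ _).trans hL
  induction T with
  | leaf v => exact le_min h (hreps (L := [v]) hT)
  | node s t ih1 ih2 =>
    have hlen : s.leaves.length + t.leaves.length ≤ n := by simpa [leaves] using hT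
    exact ⟨le_min h.1 (hreps hT), ih1 h.2.1 (by omega), ih2 h.2.2 (by omega)⟩

theorem WidthLE.pos {T : BinTree} (h : T.WidthLE adj n W) : 0 < W := by
  induction T with
  | leaf v => simpa [WidthLE, reps_singleton, Nat.succ_le_iff] using h
  | node s t ih1 ih2 => exact ih1 h.2.1

end BinTree

/-! ## Reading the input -/

theorem exists_program_tree : ∃ P : Program, ∀ (n : ℕ) (T : RTree (Fin n)),
    ∃ t ≤ 40 * T.numNodes, Runs P (.ofTree T) (enc T.toBin) t := by
  let F : Term → Term := .call 0
  let x : Term := .var 0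
  -- The nested tests read the unary number of children. A leaf is returned as it is, because its
  -- two encodings agree.
  obtain ⟨P, hP⟩ : ∃ P : Program, P.getD 0 .nil = .cond (.hd x) (.cond (.tl (.hd x))
      (.cond (.tl (.tl (.hd x)))
        (.cons (.cons (F (.hd (.tl x))) (F (.hd (.tl (.tl x))))) (F (.tl (.tl (.tl x)))))
        (.cons (F (.hd (.tl x))) (F (.tl (.tl x)))))
      (F (.tl x))) x := ⟨[_], rfl⟩
  refine ⟨P, fun n T => ?_⟩
  induction T with
  | leaf v => exact ⟨_, by simp [RTree.numNodes],
      Runs.of_body hP (.cond_nil (.hd (.var _ 0)) (.var _ 0))⟩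
  | node1 t ih =>
    obtain ⟨a, ha, ha'⟩ := ih
    refine ⟨_, ?_, Runs.of_body hP (.cond_cons (x := .nil) (x' := .nil) (.hd (.var _ 0))
      (.cond_nil (.tl (.hd (.var _ 0))) (.call (.tl (.var _ 0)) ha')))⟩
    simp only [RTree.numNodes]; omega
  | node2 s t ih1 ih2 =>
    obtain ⟨a, ha, ha'⟩ := ih1
    obtain ⟨b, hb, hb'⟩ := ih2
    refine ⟨_, ?_, Runs.of_body hP (.cond_cons (x := .nil) (x' := .ofNat 1) (.hd (.var _ 0))
      (.cond_cons (x := .nil) (x' := .nil) (.tl (.hd (.var _ 0)))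
        (.cond_nil (.tl (.tl (.hd (.var _ 0))))
          (.cons (.call (.hd (.tl (.var _ 0))) ha') (.call (.tl (.tl (.var _ 0))) hb')))))⟩
    simp only [RTree.numNodes]; omega
  | node3 r s t ih1 ih2 ih3 =>
    obtain ⟨a, ha, ha'⟩ := ih1
    obtain ⟨b, hb, hb'⟩ := ih2
    obtain ⟨c, hc, hc'⟩ := ih3
    refine ⟨_, ?_, Runs.of_body hP (.cond_cons (x := .nil) (x' := .ofNat 2) (.hd (.var _ 0))
      (.cond_cons (x := .nil) (x' := .ofNat 1) (.tl (.hd (.var _ 0)))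
        (.cond_cons (x := .nil) (x' := .nil) (.tl (.tl (.hd (.var _ 0))))
          (.cons (.cons (.call (.hd (.tl (.var _ 0))) ha')
            (.call (.hd (.tl (.tl (.var _ 0)))) hb'))
            (.call (.tl (.tl (.tl (.var _ 0)))) hc')))))⟩
    simp only [RTree.numNodes]; omega

/-- Joins and relabelings are skipped: the algorithm reads edges from the matrix, and labels serve
only to bound the width. -/
theorem exists_program_cwExpr : ∃ P : Program, ∀ (n w : ℕ) (e : CWExpr (Fin n) w),
    ∃ t ≤ 40 * e.numNodes, Runs P (.ofCWExpr e) (enc e.toBin) t := by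
  let F : Term → Term := .call 0
  let x : Term := .var 0
  obtain ⟨P, hP⟩ : ∃ P : Program, P.getD 0 .nil = .cond (.hd x) (.cond (.tl (.hd x))
      (F (.tl (.tl (.tl x)))) (.cons (F (.hd (.tl x))) (F (.tl (.tl x)))))
      (.cons .nil (.hd (.tl x))) := ⟨[_], rfl⟩
  refine ⟨P, fun n w e => ?_⟩
  induction e with
  | single v i => exact ⟨_, by simp [CWExpr.numNodes],
      Runs.of_body hP (.cond_nil (.hd (.var _ 0)) (.cons (.nil _) (.hd (.tl (.var _ 0)))))⟩
  | union a b ih1 ih2 =>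
    obtain ⟨s, hs, hs'⟩ := ih1
    obtain ⟨t, ht, ht'⟩ := ih2
    refine ⟨_, ?_, Runs.of_body hP (.cond_cons (x := .nil) (x' := .nil) (.hd (.var _ 0))
      (.cond_nil (.tl (.hd (.var _ 0)))
        (.cons (.call (.hd (.tl (.var _ 0))) hs') (.call (.tl (.tl (.var _ 0))) ht'))))⟩
    simp only [CWExpr.numNodes]; omega
  | join i j _ a ih =>
    obtain ⟨s, hs, hs'⟩ := ih
    refine ⟨_, ?_, Runs.of_body hP (.cond_cons (x := .nil) (x' := .ofNat 1) (.hd (.var _ 0))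
      (.cond_cons (x := .nil) (x' := .nil) (.tl (.hd (.var _ 0)))
        (.call (.tl (.tl (.tl (.var _ 0)))) hs')))⟩
    simp only [CWExpr.numNodes]; omega
  | relabel i j a ih =>
    obtain ⟨s, hs, hs'⟩ := ih
    refine ⟨_, ?_, Runs.of_body hP (.cond_cons (x := .nil) (x' := .ofNat 2) (.hd (.var _ 0))
      (.cond_cons (x := .nil) (x' := .ofNat 1) (.tl (.hd (.var _ 0)))
        (.call (.tl (.tl (.tl (.var _ 0)))) hs')))⟩
    simp only [CWExpr.numNodes]; omega

/-- The claimed time does not depend on `k`, so `k` cannot be read to its end. The matrix and `k`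
are consumed together, stopping at the shorter one. -/
theorem exists_program_min : ∃ P : Program, ∀ (M : List (List Bool)) (k : ℕ),
    ∃ t ≤ 40 * (M.length + 1), Runs P (enc (M, k)) (enc (min M.length k)) t := by
  let x : Term := .var 0
  obtain ⟨P, hP⟩ : ∃ P : Program, P.getD 0 .nil = .cond (.hd x) (.cond (.tl x)
      (.cons .nil (.call 0 (.cons (.tl (.hd x)) (.tl (.tl x))))) .nil) .nil := ⟨[_], rfl⟩
  refine ⟨P, fun M => ?_⟩
  induction M with
  | nil =>
    intro k
    rw [List.length_nil, Nat.zero_min]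
    refine ⟨_, ?_, Runs.of_body hP (.cond_nil (ρ := [enc (([] : List (List Bool)), k)])
      (.hd (.var _ 0)) (.nil _))⟩
    omega
  | cons r M ih =>
    intro k
    cases k with
    | zero => exact ⟨_, by simp; omega, Runs.of_body hP (.cond_cons (x := enc r) (x' := enc M)
        (.hd (.var _ 0)) (.cond_nil (.tl (.var _ 0)) (.nil _)))⟩
    | succ k =>
      obtain ⟨t, ht, ht'⟩ := ih k
      rw [List.length_cons, Nat.succ_min_succ]
      refine ⟨_, ?_, Runs.of_body hP (.cond_cons (x := enc r) (x' := enc M)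
        (.hd (.var _ 0)) (.cond_cons (x := .nil) (x' := enc k) (.tl (.var _ 0))
          (.cons (.nil _) (.call (.cons (.tl (.hd (.var _ 0))) (.tl (.tl (.var _ 0)))) ht'))))⟩
      omega

/-! ## Correctness of the answer -/

section
variable {n : ℕ} {G : SimpleGraph (Fin n)}

theorem enc_range_map {k : ℕ} {φ : Fin n → Fin k} {ψ : ℕ → ℕ} (h : ∀ v : Fin n, ψ v = φ v) :
    enc ((List.range n).map ψ) = Data.ofColoring φ := by
  simp only [enc, Data.ofColoring]
  congr 1
  refine List.ext_getElem (by simp) fun i h1 h2 => ?_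
  simp only [List.length_map, List.length_range] at h1
  simpa using congrArg Data.ofNat (h ⟨i, h1⟩)

/-- Capping the colors at `n` loses nothing: if `n ≤ k`, giving every vertex its own color refines
any clique coloring. -/
theorem isAnswer_answer {B : BinTree} {k : ℕ} (hk : 0 < k) (hB : B.leaves.Nodup)
    (hmem : ∀ v, v ∈ B.leaves ↔ v < n) :
    IsAnswer G k (enc (answer n (B.value (entryOf (matrix G)) n (min n k)).2)) := by
  have hn : 0 < n := by
    obtain ⟨v, hv⟩ := List.exists_mem_of_length_pos B.length_leaves_pos
    have := (hmem v).mp hv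
    omega
  have hk' : 0 < min n k := by omega
  have hlt : ∀ v ∈ B.leaves, v < n := fun v => (hmem v).mp
  cases h : answer n (B.value (entryOf (matrix G)) n (min n k)).2 with
  | none =>
    refine .inl ⟨?_, rfl⟩
    rintro ⟨φ, hφ⟩
    obtain ⟨χ, hχ⟩ : ∃ χ : Fin n → Fin (min n k), IsCliqueColoring G χ := by
      rcases le_total k n with hkn | hkn
      · refine ⟨fun v => Fin.cast (min_eq_right hkn).symm (φ v), hφ.refine hk fun u v h => ?_⟩
        exact Fin.cast_injective _ h
      · refine ⟨fun v => Fin.cast (min_eq_left hkn).symm v, hφ.refine hk fun u v h => ?_⟩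
        rw [Fin.cast_injective _ h]
    obtain ⟨ψ, hψ⟩ : ∃ ψ : ℕ → ℕ, ∀ v : Fin n, ψ v = χ v :=
      ⟨fun v => if h : v < n then χ ⟨v, h⟩ else 0, fun v => by simp⟩
    refine answer_eq_none entryOf_matrix_symm hB hlt h (fun v hv => ?_)
      ((goodColoring_iff hψ hmem).mpr hχ)
    exact (hψ ⟨v, hlt v hv⟩).trans_lt (χ _).2
  | some l =>
    obtain ⟨ψ, rfl, hψ, hgood⟩ := answer_eq_some entryOf_matrix_symm hk' hB hlt h
    have hcol := (goodColoring_iff (φ := fun v : Fin n => ⟨ψ v, hψ v ((hmem v).mpr v.2)⟩)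
      (fun _ => rfl) hmem).mp hgood
    refine .inr ⟨fun v => ⟨ψ v, (hψ v ((hmem v).mpr v.2)).trans_le (min_le_right _ _)⟩,
      hcol.refine hk' fun u v h => ?_, ?_⟩
    · simpa using h
    · rw [enc_some]
      exact congrArg _ (enc_range_map fun _ => rfl)

end

/-! ## The running time -/

/-- From `n + 2 ≤ n ^ 2`, the total exponent of `n` is at most `2 ^ (1 + 2 * 4 ^ W + 2 * c)`. The
choice of `4 + 2 * c` works because `2 ^ ((4 + 2 * c) * W)` factors as `4 ^ W * 4 ^ W * 4 ^ (c *
W)`, which is at least `4 ^ W * (4 * (c + 1))`. -/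
theorem pairingBound_pow_le {n W c : ℕ} (hn : 2 ≤ n) (hW : 0 < W) :
    (pairingBound n W W + c) ^ c ≤ n ^ 2 ^ 2 ^ ((4 + 2 * c) * W) := by
  have h4 : W < 4 ^ W := Nat.lt_pow_self (by omega)
  have h1 : pairingBound n W W + c ≤ n ^ (2 * 2 ^ (2 * 4 ^ W) + c) := by
    have ha : pairingBound n W W ≤ n ^ (2 * 2 ^ (2 * 4 ^ W)) := by
      rw [pairingBound, ← pow_add, ← two_mul, pow_mul n 2]
      exact Nat.pow_le_pow_left (by nlinarith) _
    have hb : c + 1 ≤ n ^ c := Nat.lt_pow_self (by omega)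
    rw [pow_add]
    have hpos : 1 ≤ n ^ (2 * 2 ^ (2 * 4 ^ W)) := Nat.one_le_pow _ _ (by omega)
    nlinarith
  refine (Nat.pow_le_pow_left h1 c).trans ?_
  rw [← pow_mul]
  refine Nat.pow_le_pow_right (by omega) ?_
  have h2 : 2 * 2 ^ (2 * 4 ^ W) + c ≤ 2 ^ (1 + 2 * 4 ^ W + c) := by
    have : c + 1 ≤ 2 ^ c := Nat.lt_pow_self (by omega)
    have hp : 1 ≤ 2 * 2 ^ (2 * 4 ^ W) := by have := Nat.one_le_two_pow (n := 2 * 4 ^ W); omega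
    rw [pow_add, pow_add, pow_one]
    nlinarith
  calc (2 * 2 ^ (2 * 4 ^ W) + c) * c ≤ 2 ^ (1 + 2 * 4 ^ W + c) * 2 ^ c :=
        Nat.mul_le_mul h2 (Nat.lt_pow_self (by omega)).le
    _ = 2 ^ (1 + 2 * 4 ^ W + 2 * c) := by rw [← pow_add]; ring_nf
    _ ≤ _ := Nat.pow_le_pow_right (by omega) ?_
  have e : 2 ^ ((4 + 2 * c) * W) = 4 ^ W * (4 ^ W * 4 ^ (c * W)) := by
    rw [show (4 : ℕ) = 2 ^ 2 by norm_num, ← pow_mul, ← pow_mul, ← pow_add, ← pow_add]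
    ring_nf
  have hc : c + 1 ≤ 4 ^ (c * W) := by
    have : c * W < 4 ^ (c * W) := Nat.lt_pow_self (by omega)
    rcases Nat.eq_zero_or_pos c with rfl | hc
    · simp
    · nlinarith
  have h4' : 4 ≤ 4 ^ W := by
    calc 4 = 4 ^ 1 := rfl
      _ ≤ _ := Nat.pow_le_pow_right (by omega) hW
  rw [e]
  have h5 : 4 * (c + 1) ≤ 4 ^ W * 4 ^ (c * W) := Nat.mul_le_mul h4' hc
  nlinarith [Nat.mul_le_mul_left (4 ^ W) h5]

theorem exists_program_of_reader (tr : Program) : ∃ (P : Program) (c : ℕ),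
    ∀ (n : ℕ) (G : SimpleGraph (Fin n)) (δ : Data) (B : BinTree) (s k W : ℕ),
      (∃ t ≤ 40 * s, Runs tr δ (enc B) t) → B.leaves.Nodup → (∀ v, v ∈ B.leaves ↔ v < n) →
      n ≤ s → B.WidthLE (entryOf (matrix G)) n W → 0 < k →
      ∃ (output : Data) (t : ℕ), Runs P (.cons (.ofGraph G) (.cons δ (.ofNat k))) output t ∧
        IsAnswer G k output ∧ t ≤ c * s ^ c * n ^ 2 ^ 2 ^ (c * W) := by
  obtain ⟨main, c, hmain⟩ := exists_program_answer
  obtain ⟨cap, hcap⟩ := exists_program_min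
  let x : Term := .var 0
  obtain ⟨P, i, j, l, h0, h1, h2, h3⟩ := exists_link (fun i j l => .call i (.cons
    (.cons (.hd x) (.call j (.cons (.hd x) (.tl (.tl x))))) (.call l (.hd (.tl x))))) main cap tr
  -- The three summands cover the linear overhead, the running time for `n = 1`, and the coefficient
  -- in the exponent from `pairingBound_pow_le`.
  refine ⟨P, 200 + (pairingBound 1 1 1 + c) ^ c + (4 + 2 * c), ?_⟩
  set K := (pairingBound 1 1 1 + c) ^ c
  intro n G δ B s k W ⟨t₁, ht₁, ht₁'⟩ hB hmem hns hW hk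
  have hlt : ∀ v ∈ B.leaves, v < n := fun v => (hmem v).mp
  have hlen : B.leaves.length ≤ n := by
    simpa using (hB.subperm (l₂ := List.range n) fun v hv =>
      List.mem_range.mpr (hlt v hv)).length_le
  have hn : 0 < n := B.length_leaves_pos.trans_le hlen
  have hM := length_matrix G
  obtain ⟨t₂, ht₂, ht₂'⟩ := hcap (matrix G) k
  obtain ⟨t₃, ht₃, ht₃'⟩ := hmain
    { M := matrix G
      k := min (matrix G).length k
      T := B
      W := min W n
      rows := by
        intro r hr
        obtain ⟨i, rfl⟩ := (List.mem_ofFn' _ _).mp hr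
        simp [length_matrix]
      symm := entryOf_matrix_symm
      k_pos := by omega
      k_le := min_le_left _ _
      nodup := hB
      lt := by rwa [hM]
      width := by rw [hM]; exact hW.min hlen }
  have hrun : Runs P (.cons (enc (matrix G)) (.cons δ (.ofNat k))) _ _ :=
    Runs.of_body h0 (.call (.cons (.cons (.hd (.var _ 0))
      (.call (.cons (.hd (.var _ 0)) (.tl (.tl (.var _ 0)))) (h2 _ _ _ ht₂')))
      (.call (.hd (.tl (.var _ 0))) (h3 _ _ _ ht₁')))
      (h1 _ _ _ ht₃'))
  rw [enc_matrix] at hrun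
  refine ⟨_, _, hrun, ?_, ?_⟩
  · simp only [TreeInstance.value, hM]
    exact isAnswer_answer hk hB hmem
  · simp only [TreeInstance.bound, hM] at ht₃ ht₂
    set C := 200 + K + (4 + 2 * c) with hC
    have hW0 := hW.pos
    have hs : s ≤ s ^ C := Nat.le_self_pow (by omega) s
    have hexp : n ^ 2 ^ 2 ^ ((4 + 2 * c) * W) ≤ n ^ 2 ^ 2 ^ (C * W) := by
      refine Nat.pow_le_pow_right hn (Nat.pow_le_pow_right (by omega)
        (Nat.pow_le_pow_right (by omega) (Nat.mul_le_mul_right _ (by omega))))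
    have hK : 0 < n ^ 2 ^ 2 ^ (C * W) := Nat.pow_pos hn
    have ht₃ : t₃ ≤ (K + 1) * n ^ 2 ^ 2 ^ (C * W) := by
      refine ht₃.trans ?_
      -- For `n = 1` the capped width is `1`, so the main program takes at most `K` steps.
      rcases Nat.lt_or_ge n 2 with hn2 | hn2
      · obtain rfl : n = 1 := by omega
        have hW1 : min W 1 = 1 := by omega
        rw [hW1, one_pow]
        omega
      · refine (Nat.pow_le_pow_left (Nat.add_le_add_right (TreeInstance.pairingBound_mono le_rfl
          (min_le_left W n) (min_le_left W n)) c) c).trans ?_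
        refine ((pairingBound_pow_le hn2 hW0).trans hexp).trans ?_
        exact Nat.le_mul_of_pos_left _ (by omega)
    set N := n ^ 2 ^ 2 ^ (C * W)
    have hsN : s * N ≤ s ^ C * N := Nat.mul_le_mul_right _ hs
    have h1 : s ≤ s * N := Nat.le_mul_of_pos_right _ hK
    have h2 : N ≤ s * N := Nat.le_mul_of_pos_left _ (by omega)
    calc _ ≤ 180 * s + t₃ := by omega
      _ ≤ 180 * (s * N) + (K + 1) * (s * N) := by gcongr; exact ht₃.trans (by gcongr)
      _ = (181 + K) * (s * N) := by ring
      _ ≤ C * (s ^ C * N) := Nat.mul_le_mul (by omega) hsN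
      _ = _ := by ring

theorem exists_program_branchDecomposition : ∃ (P : Program) (c : ℕ),
    ∀ (n : ℕ) (G : SimpleGraph (Fin n)) (T : RTree (Fin n)) (k : ℕ),
      IsRootedBranchDecomposition T → 0 < k → ∃ (output : Data) (t : ℕ),
        Runs P (.cons (.ofGraph G) (.cons (.ofTree T) (.ofNat k))) output t ∧
        IsAnswer G k output ∧ t ≤ c * T.numNodes ^ c * n ^ 2 ^ 2 ^ (c * moduleWidth G T) := by
  obtain ⟨tr, htr⟩ := exists_program_tree
  obtain ⟨P, c, hP⟩ := exists_program_of_reader tr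
  -- The binary tree has width at most twice the module-width, which doubles the constant in the
  -- exponent.
  refine ⟨P, 2 * c, fun n G T k hT hk => ?_⟩
  have hmem : ∀ v, v ∈ T.toBin.leaves ↔ v < n := fun v => by
    rw [RTree.leaves_toBin, List.mem_map]
    exact ⟨fun ⟨u, _, hu⟩ => hu ▸ u.2, fun hv => ⟨⟨v, hv⟩, hT.complete _, rfl⟩⟩
  have hn : n ≤ T.numNodes := by
    refine le_trans ?_ T.length_leaves_le
    simpa using (List.nodup_finRange n).subperm (fun v _ => hT.complete v) |>.length_le
  obtain ⟨output, t, hrun, hans, ht⟩ := hP n G _ T.toBin T.numNodes k (2 * moduleWidth G T)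
    (htr n T) (T.leaves_toBin ▸ hT.nodup.map Fin.val_injective) hmem hn
    (RTree.widthLE hT.nodup le_rfl) hk
  have hs : 0 < T.numNodes := by cases T <;> simp [RTree.numNodes]
  refine ⟨output, t, hrun, hans, ht.trans ?_⟩
  rw [show c * (2 * moduleWidth G T) = 2 * c * moduleWidth G T by ring]
  gcongr <;> omega

theorem exists_program_cliqueWidth : ∃ (P : Program) (c : ℕ),
    ∀ (n w : ℕ) (G : SimpleGraph (Fin n)) (e : CWExpr (Fin n) w) (k : ℕ),
      e.Builds G → 0 < k → ∃ (output : Data) (t : ℕ),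
        Runs P (.cons (.ofGraph G) (.cons (.ofCWExpr e) (.ofNat k))) output t ∧
        IsAnswer G k output ∧ t ≤ c * e.numNodes ^ c * n ^ 2 ^ 2 ^ (c * w) := by
  obtain ⟨tr, htr⟩ := exists_program_cwExpr
  obtain ⟨P, c, hP⟩ := exists_program_of_reader tr
  refine ⟨P, c, fun n w G e k he hk => ?_⟩
  have hmem : ∀ v, v ∈ e.toBin.leaves ↔ v < n := fun v => by
    rw [CWExpr.leaves_toBin, List.mem_map]
    exact ⟨fun ⟨u, _, hu⟩ => hu ▸ u.2, fun hv => ⟨⟨v, hv⟩, he.complete _, rfl⟩⟩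
  have hn : n ≤ e.numNodes := by
    refine le_trans ?_ e.length_verts_le
    simpa using (List.nodup_finRange n).subperm (fun v _ => he.complete v) |>.length_le
  exact hP n G _ e.toBin e.numNodes k w (htr n w e)
    (e.leaves_toBin ▸ he.nodup.map Fin.val_injective) hmem hn
    (CWExpr.widthLE he.nodup he.respects) hk

end CliqueCol

theorem theorem4 :
    (∃ (P : CliqueCol.Program) (c : ℕ),
      ∀ (n : ℕ) (G : SimpleGraph (Fin n)) (T : CliqueCol.RTree (Fin n)) (k : ℕ),
        CliqueCol.IsRootedBranchDecomposition T → 0 < k →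
        ∃ (output : CliqueCol.Data) (t : ℕ),
          CliqueCol.Runs P
            (.cons (.ofGraph G) (.cons (.ofTree T) (.ofNat k))) output t ∧
          CliqueCol.IsAnswer G k output ∧
          t ≤ c * T.numNodes ^ c * n ^ (2 ^ (2 ^ (c * CliqueCol.moduleWidth G T)))) ∧
    (∃ (P : CliqueCol.Program) (c : ℕ),
      ∀ (n w : ℕ) (G : SimpleGraph (Fin n)) (e : CliqueCol.CWExpr (Fin n) w) (k : ℕ),
        e.Builds G → 0 < k →
        ∃ (output : CliqueCol.Data) (t : ℕ),
          CliqueCol.Runs P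
            (.cons (.ofGraph G) (.cons (.ofCWExpr e) (.ofNat k))) output t ∧
          CliqueCol.IsAnswer G k output ∧
          t ≤ c * e.numNodes ^ c * n ^ (2 ^ (2 ^ (c * w)))) := by
  exact ⟨CliqueCol.exists_program_branchDecomposition, CliqueCol.exists_program_cliqueWidth⟩
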